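/- **Theorem 1.1 (Exact asymptotics tail $S_u$).** Let $\tau\in(3,4)$, $\alpha=1/(\tau-1)$, $\tilde\beta\in\mathbb R$ and $c_i=i^{-\alpha}$. Let $(T_i)_{i\ge2}$ be independent, $T_i$ exponentially distributed with mean $1/c_i=i^{\alpha}$, and let $$S_t=1+\tilde\beta t+\sum_{i=2}^{\infty}c_i\big[\mathbf 1_{\{T_i\le t\}}-c_it\big]=\lim_{N\to\infty}\Big(1+\tilde\beta t+\sum_{i=2}^{N}c_i\big[\mathbf 1_{\{T_i\le t\}}-c_it\big]\Big),\qquad t\ge0,$$ where, for each $t\ge 0$, the limit exists almost surely. For $\vartheta\in\mathbb R$ and $x>0$ put $$f(x;\vartheta)=\log\!\big(1+e^{-x^{-\alpha}}(e^{-\vartheta x^{-\alpha}}-1)\big)+\vartheta x^{-\alpha}-\vartheta x^{-2\alpha},\qquad \Lambda(\vartheta)=\int_0^\infty f(x;\vartheta)\,dx .$$ The integral $\Lambda(\vartheta)$ converges absolutely for every $\vartheta\in\mathbb R$, and $\Lambda$ has a unique minimizer $\theta^*$; moreover $\theta^*>0$ and $I:=-\Lambda(\theta^*)=-\min\Lambda>0$.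 Put $$I_V(1)=(\tau-1)\int_0^\infty r(v)\,(1-r(v))\,\frac{dv}{v^{\tau-2}},\qquad r(v)=\frac{e^{\theta^*v}(1-e^{-v})}{e^{\theta^*v}(1-e^{-v})+e^{-v}},$$ which is finite and positive, $B=(2\pi I_V(1))^{-1/2}$ and $D=B/\theta^*>0$. The function $h(\varepsilon)=\inf_{\vartheta\in\mathbb R}[\Lambda(\vartheta)+\vartheta\varepsilon]$ is infinitely differentiable at $\varepsilon=0$. With $\zeta$ the (analytically continued) Riemann zeta function, put, for integers $i,j\ge0$, $$\kappa_{ij}=\frac{h^{(i+j)}(0)}{(i+j)!}\binom{i+j}{i}\,\zeta(\alpha)^i\,(\tilde\beta+1-\zeta(2\alpha))^j\in\mathbb R .$$ Then, as $u\to\infty$, $$\mathbb P(S_u>0)=\frac{D}{u^{(\tau-1)/2}}\exp\Big(-Iu^{\tau-1}+u^{\tau-1}\sum_{i,j}\kappa_{ij}\,u^{-i(\tau-2)-j(\tau-3)}\Big)(1+o(1)),$$ where the sum is over the finitely many integers $i,j\ge0$ with $i+j\ge1$ and $\tau-1-i(\tau-2)-j(\tau-3)\ge0$. -/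

import Mathlib

open MeasureTheory ProbabilityTheory Filter Topology
open scoped Asymptotics

namespace ThinnedLevy

/-- The exponent `α = 1 / (τ - 1)`. -/
noncomputable def alpha (τ : ℝ) : ℝ := 1 / (τ - 1)

/-- The coefficients `c_i = i ^ (-α)`. -/
noncomputable def coeff (τ : ℝ) (i : ℕ) : ℝ := (i : ℝ) ^ (-alpha τ)

open Classical in
/-- The partial sum `1 + β t + ∑_{2 ≤ i ≤ N} c_i (1{T_i ≤ t} - c_i t)`. -/
noncomputable def partialProcess {Ω : Type*} (τ β : ℝ) (T : ℕ → Ω → ℝ) (N : ℕ) (t : ℝ) (ω : Ω) :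
    ℝ :=
  1 + β * t + ∑ i ∈ Finset.Icc 2 N, coeff τ i * ((if T i ω ≤ t then 1 else 0) - coeff τ i * t)

/-- The thinned Lévy process `S_t`, the limit of the partial sums. (The series converges almost
surely, but not absolutely, so it is not an unconditional sum.) -/
noncomputable def process {Ω : Type*} (τ β : ℝ) (T : ℕ → Ω → ℝ) (t : ℝ) (ω : Ω) : ℝ :=
  limUnder atTop (fun N : ℕ => partialProcess τ β T N t ω)

/-- `f(x; ϑ) = log (1 + e^{-y} (e^{-ϑ y} - 1)) + ϑ y - ϑ y²` with `y = x ^ (-α)`. -/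
noncomputable def f (τ ϑ x : ℝ) : ℝ :=
  Real.log (1 + Real.exp (-x ^ (-alpha τ)) * (Real.exp (-ϑ * x ^ (-alpha τ)) - 1))
    + ϑ * x ^ (-alpha τ) - ϑ * x ^ (-2 * alpha τ)

/-- `Λ(ϑ) = ∫_0^∞ f(x; ϑ) dx`. -/
noncomputable def Lam (τ ϑ : ℝ) : ℝ := ∫ x in Set.Ioi (0 : ℝ), f τ ϑ x

/-- The ratio `e^{θ v} (1 - e^{-v}) / (e^{θ v} (1 - e^{-v}) + e^{-v})`. -/
noncomputable def tiltRatio (θ v : ℝ) : ℝ :=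
  Real.exp (θ * v) * (1 - Real.exp (-v)) /
    (Real.exp (θ * v) * (1 - Real.exp (-v)) + Real.exp (-v))

/-- The integrand of `I_V(1)`. -/
noncomputable def varIntegrand (τ θ v : ℝ) : ℝ :=
  tiltRatio θ v * (1 - tiltRatio θ v) / v ^ (τ - 2)

/-- The variance constant `I_V(1)`, as a function of the tilt `θ`. -/
noncomputable def varConst (τ θ : ℝ) : ℝ :=
  (τ - 1) * ∫ v in Set.Ioi (0 : ℝ), varIntegrand τ θ v

/-- The minimal value `min_ϑ (Λ(ϑ) + ϑ ε)` of the perturbed variational problem. -/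
noncomputable def perturbedMin (τ ε : ℝ) : ℝ := ⨅ ϑ : ℝ, (Lam τ ϑ + ϑ * ε)

/-- The Riemann zeta function at a real argument. -/
noncomputable def zetaReal (s : ℝ) : ℝ := (riemannZeta (s : ℂ)).re

/-- The constants `κ_ij`: the coefficient of `x ^ i * y ^ j` in the Taylor expansion at `(0, 0)` of
`min_ϑ (Λ(ϑ) + ϑ ε)` at `ε = ζ(α) x + (β + 1 - ζ(2α)) y`. -/
noncomputable def kappa (τ β : ℝ) (i j : ℕ) : ℝ :=
  iteratedDeriv (i + j) (perturbedMin τ) 0 / ((i + j).factorial : ℝ) * ((i + j).choose i : ℝ)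
    * zetaReal (alpha τ) ^ i * (β + 1 - zetaReal (2 * alpha τ)) ^ j

/-- The pairs `(i, j)` with `i + j ≥ 1` for which the power `u ^ (τ - 1 - i (τ - 2) - j (τ - 3))`
does not vanish as `u → ∞` (see `mem_correctionPairs`). -/
noncomputable def correctionPairs (τ : ℝ) : Finset (ℕ × ℕ) :=
  (Finset.range (⌊(τ - 1) / (τ - 3)⌋₊ + 1) ×ˢ Finset.range (⌊(τ - 1) / (τ - 3)⌋₊ + 1)).filter
    fun p => 1 ≤ p.1 + p.2 ∧ 0 ≤ τ - 1 - p.1 * (τ - 2) - p.2 * (τ - 3)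

theorem mem_correctionPairs {τ : ℝ} (hτ : 3 < τ) (p : ℕ × ℕ) :
    p ∈ correctionPairs τ ↔
      1 ≤ p.1 + p.2 ∧ 0 ≤ τ - 1 - p.1 * (τ - 2) - p.2 * (τ - 3) := by
  unfold correctionPairs
  rw [Finset.mem_filter, and_iff_right_iff_imp]
  rintro ⟨-, h⟩
  have h3 : 0 < τ - 3 := by linarith
  have ha : (0 : ℝ) ≤ p.1 := Nat.cast_nonneg _
  have hb : (0 : ℝ) ≤ p.2 := Nat.cast_nonneg _
  rw [Finset.mem_product, Finset.mem_range, Finset.mem_range, Nat.lt_succ_iff, Nat.lt_succ_iff]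
  constructor <;> apply Nat.le_floor <;> rw [le_div_iff₀ h3] <;> nlinarith

/-- The exponent `-I u^{τ-1} + u^{τ-1} ∑ κ_ij u^{-i(τ-2)-j(τ-3)}`. -/
noncomputable def exponent (τ β I u : ℝ) : ℝ :=
  -I * u ^ (τ - 1) + u ^ (τ - 1) *
    ∑ p ∈ correctionPairs τ, kappa τ β p.1 p.2 * u ^ (-(p.1 * (τ - 2)) - p.2 * (τ - 3))

end ThinnedLevy

/-! Write y_i = u c_i. Then u S_u is the drift u(1 + βu) plus a sum of independent terms y_i (1{T_i
≤ u} - y_i), where P(T_i ≤ u) = 1 - e^{-y_i}. Its log-moment generating function is therefore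
explicit, a linear term plus ∑ `cgf ϑ y_i`, and exponential tilting by ϑ turns the indicators into
Bernoulli variables of parameter `tiltRatio ϑ y_i`. With n = u^{τ-1} one has y_i = (i/n)^{-α}, so
every sum over i is a Riemann sum of mesh 1/n. Because 1/3 < α < 1/2, the function min(y², y³) at y
= x^{-α} is integrable on (0, ∞); it dominates all the summands that occur.

The asymptotics come from a saddle point argument of Bahadur–Rao type. Let t(u) be the tilt under
which u S_u has mean zero; t(u) converges to θ, the zero of Λ' (`exists_tilt`). Bromwich inversion
along Re z = t(u) expresses the expectation of a smoothed indicator of {S_u > 0} as e^{logMgf(t(u))}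
times an integral of the tilted characteristic function (`integral_hinge_process`). On the scale
n^{-1/2} that function converges to a Gaussian with variance Λ''(θ) = I_V(1) (`tendsto_tiltChar`),
and `exists_norm_tiltChar_le` supplies an integrable majorant. Removing the smoothing gives P(S_u >
0) ~ e^{logMgf(t(u))} / (θ √(2π n I_V(1))) (`tendsto_measureReal_process`).

It remains to know logMgf(t(u)) up to o(1), for which the leading term nΛ is not enough.
Euler–Maclaurin summation (`exists_abs_tsum_cgf_sub_le`) gives ∑ `cgf ϑ y_i` = nΛ(ϑ) + ϑ u (ζ(α) -
1) - ϑ u² (ζ(2α) - 1) + o(1), uniformly for ϑ in [0, Θ]. Together with the drift this is n(Λ(ϑ) +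
ϑε) + o(1), where ε = `perturbation τ β u` tends to 0. Comparing minima yields logMgf(t(u)) = n h(ε)
+ o(1) (`tendsto_logMgf_sub_perturbedMin`). The function h is smooth at 0, since Λ' extends
holomorphically near θ and Λ''(θ) > 0; the Taylor expansion of h in ε produces the constants κ_ij,
and h(0) = -I. -/

namespace ThinnedLevy

/-! ### The cumulant generating function of a single jump and its tilt -/

/-- The normalised probability weight `1 - e^{-y} + e^{-(1+ϑ)y}` of the tilted Bernoulli law. -/
noncomputable def weight (ϑ y : ℝ) : ℝ := 1 - Real.exp (-y) + Real.exp (-(1 + ϑ) * y)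

/-- The cumulant generating function at `ϑ` of `y (1 - y)` times a Bernoulli variable. -/
noncomputable def cgf (ϑ y : ℝ) : ℝ := Real.log (weight ϑ y) + ϑ * y - ϑ * y ^ 2

/-- The derivative of `cgf` in `ϑ`. -/
noncomputable def dcgf (ϑ y : ℝ) : ℝ := y * (tiltRatio ϑ y - y)

/-- The second derivative of `cgf` in `ϑ`. -/
noncomputable def tiltVar (ϑ y : ℝ) : ℝ := y ^ 2 * (tiltRatio ϑ y * (1 - tiltRatio ϑ y))

/-- The common envelope `min (y ^ 2) (y ^ 3)`. -/
noncomputable def env (y : ℝ) : ℝ := min (y ^ 2) (y ^ 3)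

theorem weight_pos {ϑ y : ℝ} (hy : 0 ≤ y) : 0 < weight ϑ y := by
  have h1 : Real.exp (-y) ≤ 1 := Real.exp_le_one_iff.2 (by linarith)
  have h2 := Real.exp_pos (-(1 + ϑ) * y)
  unfold weight; linarith

theorem tiltRatio_eq (ϑ y : ℝ) : tiltRatio ϑ y = (1 - Real.exp (-y)) / weight ϑ y := by
  have h : Real.exp (ϑ * y) ≠ 0 := (Real.exp_pos _).ne'
  have h2 : Real.exp (ϑ * y) * (1 - Real.exp (-y)) + Real.exp (-y)
      = Real.exp (ϑ * y) * weight ϑ y := by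
    unfold weight
    rw [mul_add, ← Real.exp_add]; ring_nf
  rw [tiltRatio, h2, mul_div_mul_left _ _ h]

theorem one_sub_tiltRatio {ϑ y : ℝ} (hy : 0 ≤ y) :
    1 - tiltRatio ϑ y = Real.exp (-(1 + ϑ) * y) / weight ϑ y := by
  have := (weight_pos (ϑ := ϑ) hy).ne'
  rw [tiltRatio_eq, eq_div_iff this, sub_mul, div_mul_cancel₀ _ this, weight]; ring

theorem tiltRatio_nonneg {ϑ y : ℝ} (hy : 0 ≤ y) : 0 ≤ tiltRatio ϑ y := by
  rw [tiltRatio_eq]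
  have h1 : Real.exp (-y) ≤ 1 := Real.exp_le_one_iff.2 (by linarith)
  exact div_nonneg (by linarith) (weight_pos hy).le

theorem tiltRatio_pos {ϑ y : ℝ} (hy : 0 < y) : 0 < tiltRatio ϑ y := by
  rw [tiltRatio_eq]
  have h1 : Real.exp (-y) < 1 := by rw [← Real.exp_zero]; exact Real.exp_lt_exp.2 (by linarith)
  exact div_pos (by linarith) (weight_pos hy.le)

theorem tiltRatio_lt_one {ϑ y : ℝ} (hy : 0 ≤ y) : tiltRatio ϑ y < 1 := by
  have := one_sub_tiltRatio (ϑ := ϑ) hy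
  have h2 : 0 < Real.exp (-(1 + ϑ) * y) / weight ϑ y := div_pos (Real.exp_pos _) (weight_pos hy)
  linarith

theorem f_eq_cgf {τ ϑ x : ℝ} (hx : 0 < x) : f τ ϑ x = cgf ϑ (x ^ (-alpha τ)) := by
  have h : x ^ (-2 * alpha τ) = (x ^ (-alpha τ)) ^ 2 := by
    rw [← Real.rpow_natCast, ← Real.rpow_mul hx.le]; congr 1; push_cast; ring
  have h2 : Real.exp (-(1 + ϑ) * x ^ (-alpha τ))
      = Real.exp (-x ^ (-alpha τ)) * Real.exp (-ϑ * x ^ (-alpha τ)) := by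
    rw [← Real.exp_add]; ring_nf
  unfold f cgf weight
  rw [h, h2]
  ring_nf

theorem cgf_zero (y : ℝ) : cgf 0 y = 0 := by
  simp [cgf, weight]

theorem hasDerivAt_weight (ϑ y : ℝ) :
    HasDerivAt (fun ϑ => weight ϑ y) (-y * Real.exp (-(1 + ϑ) * y)) ϑ := by
  have h : HasDerivAt (fun ϑ : ℝ => -(1 + ϑ) * y) (-y) ϑ := by
    simpa using (((hasDerivAt_id ϑ).const_add 1).neg.mul_const y)
  simpa [weight, mul_comm] using h.exp.const_add (1 - Real.exp (-y))

theorem hasDerivAt_cgf {y : ℝ} (hy : 0 ≤ y) (ϑ : ℝ) :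
    HasDerivAt (fun ϑ => cgf ϑ y) (dcgf ϑ y) ϑ := by
  have h1 := (hasDerivAt_weight ϑ y).log (weight_pos hy).ne'
  have h2 := (h1.add ((hasDerivAt_id ϑ).mul_const y)).sub ((hasDerivAt_id ϑ).mul_const (y ^ 2))
  refine h2.congr_deriv ?_
  have h3 := one_sub_tiltRatio (ϑ := ϑ) hy
  unfold dcgf
  rw [mul_div_assoc, ← h3]
  ring

theorem hasDerivAt_dcgf {y : ℝ} (hy : 0 ≤ y) (ϑ : ℝ) :
    HasDerivAt (fun ϑ => dcgf ϑ y) (tiltVar ϑ y) ϑ := by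
  have hw := (weight_pos (ϑ := ϑ) hy).ne'
  have h1 := ((((hasDerivAt_const ϑ (1 - Real.exp (-y))).div (hasDerivAt_weight ϑ y) hw).sub_const
    y).const_mul y)
  simp only [dcgf, tiltRatio_eq]
  refine h1.congr_deriv ?_
  unfold tiltVar
  rw [one_sub_tiltRatio hy, tiltRatio_eq]
  field_simp
  ring

theorem tiltVar_pos {ϑ y : ℝ} (hy : 0 < y) : 0 < tiltVar ϑ y := by
  have h1 := tiltRatio_pos (ϑ := ϑ) hy
  have h2 := tiltRatio_lt_one (ϑ := ϑ) hy.le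
  unfold tiltVar
  have : 0 < 1 - tiltRatio ϑ y := by linarith
  positivity

theorem tiltVar_nonneg {ϑ y : ℝ} (hy : 0 ≤ y) : 0 ≤ tiltVar ϑ y := by
  have h1 := tiltRatio_nonneg (ϑ := ϑ) hy
  have h2 := tiltRatio_lt_one (ϑ := ϑ) hy
  unfold tiltVar
  have : 0 < 1 - tiltRatio ϑ y := by linarith
  positivity

theorem strictMono_dcgf {y : ℝ} (hy : 0 < y) : StrictMono (fun ϑ => dcgf ϑ y) :=
  strictMono_of_hasDerivAt_pos (fun ϑ => hasDerivAt_dcgf hy.le ϑ) fun _ => tiltVar_pos hy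

theorem monotone_dcgf {y : ℝ} (hy : 0 ≤ y) : Monotone (fun ϑ => dcgf ϑ y) := by
  rcases hy.eq_or_lt with rfl | hy
  · simp [dcgf, Monotone]
  · exact (strictMono_dcgf hy).monotone

/-- The tangent line inequality for the convex function `cgf · y`. -/
theorem cgf_add_mul_dcgf_le {y : ℝ} (hy : 0 ≤ y) (ϑ₀ ϑ : ℝ) :
    cgf ϑ₀ y + (ϑ - ϑ₀) * dcgf ϑ₀ y ≤ cgf ϑ y := by
  have hc : ConvexOn ℝ Set.univ (fun ϑ => cgf ϑ y) :=
    MonotoneOn.convexOn_of_deriv convex_univ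
      (fun ϑ _ => (hasDerivAt_cgf hy ϑ).continuousAt.continuousWithinAt)
      (fun ϑ _ => (hasDerivAt_cgf hy ϑ).differentiableAt.differentiableWithinAt)
      (by
        intro a _ b _ hab
        rw [(hasDerivAt_cgf hy a).deriv, (hasDerivAt_cgf hy b).deriv]
        exact monotone_dcgf hy hab)
  have hd := hasDerivAt_cgf hy ϑ₀
  rcases lt_trichotomy ϑ ϑ₀ with h | rfl | h
  · have := hc.slope_le_of_hasDerivAt (Set.mem_univ ϑ) (Set.mem_univ ϑ₀) h hd
    rw [slope_def_field, div_le_iff₀ (by linarith)] at this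
    linarith
  · simp
  · have := hc.le_slope_of_hasDerivAt (Set.mem_univ ϑ₀) (Set.mem_univ ϑ) h hd
    rw [slope_def_field, le_div_iff₀ (by linarith)] at this
    linarith

/-! ### The envelope min(y², y³): bounds and integrability -/

theorem env_nonneg {y : ℝ} (hy : 0 ≤ y) : 0 ≤ env y := le_min (by positivity) (by positivity)

theorem env_of_le_one {y : ℝ} (hy : 0 ≤ y) (h : y ≤ 1) : env y = y ^ 3 :=
  min_eq_right (pow_le_pow_of_le_one hy h (by norm_num))

theorem env_of_one_le {y : ℝ} (h : 1 ≤ y) : env y = y ^ 2 :=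
  min_eq_left (pow_le_pow_right₀ h (by norm_num))

theorem monotoneOn_env : MonotoneOn env (Set.Ici 0) := fun _ ha _ _ hab =>
  min_le_min (pow_le_pow_left₀ ha hab 2) (pow_le_pow_left₀ ha hab 3)

theorem continuous_env : Continuous env := by unfold env; fun_prop

/-- The weight is the convex combination of 1 and e^{-ϑy} with coefficients 1 - e^{-y} and e^{-y},
and for y ≤ 1 both points are at least e^{-|ϑ|}. -/
theorem exp_neg_abs_le_weight {ϑ y : ℝ} (hy : 0 ≤ y) (hy1 : y ≤ 1) :
    Real.exp (-|ϑ|) ≤ weight ϑ y := by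
  have h1 : Real.exp (-y) ≤ 1 := Real.exp_le_one_iff.2 (by linarith)
  have h2 : Real.exp (-|ϑ|) ≤ 1 := Real.exp_le_one_iff.2 (by linarith [abs_nonneg ϑ])
  have h3 : Real.exp (-|ϑ|) ≤ Real.exp (-ϑ * y) := by
    apply Real.exp_le_exp.2
    have : ϑ * y ≤ |ϑ| * 1 :=
      mul_le_mul (le_abs_self ϑ) hy1 hy (abs_nonneg _)
    linarith
  have h4 : Real.exp (-(1 + ϑ) * y) = Real.exp (-y) * Real.exp (-ϑ * y) := by
    rw [← Real.exp_add]; ring_nf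
  have h5 := Real.exp_pos (-y)
  unfold weight
  rw [h4]
  nlinarith

theorem abs_exp_sub_one_le' (x : ℝ) : |Real.exp x - 1| ≤ |x| * Real.exp |x| := by
  have h := Real.exp_pos x
  rcases le_total 0 x with hx | hx
  · rw [abs_of_nonneg hx, abs_of_nonneg (by linarith [Real.add_one_le_exp x])]
    have h1 := Real.add_one_le_exp (-x)
    have h2 : Real.exp (-x) * Real.exp x = 1 := by rw [← Real.exp_add]; simp
    nlinarith
  · rw [abs_of_nonpos hx, abs_of_nonpos (by linarith [Real.exp_le_one_iff.2 hx])]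
    have h1 := Real.add_one_le_exp x
    have h2 : 1 ≤ Real.exp (-x) := Real.one_le_exp (by linarith)
    nlinarith

/-- For y ≥ 1 the crude bound |r - y| ≤ 2y suffices. For y ≤ 1 the compensator cancels the leading
term: with p = 1 - e^{-y}, both r - p = p (1 - p)(1 - e^{-ϑy}) / weight and p - y are O(y²), which
leaves y³ after multiplication by y. -/
theorem abs_dcgf_le {ϑ y : ℝ} (hy : 0 ≤ y) :
    |dcgf ϑ y| ≤ (2 + |ϑ| * Real.exp (2 * |ϑ|)) * env y := by
  have hϑ : 0 ≤ |ϑ| * Real.exp (2 * |ϑ|) := by positivity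
  have hr0 := tiltRatio_nonneg (ϑ := ϑ) hy
  have hr1 := tiltRatio_lt_one (ϑ := ϑ) hy
  unfold dcgf
  rw [abs_mul, abs_of_nonneg hy]
  rcases le_total y 1 with h1 | h1
  · rw [env_of_le_one hy h1]
    have key : |tiltRatio ϑ y - y| ≤ (2 + |ϑ| * Real.exp (2 * |ϑ|)) * y ^ 2 := by
      set p := 1 - Real.exp (-y) with hp
      have hp0 : 0 ≤ p := by
        have : Real.exp (-y) ≤ 1 := Real.exp_le_one_iff.2 (by linarith)
        rw [hp]; linarith
      have hpy : p ≤ y := by have := Real.add_one_le_exp (-y); rw [hp]; linarith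
      have hpy2 : y - p ≤ y ^ 2 := by
        have h2 := Real.abs_exp_sub_one_sub_id_le (x := -y) (by rw [abs_neg, abs_of_nonneg hy]; exact h1)
        have := (abs_le.1 h2).2
        rw [hp]; nlinarith
      have hw := weight_pos (ϑ := ϑ) hy
      have hwl := exp_neg_abs_le_weight (ϑ := ϑ) hy h1
      have hid : tiltRatio ϑ y - p = p * ((1 - p) * (1 - Real.exp (-ϑ * y)) / weight ϑ y) := by
        have h4 : Real.exp (-(1 + ϑ) * y) = Real.exp (-y) * Real.exp (-ϑ * y) := by
          rw [← Real.exp_add]; ring_nf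
        rw [tiltRatio_eq, ← hp]
        field_simp
        rw [weight, h4, hp]; ring_nf
      have hb : |tiltRatio ϑ y - p| ≤ y * ((|ϑ| * y * Real.exp |ϑ|) * Real.exp |ϑ|) := by
        rw [hid, abs_mul, abs_of_nonneg hp0]
        apply mul_le_mul hpy _ (abs_nonneg _) hy
        rw [abs_div, abs_of_pos hw, div_le_iff₀ hw]
        have e1 : |(1 - p) * (1 - Real.exp (-ϑ * y))| ≤ |ϑ| * y * Real.exp |ϑ| := by
          rw [abs_mul, abs_sub_comm 1 (Real.exp (-ϑ * y))]
          have e2 := abs_exp_sub_one_le' (-ϑ * y)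
          have e3 : |(-ϑ * y)| = |ϑ| * y := by rw [abs_mul, abs_neg, abs_of_nonneg hy]
          rw [e3] at e2
          have e4 : Real.exp (|ϑ| * y) ≤ Real.exp |ϑ| :=
            Real.exp_le_exp.2 (by nlinarith [abs_nonneg ϑ])
          have e5 : |1 - p| ≤ 1 := by
            rw [abs_le]; constructor <;> linarith
          calc |1 - p| * |Real.exp (-ϑ * y) - 1| ≤ 1 * (|ϑ| * y * Real.exp (|ϑ| * y)) :=
                mul_le_mul e5 e2 (abs_nonneg _) zero_le_one
            _ ≤ _ := by rw [one_mul]; gcongr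
        have e6 : 1 ≤ Real.exp |ϑ| * weight ϑ y := by
          have : Real.exp |ϑ| * Real.exp (-|ϑ|) = 1 := by rw [← Real.exp_add]; simp
          nlinarith [Real.exp_pos |ϑ|]
        calc _ ≤ |ϑ| * y * Real.exp |ϑ| := e1
          _ ≤ |ϑ| * y * Real.exp |ϑ| * (Real.exp |ϑ| * weight ϑ y) :=
              le_mul_of_one_le_right (by positivity) e6
          _ = _ := by ring
      have he : Real.exp |ϑ| * Real.exp |ϑ| = Real.exp (2 * |ϑ|) := by
        rw [← Real.exp_add]; ring_nf
      have hb' : |tiltRatio ϑ y - p| ≤ |ϑ| * Real.exp (2 * |ϑ|) * y ^ 2 := by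
        rw [← he]; linarith
      have hc : |p - y| ≤ y ^ 2 := by rw [abs_le]; constructor <;> nlinarith
      calc |tiltRatio ϑ y - y| ≤ |tiltRatio ϑ y - p| + |p - y| := abs_sub_le _ _ _
        _ ≤ _ := by nlinarith
    calc y * |tiltRatio ϑ y - y| ≤ y * ((2 + |ϑ| * Real.exp (2 * |ϑ|)) * y ^ 2) := by gcongr
      _ = _ := by ring
  · rw [env_of_one_le h1]
    have : |tiltRatio ϑ y - y| ≤ 2 * y := by rw [abs_le]; constructor <;> linarith
    nlinarith [mul_nonneg hϑ (sq_nonneg y)]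

theorem abs_dcgf_le_of_abs_le {ϑ Θ y : ℝ} (hy : 0 ≤ y) (h : |ϑ| ≤ Θ) :
    |dcgf ϑ y| ≤ (2 + Θ * Real.exp (2 * Θ)) * env y := by
  have := env_nonneg hy
  have h0 : 0 ≤ Θ := (abs_nonneg ϑ).trans h
  refine (abs_dcgf_le hy).trans ?_
  gcongr

/-- The function vanishes at ϑ = 0, so the derivative bound integrates to this one. -/
theorem abs_cgf_le {ϑ Θ y : ℝ} (hy : 0 ≤ y) (h : |ϑ| ≤ Θ) :
    |cgf ϑ y| ≤ Θ * (2 + Θ * Real.exp (2 * Θ)) * env y := by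
  have hΘ : 0 ≤ Θ := (abs_nonneg ϑ).trans h
  have hb := Convex.norm_image_sub_le_of_norm_hasDerivWithin_le (f := fun ϑ => cgf ϑ y)
    (f' := fun ϑ => dcgf ϑ y) (C := (2 + Θ * Real.exp (2 * Θ)) * env y) (s := Set.Icc (-Θ) Θ)
    (x := 0) (y := ϑ) (fun t _ => (hasDerivAt_cgf hy t).hasDerivWithinAt)
    (fun t ht => abs_dcgf_le_of_abs_le hy (abs_le.2 ht)) (convex_Icc _ _)
    ⟨by linarith, hΘ⟩ (abs_le.1 h)
  simp only [cgf_zero, sub_zero, Real.norm_eq_abs] at hb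
  refine hb.trans ?_
  have := env_nonneg hy
  calc _ ≤ (2 + Θ * Real.exp (2 * Θ)) * env y * Θ := by gcongr
    _ = _ := by ring

theorem antitoneOn_env_rpow {α : ℝ} (hα : 0 ≤ α) :
    AntitoneOn (fun x : ℝ => env (x ^ (-α))) (Set.Ioi 0) := fun a ha b hb hab =>
  monotoneOn_env (Real.rpow_nonneg (le_of_lt hb) _) (Real.rpow_nonneg (le_of_lt ha) _)
    (Real.rpow_le_rpow_of_nonpos ha hab (by linarith))

theorem env_rpow_le_two {α x : ℝ} (hx : 0 < x) : env (x ^ (-α)) ≤ x ^ (-(2 * α)) := by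
  refine (min_le_left _ _).trans_eq ?_
  rw [← Real.rpow_natCast, ← Real.rpow_mul hx.le]; congr 1; push_cast; ring

theorem env_rpow_le_three {α x : ℝ} (hx : 0 < x) : env (x ^ (-α)) ≤ x ^ (-(3 * α)) := by
  refine (min_le_right _ _).trans_eq ?_
  rw [← Real.rpow_natCast, ← Real.rpow_mul hx.le]; congr 1; push_cast; ring

theorem measurable_env_rpow (α : ℝ) : Measurable (fun x : ℝ => env (x ^ (-α))) :=
  continuous_env.measurable.comp (measurable_id.pow_const _)

/-- Both ends of the range of τ are used here: x^{-2α} is integrable at 0 because α < 1/2, and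
x^{-3α} is integrable at infinity because α > 1/3. -/
theorem integrableOn_env_rpow {α : ℝ} (h1 : 1 / 3 < α) (h2 : α < 1 / 2) :
    IntegrableOn (fun x : ℝ => env (x ^ (-α))) (Set.Ioi 0) := by
  rw [← Set.Ioc_union_Ioi_eq_Ioi (zero_le_one' ℝ)]
  refine IntegrableOn.union ?_ ?_
  · have : IntegrableOn (fun x : ℝ => x ^ (-(2 * α))) (Set.Ioc 0 1) := by
      rw [← intervalIntegrable_iff_integrableOn_Ioc_of_le zero_le_one]
      exact intervalIntegral.intervalIntegrable_rpow' (by linarith)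
    refine Integrable.mono' this (measurable_env_rpow α).aestronglyMeasurable ?_
    filter_upwards [ae_restrict_mem measurableSet_Ioc] with x hx
    rw [Real.norm_of_nonneg (env_nonneg (Real.rpow_nonneg hx.1.le _))]
    exact env_rpow_le_two hx.1
  · have : IntegrableOn (fun x : ℝ => x ^ (-(3 * α))) (Set.Ioi 1) :=
      integrableOn_Ioi_rpow_of_lt (by linarith) zero_lt_one
    refine Integrable.mono' this (measurable_env_rpow α).aestronglyMeasurable ?_
    filter_upwards [ae_restrict_mem measurableSet_Ioi] with x hx
    have hx0 : 0 < x := zero_lt_one.trans hx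
    rw [Real.norm_of_nonneg (env_nonneg (Real.rpow_nonneg hx0.le _))]
    exact env_rpow_le_three hx0

theorem summable_env_rpow {α n : ℝ} (h1 : 1 / 3 < α) (hn : 0 < n) :
    Summable (fun i : ℕ => env ((((i : ℝ) + 2) / n) ^ (-α))) := by
  have h : Summable (fun i : ℕ => (n ^ (-(3 * α)))⁻¹ * ((i + 2 : ℕ) : ℝ) ^ (-(3 * α))) :=
    (((summable_nat_add_iff 2).2 (Real.summable_nat_rpow.2 (by linarith)))).mul_left _
  refine Summable.of_nonneg_of_le (fun i => env_nonneg (Real.rpow_nonneg (by positivity) _))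
    (fun i => ?_) h
  refine (env_rpow_le_three (by positivity)).trans_eq ?_
  rw [Real.div_rpow (by positivity) hn.le]
  push_cast
  ring

/-! ### Riemann sums on the half-line -/

theorem hasSum_integral_floor {F : ℕ → ℝ}
    (h : IntegrableOn (fun x : ℝ => F ⌊x⌋₊) (Set.Ici 0)) :
    HasSum F (∫ x in Set.Ici (0 : ℝ), F ⌊x⌋₊) := by
  have hU : (⋃ i : ℕ, Set.Ico (i : ℝ) (i + 1)) = Set.Ici 0 := by
    ext x
    simp only [Set.mem_iUnion, Set.mem_Ico, Set.mem_Ici]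
    constructor
    · rintro ⟨i, hi, -⟩
      exact (Nat.cast_nonneg i).trans hi
    · intro hx
      exact ⟨⌊x⌋₊, Nat.floor_le hx, Nat.lt_floor_add_one x⟩
  have hfl : ∀ i : ℕ, ∀ x ∈ Set.Ico (i : ℝ) (i + 1), ⌊x⌋₊ = i := fun i x hx =>
    (Nat.floor_eq_iff ((Nat.cast_nonneg i).trans hx.1)).2 hx
  have hs := hasSum_integral_iUnion (μ := volume) (f := fun x : ℝ => F ⌊x⌋₊)
    (s := fun i : ℕ => Set.Ico (i : ℝ) (i + 1)) (fun i => measurableSet_Ico)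
    (by
      intro i j hij
      refine Set.disjoint_left.2 fun x hx hx' => hij ?_
      rw [← hfl i x hx, ← hfl j x hx']) (by rwa [hU])
  rw [hU] at hs
  have he : (fun i : ℕ => ∫ x in Set.Ico (i : ℝ) (i + 1), F ⌊x⌋₊) = F := by
    funext i
    rw [setIntegral_congr_fun measurableSet_Ico (g := fun _ => F i)
      (fun x hx => by simp only [hfl i x hx])]
    simp
  rwa [he] at hs

/-- Convergence of Riemann sums on `(0, ∞)` under an antitone integrable envelope. -/
theorem tendsto_riemann_sum {ι : Type*} {l : Filter ι} [l.IsCountablyGenerated]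
    {q : ι → ℝ → ℝ} {q₀ D : ℝ → ℝ} {n : ι → ℝ} (hn : Tendsto n l atTop)
    (hD : AntitoneOn D (Set.Ioi 0)) (hDi : IntegrableOn D (Set.Ioi 0))
    (hq : ∀ᶠ k in l, ∀ x > 0, |q k x| ≤ D x)
    (hlim : ∀ x > 0, ∀ w : ι → ℝ, Tendsto w l (𝓝 x) →
      Tendsto (fun k => q k (w k)) l (𝓝 (q₀ x))) :
    Tendsto (fun k => (∑' i : ℕ, q k (((i : ℝ) + 2) / n k)) / n k) l
      (𝓝 (∫ x in Set.Ioi (0 : ℝ), q₀ x)) := by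
  have hmeas : ∀ k, Measurable (fun x : ℝ => q k (((⌊n k * x⌋₊ : ℝ) + 2) / n k)) := fun k =>
    (measurable_from_top (f := fun i : ℕ => q k (((i : ℝ) + 2) / n k))).comp
      (Nat.measurable_floor.comp (measurable_const_mul (n k)))
  -- The sum is treated as the integral of a step function. Its node lies to the right of x, so an
  -- antitone envelope at the node is at most its value at x; the shift by 2 reflects that the jumps
  -- start at index 2.
  have hle : ∀ k, 0 < n k → ∀ x > 0, x ≤ ((⌊n k * x⌋₊ : ℝ) + 2) / n k := by
    intro k hk x hx
    rw [le_div_iff₀ hk]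
    have := Nat.lt_floor_add_one (n k * x)
    linarith
  have hbound : ∀ᶠ k in l, ∀ x > 0, |q k (((⌊n k * x⌋₊ : ℝ) + 2) / n k)| ≤ D x := by
    filter_upwards [hq, hn.eventually_gt_atTop 0] with k hk hk0 x hx
    have h1 := hle k hk0 x hx
    have h2 : 0 < ((⌊n k * x⌋₊ : ℝ) + 2) / n k := by positivity
    exact (hk _ h2).trans (hD hx h2 h1)
  have key : Tendsto (fun k => ∫ x in Set.Ioi (0 : ℝ), q k (((⌊n k * x⌋₊ : ℝ) + 2) / n k)) l
      (𝓝 (∫ x in Set.Ioi (0 : ℝ), q₀ x)) := by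
    refine tendsto_integral_filter_of_dominated_convergence D
      (Eventually.of_forall fun k => (hmeas k).aestronglyMeasurable) ?_ hDi ?_
    · filter_upwards [hbound] with k hk
      filter_upwards [ae_restrict_mem measurableSet_Ioi] with x hx
      exact hk x hx
    · filter_upwards [ae_restrict_mem measurableSet_Ioi] with x hx
      refine hlim x hx _ ?_
      have hup : Tendsto (fun k => x + 2 / n k) l (𝓝 x) := by
        simpa using (tendsto_const_nhds (x := x)).add (hn.const_div_atTop 2)
      refine tendsto_of_tendsto_of_tendsto_of_le_of_le' tendsto_const_nhds hup ?_ ?_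
      · filter_upwards [hn.eventually_gt_atTop 0] with k hk using hle k hk x hx
      · filter_upwards [hn.eventually_gt_atTop 0] with k hk
        have h0 : (0 : ℝ) < x := hx
        have := Nat.floor_le (a := n k * x) (by positivity)
        rw [add_div, add_le_add_iff_right, div_le_iff₀ hk]
        linarith
  refine key.congr' ?_
  filter_upwards [hbound, hn.eventually_gt_atTop 0] with k hk hk0
  have hint : IntegrableOn (fun x : ℝ => q k (((⌊n k * x⌋₊ : ℝ) + 2) / n k)) (Set.Ioi 0) := by
    refine Integrable.mono' hDi (hmeas k).aestronglyMeasurable ?_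
    filter_upwards [ae_restrict_mem measurableSet_Ioi] with x hx
    exact hk x hx
  -- Rescaling by n makes the integrand constant on each [i, i + 1), so its integral is the series;
  -- the Jacobian is the factor 1/n.
  have h1 := integral_comp_mul_left_Ioi (fun x : ℝ => q k (((⌊x⌋₊ : ℝ) + 2) / n k)) 0 hk0
  have h2 := integrableOn_Ioi_comp_mul_left_iff (fun x : ℝ => q k (((⌊x⌋₊ : ℝ) + 2) / n k)) 0 hk0
  rw [mul_zero] at h1 h2
  have h3 := hasSum_integral_floor (F := fun i : ℕ => q k (((i : ℝ) + 2) / n k))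
    ((integrableOn_Ici_iff_integrableOn_Ioi).2 (h2.1 hint))
  rw [h1, h3.tsum_eq, integral_Ici_eq_integral_Ioi, smul_eq_mul]
  ring

/-! ### The limiting function Λ, its derivatives and its minimiser -/

theorem setIntegral_Ioi_pos {g : ℝ → ℝ} (hg : ∀ x > 0, 0 < g x)
    (hi : IntegrableOn g (Set.Ioi 0)) : 0 < ∫ x in Set.Ioi (0 : ℝ), g x := by
  rw [setIntegral_pos_iff_support_of_nonneg_ae _ hi]
  · have : Set.Ioi (0 : ℝ) ⊆ Function.support g ∩ Set.Ioi 0 := fun x hx => ⟨(hg x hx).ne', hx⟩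
    refine lt_of_lt_of_le ?_ (measure_mono this)
    simp
  · filter_upwards [ae_restrict_mem measurableSet_Ioi] with x hx using (hg x hx).le

theorem measurable_tiltRatio (ϑ : ℝ) : Measurable (tiltRatio ϑ) := by
  unfold tiltRatio; fun_prop

theorem measurable_cgf (ϑ : ℝ) : Measurable (cgf ϑ) := by
  unfold cgf weight; fun_prop

theorem measurable_dcgf (ϑ : ℝ) : Measurable (dcgf ϑ) := by
  have := measurable_tiltRatio ϑ
  unfold dcgf; fun_prop

theorem measurable_tiltVar (ϑ : ℝ) : Measurable (tiltVar ϑ) := by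
  have := measurable_tiltRatio ϑ
  unfold tiltVar; fun_prop

/-- For y ≤ 1 one has y² r = y³ + y · `dcgf`, so the bound on `dcgf` applies; for y ≥ 1 use r (1 -
r) ≤ 1. -/
theorem tiltVar_le {ϑ Θ y : ℝ} (hy : 0 ≤ y) (h : |ϑ| ≤ Θ) :
    tiltVar ϑ y ≤ (3 + Θ * Real.exp (2 * Θ)) * env y := by
  have hΘ : 0 ≤ Θ := (abs_nonneg ϑ).trans h
  have hC : 0 ≤ Θ * Real.exp (2 * Θ) := by positivity
  have hr0 := tiltRatio_nonneg (ϑ := ϑ) hy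
  have hr1 := tiltRatio_lt_one (ϑ := ϑ) hy
  have hb := (abs_le.1 (abs_dcgf_le_of_abs_le hy h)).2
  unfold dcgf at hb
  unfold tiltVar
  set r := tiltRatio ϑ y
  have hrr : r * (1 - r) ≤ r := by nlinarith
  rcases le_total y 1 with h1 | h1
  · rw [env_of_le_one hy h1] at *
    have h2 : y ^ 2 * r ≤ y ^ 3 + (2 + Θ * Real.exp (2 * Θ)) * y ^ 3 := by
      have : y * (y * (r - y)) ≤ y * ((2 + Θ * Real.exp (2 * Θ)) * y ^ 3) := by gcongr
      have h3 : y * ((2 + Θ * Real.exp (2 * Θ)) * y ^ 3)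
          ≤ 1 * ((2 + Θ * Real.exp (2 * Θ)) * y ^ 3) := by gcongr
      nlinarith
    have h3 : y ^ 2 * (r * (1 - r)) ≤ y ^ 2 * r := by gcongr
    linarith
  · rw [env_of_one_le h1]
    have : y ^ 2 * (r * (1 - r)) ≤ y ^ 2 * 1 := by gcongr; linarith
    nlinarith [mul_nonneg hC (sq_nonneg y)]

section

variable {α : ℝ}

theorem integrableOn_of_le_env {g : ℝ → ℝ} {C : ℝ} (h1 : 1 / 3 < α) (h2 : α < 1 / 2)
    (hg : Measurable g) (hb : ∀ y, 0 ≤ y → |g y| ≤ C * env y) :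
    IntegrableOn (fun x : ℝ => g (x ^ (-α))) (Set.Ioi 0) := by
  refine Integrable.mono' ((integrableOn_env_rpow h1 h2).const_mul C)
    (hg.comp (measurable_id.pow_const _)).aestronglyMeasurable ?_
  filter_upwards [ae_restrict_mem measurableSet_Ioi] with x hx
  exact hb _ (Real.rpow_nonneg (le_of_lt hx) _)

theorem integrableOn_cgf (h1 : 1 / 3 < α) (h2 : α < 1 / 2) (ϑ : ℝ) :
    IntegrableOn (fun x : ℝ => cgf ϑ (x ^ (-α))) (Set.Ioi 0) :=
  integrableOn_of_le_env h1 h2 (measurable_cgf ϑ) fun _ hy => abs_cgf_le hy le_rfl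

theorem integrableOn_dcgf (h1 : 1 / 3 < α) (h2 : α < 1 / 2) (ϑ : ℝ) :
    IntegrableOn (fun x : ℝ => dcgf ϑ (x ^ (-α))) (Set.Ioi 0) :=
  integrableOn_of_le_env h1 h2 (measurable_dcgf ϑ) fun _ hy => abs_dcgf_le hy

theorem integrableOn_tiltVar (h1 : 1 / 3 < α) (h2 : α < 1 / 2) (ϑ : ℝ) :
    IntegrableOn (fun x : ℝ => tiltVar ϑ (x ^ (-α))) (Set.Ioi 0) :=
  integrableOn_of_le_env h1 h2 (measurable_tiltVar ϑ) fun _ hy => by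
    rw [abs_of_nonneg (tiltVar_nonneg hy)]; exact tiltVar_le hy le_rfl

/-- The limiting cumulant generating function, as a function of the exponent `α`. -/
noncomputable def cgfInt (α ϑ : ℝ) : ℝ := ∫ x in Set.Ioi (0 : ℝ), cgf ϑ (x ^ (-α))

/-- The derivative of `cgfInt`. -/
noncomputable def dcgfInt (α ϑ : ℝ) : ℝ := ∫ x in Set.Ioi (0 : ℝ), dcgf ϑ (x ^ (-α))

/-- The second derivative of `cgfInt`. -/
noncomputable def tiltVarInt (α ϑ : ℝ) : ℝ := ∫ x in Set.Ioi (0 : ℝ), tiltVar ϑ (x ^ (-α))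

theorem Lam_eq_cgfInt (τ ϑ : ℝ) : Lam τ ϑ = cgfInt (alpha τ) ϑ :=
  setIntegral_congr_fun measurableSet_Ioi fun _ hx => f_eq_cgf hx

theorem hasDerivAt_cgfInt (h1 : 1 / 3 < α) (h2 : α < 1 / 2) (ϑ : ℝ) :
    HasDerivAt (cgfInt α) (dcgfInt α ϑ) ϑ := by
  refine (hasDerivAt_integral_of_dominated_loc_of_deriv_le (μ := volume.restrict (Set.Ioi 0))
    (F := fun ϑ x => cgf ϑ (x ^ (-α))) (F' := fun ϑ x => dcgf ϑ (x ^ (-α))) (x₀ := ϑ)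
    (s := Metric.ball ϑ 1)
    (bound := fun x => (2 + (|ϑ| + 1) * Real.exp (2 * (|ϑ| + 1))) * env (x ^ (-α)))
    (Metric.ball_mem_nhds _ one_pos)
    (Eventually.of_forall fun t => (integrableOn_cgf h1 h2 t).aestronglyMeasurable)
    (integrableOn_cgf h1 h2 ϑ) (integrableOn_dcgf h1 h2 ϑ).aestronglyMeasurable ?_
    ((integrableOn_env_rpow h1 h2).const_mul _) ?_).2
  · filter_upwards [ae_restrict_mem measurableSet_Ioi] with x hx t ht
    refine abs_dcgf_le_of_abs_le (Real.rpow_nonneg (le_of_lt hx) _) ?_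
    have := abs_sub_abs_le_abs_sub t ϑ
    rw [Metric.mem_ball, Real.dist_eq] at ht
    linarith
  · filter_upwards [ae_restrict_mem measurableSet_Ioi] with x hx t ht
    exact hasDerivAt_cgf (Real.rpow_nonneg (le_of_lt hx) _) t

theorem hasDerivAt_dcgfInt (h1 : 1 / 3 < α) (h2 : α < 1 / 2) (ϑ : ℝ) :
    HasDerivAt (dcgfInt α) (tiltVarInt α ϑ) ϑ := by
  refine (hasDerivAt_integral_of_dominated_loc_of_deriv_le (μ := volume.restrict (Set.Ioi 0))
    (F := fun ϑ x => dcgf ϑ (x ^ (-α))) (F' := fun ϑ x => tiltVar ϑ (x ^ (-α))) (x₀ := ϑ)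
    (s := Metric.ball ϑ 1)
    (bound := fun x => (3 + (|ϑ| + 1) * Real.exp (2 * (|ϑ| + 1))) * env (x ^ (-α)))
    (Metric.ball_mem_nhds _ one_pos)
    (Eventually.of_forall fun t => (integrableOn_dcgf h1 h2 t).aestronglyMeasurable)
    (integrableOn_dcgf h1 h2 ϑ) (integrableOn_tiltVar h1 h2 ϑ).aestronglyMeasurable ?_
    ((integrableOn_env_rpow h1 h2).const_mul _) ?_).2
  · filter_upwards [ae_restrict_mem measurableSet_Ioi] with x hx t ht
    have hy := Real.rpow_nonneg (le_of_lt hx) (-α)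
    rw [Real.norm_of_nonneg (tiltVar_nonneg hy)]
    refine tiltVar_le hy ?_
    have := abs_sub_abs_le_abs_sub t ϑ
    rw [Metric.mem_ball, Real.dist_eq] at ht
    linarith
  · filter_upwards [ae_restrict_mem measurableSet_Ioi] with x hx t ht
    exact hasDerivAt_dcgf (Real.rpow_nonneg (le_of_lt hx) _) t

theorem tiltVarInt_pos (h1 : 1 / 3 < α) (h2 : α < 1 / 2) (ϑ : ℝ) : 0 < tiltVarInt α ϑ :=
  setIntegral_Ioi_pos (fun _ hx => tiltVar_pos (Real.rpow_pos_of_pos hx _))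
    (integrableOn_tiltVar h1 h2 ϑ)

theorem strictMono_dcgfInt (h1 : 1 / 3 < α) (h2 : α < 1 / 2) : StrictMono (dcgfInt α) :=
  strictMono_of_hasDerivAt_pos (hasDerivAt_dcgfInt h1 h2) (tiltVarInt_pos h1 h2)

theorem cgfInt_zero (α : ℝ) : cgfInt α 0 = 0 := by simp [cgfInt, cgf_zero]

/-- The derivative `dcgfInt α t + e` is strictly increasing and vanishes at ϑ₀. The linear term is
kept because the case e = 0 identifies θ and small e gives the perturbed problem. -/
theorem cgfInt_lt {ϑ₀ ϑ e : ℝ} (h1 : 1 / 3 < α) (h2 : α < 1 / 2) (h0 : dcgfInt α ϑ₀ = -e)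
    (hne : ϑ ≠ ϑ₀) : cgfInt α ϑ₀ + ϑ₀ * e < cgfInt α ϑ + ϑ * e := by
  have hd : ∀ t, HasDerivAt (fun t => cgfInt α t + t * e) (dcgfInt α t + e) t := fun t =>
    ((hasDerivAt_cgfInt h1 h2 t).add ((hasDerivAt_id t).mul_const e)).congr_deriv (by simp)
  have hm := strictMono_dcgfInt h1 h2
  have hcont : Continuous (fun t => cgfInt α t + t * e) :=
    continuous_iff_continuousAt.2 fun t => (hd t).continuousAt
  rcases lt_or_gt_of_ne hne with h | h
  · refine strictAntiOn_of_deriv_neg (convex_Iic ϑ₀) hcont.continuousOn (fun t ht => ?_)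
      h.le (Set.mem_Iic.2 le_rfl) h
    rw [interior_Iic] at ht
    rw [(hd t).deriv]
    have := hm ht
    linarith
  · refine strictMonoOn_of_deriv_pos (convex_Ici ϑ₀) hcont.continuousOn (fun t ht => ?_)
      (Set.mem_Ici.2 le_rfl) h.le h
    rw [interior_Ici] at ht
    rw [(hd t).deriv]
    have := hm ht
    linarith

/-- Untilted, r = 1 - e^{-y} < y, so the integrand is negative everywhere. This forces the minimiser
to be positive. -/
theorem dcgfInt_zero_neg (h1 : 1 / 3 < α) (h2 : α < 1 / 2) : dcgfInt α 0 < 0 := by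
  have := setIntegral_Ioi_pos (g := fun x : ℝ => -dcgf 0 (x ^ (-α))) (fun x hx => by
    have hy : 0 < x ^ (-α) := Real.rpow_pos_of_pos hx _
    have h3 := Real.add_one_lt_exp (x := -x ^ (-α)) (by linarith)
    have h4 : tiltRatio 0 (x ^ (-α)) = 1 - Real.exp (-x ^ (-α)) := by simp [tiltRatio]
    unfold dcgf
    rw [h4]
    nlinarith) (integrableOn_dcgf h1 h2 0).neg
  rw [integral_neg] at this
  unfold dcgfInt
  linarith

theorem tendsto_tiltRatio_atTop {y : ℝ} (hy : 0 < y) :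
    Tendsto (fun k : ℕ => tiltRatio (k : ℝ) y) atTop (𝓝 1) := by
  simp only [tiltRatio_eq, weight]
  have hp : (1 : ℝ) - Real.exp (-y) ≠ 0 := by
    have : Real.exp (-y) < 1 := by rw [← Real.exp_zero]; exact Real.exp_lt_exp.2 (by linarith)
    linarith
  have h1 : Tendsto (fun k : ℕ => Real.exp (-(1 + (k : ℝ)) * y)) atTop (𝓝 0) := by
    refine Real.tendsto_exp_atBot.comp ?_
    refine Tendsto.atBot_mul_const hy ?_
    exact tendsto_neg_atTop_atBot.comp
      (tendsto_atTop_add_const_left _ _ tendsto_natCast_atTop_atTop)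
  have h2 := (tendsto_const_nhds (x := 1 - Real.exp (-y))).div
    ((tendsto_const_nhds (x := 1 - Real.exp (-y))).add h1) (by simpa using hp)
  rw [add_zero, div_self hp] at h2
  exact h2

/-- At infinity the integrand behaves like x^{-α}, and α < 1. -/
theorem not_integrableOn_rpow_sub (h1 : 0 < α) (h2 : α < 1 / 2) :
    ¬ IntegrableOn (fun x : ℝ => x ^ (-α) * (1 - x ^ (-α))) (Set.Ioi 0) := by
  intro h
  -- Beyond this point x^{-α} ≤ 1/2, so the integrand is at least x^{-α} / 2.
  have hc : (0 : ℝ) < 2 ^ (1 / α) := by positivity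
  have h3 : IntegrableOn (fun x : ℝ => x ^ (-α)) (Set.Ioi (2 ^ (1 / α))) := by
    refine Integrable.mono' ((h.mono_set (Set.Ioi_subset_Ioi hc.le)).const_mul 2)
      (measurable_id.pow_const _).aestronglyMeasurable ?_
    filter_upwards [ae_restrict_mem measurableSet_Ioi] with x hx
    have hx0 : 0 < x := hc.trans hx
    have hy : 0 < x ^ (-α) := Real.rpow_pos_of_pos hx0 _
    have hy2 : x ^ (-α) ≤ 1 / 2 := by
      have := Real.rpow_le_rpow_of_nonpos hc (le_of_lt hx) (z := -α) (by linarith)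
      rw [← Real.rpow_mul (by norm_num)] at this
      have e : 1 / α * -α = -1 := by field_simp
      rw [e, Real.rpow_neg_one] at this
      linarith
    rw [Real.norm_of_nonneg hy.le]
    nlinarith
  rw [integrableOn_Ioi_rpow_iff hc] at h3
  linarith

/-- As ϑ → ∞ the ratio r tends to 1 and `dcgf` increases to y(1 - y), whose integral diverges at
infinity. If the integrals stayed nonpositive, Fatou's lemma applied to the nonnegative increments
from ϑ = 0 would make this limit integrable. -/
theorem exists_dcgfInt_pos (h1 : 1 / 3 < α) (h2 : α < 1 / 2) : ∃ ϑ, 0 < dcgfInt α ϑ := by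
  by_contra! hneg
  refine not_integrableOn_rpow_sub (by linarith) h2 ?_
  set g : ℕ → ℝ → ℝ := fun k x => dcgf k (x ^ (-α)) - dcgf 0 (x ^ (-α)) with hg
  set G : ℝ → ℝ := fun x => x ^ (-α) * (1 - x ^ (-α)) - dcgf 0 (x ^ (-α)) with hG
  have hgint : ∀ k, IntegrableOn (g k) (Set.Ioi 0) := fun k =>
    (integrableOn_dcgf h1 h2 k).sub (integrableOn_dcgf h1 h2 0)
  have hgm : ∀ k, Measurable (g k) := fun k =>
    ((measurable_dcgf k).comp (measurable_id.pow_const _)).sub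
      ((measurable_dcgf 0).comp (measurable_id.pow_const _))
  have hg0 : ∀ k, ∀ x > 0, 0 ≤ g k x := fun k x hx =>
    sub_nonneg.2 (monotone_dcgf (Real.rpow_nonneg hx.le _) (Nat.cast_nonneg k))
  have hlim : ∀ x > 0, Tendsto (fun k => g k x) atTop (𝓝 (G x)) := fun x hx =>
    (((tendsto_tiltRatio_atTop (Real.rpow_pos_of_pos hx _)).sub_const _).const_mul _).sub_const _
  have hGm : Measurable G := by
    have := (measurable_dcgf 0).comp (measurable_id.pow_const (-α) : Measurable fun x : ℝ => x ^ (-α))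
    exact (((measurable_id.pow_const _).mul ((measurable_id.pow_const _).const_sub 1))).sub this
  have hGint : IntegrableOn G (Set.Ioi 0) := by
    refine ⟨hGm.aestronglyMeasurable, ?_⟩
    rw [hasFiniteIntegral_iff_ofReal (by
      filter_upwards [ae_restrict_mem measurableSet_Ioi] with x hx
      exact ge_of_tendsto' (hlim x hx) fun k => hg0 k x hx)]
    have h3 : ∫⁻ x in Set.Ioi (0 : ℝ), ENNReal.ofReal (G x)
        = ∫⁻ x in Set.Ioi (0 : ℝ), liminf (fun k => ENNReal.ofReal (g k x)) atTop := by
      refine setLIntegral_congr_fun measurableSet_Ioi fun x hx => ?_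
      exact ((ENNReal.continuous_ofReal.tendsto _).comp (hlim x hx)).liminf_eq.symm
    rw [h3]
    refine (lintegral_liminf_le fun k => (hgm k).ennreal_ofReal).trans_lt ?_
    have h4 : ∀ k, ∫⁻ x in Set.Ioi (0 : ℝ), ENNReal.ofReal (g k x)
        ≤ ENNReal.ofReal (-dcgfInt α 0) := fun k => by
      rw [← ofReal_integral_eq_lintegral_ofReal (hgint k) (by
        filter_upwards [ae_restrict_mem measurableSet_Ioi] with x hx using hg0 k x hx)]
      refine ENNReal.ofReal_le_ofReal ?_
      rw [hg, integral_sub (integrableOn_dcgf h1 h2 k) (integrableOn_dcgf h1 h2 0)]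
      have := hneg k
      unfold dcgfInt at *
      linarith
    refine lt_of_le_of_lt ?_ (ENNReal.ofReal_lt_top (r := -dcgfInt α 0))
    exact (liminf_le_liminf (Eventually.of_forall h4)).trans_eq (liminf_const _)
  have := hGint.add (integrableOn_dcgf h1 h2 0)
  refine this.congr (Eventually.of_forall fun x => ?_)
  simp [hG]

theorem exists_pos_dcgfInt_eq_zero (h1 : 1 / 3 < α) (h2 : α < 1 / 2) :
    ∃ θ, 0 < θ ∧ dcgfInt α θ = 0 := by
  obtain ⟨ϑ, hϑ⟩ := exists_dcgfInt_pos h1 h2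
  have h0 := dcgfInt_zero_neg h1 h2
  have hm := strictMono_dcgfInt h1 h2
  have hpos : 0 < ϑ := hm.lt_iff_lt.1 (h0.trans hϑ)
  have hc : Continuous (dcgfInt α) :=
    continuous_iff_continuousAt.2 fun t => (hasDerivAt_dcgfInt h1 h2 t).continuousAt
  obtain ⟨θ, hθ, hz⟩ := intermediate_value_Icc hpos.le hc.continuousOn
    (show (0 : ℝ) ∈ Set.Icc (dcgfInt α 0) (dcgfInt α ϑ) from ⟨h0.le, hϑ.le⟩)
  refine ⟨θ, lt_of_le_of_ne hθ.1 ?_, hz⟩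
  rintro rfl
  linarith

end

/-! ### The zeta function in the critical strip as a limit of corrected power sums -/

/-- `(1 - s)` times the difference of `m ^ (-s)` and `∫_m^{m+1} x ^ (-s) dx`, where `m = i + 1`. -/
noncomputable def zetaTerm (i : ℕ) (s : ℂ) : ℂ :=
  (1 - s) * ((i + 1 : ℝ) : ℂ) ^ (-s) - (((i + 2 : ℝ) : ℂ) ^ (1 - s) - ((i + 1 : ℝ) : ℂ) ^ (1 - s))

theorem differentiable_zetaTerm (i : ℕ) : Differentiable ℂ (zetaTerm i) := by
  have h1 : ((i + 1 : ℝ) : ℂ) ≠ 0 := by exact_mod_cast (by positivity : (i + 1 : ℝ) ≠ 0)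
  have h2 : ((i + 2 : ℝ) : ℂ) ≠ 0 := by exact_mod_cast (by positivity : (i + 2 : ℝ) ≠ 0)
  unfold zetaTerm
  intro s
  refine DifferentiableAt.sub (DifferentiableAt.mul (by fun_prop) ?_) (DifferentiableAt.sub ?_ ?_)
  all_goals exact DifferentiableAt.const_cpow (by fun_prop) (Or.inl ‹_›)

theorem hasDerivAt_ofReal_cpow_neg {x : ℝ} (hx : 0 < x) (s : ℂ) :
    HasDerivAt (fun y : ℝ => (y : ℂ) ^ (-s)) (-s * (x : ℂ) ^ (-s - 1)) x := by
  simpa using ((hasDerivAt_id (x : ℂ)).cpow_const (c := -s) (Or.inl (by simpa using hx))).comp_ofReal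

theorem hasDerivAt_ofReal_cpow_one_sub {x : ℝ} (hx : 0 < x) (s : ℂ) :
    HasDerivAt (fun y : ℝ => (y : ℂ) ^ (1 - s)) ((1 - s) * (x : ℂ) ^ (-s)) x := by
  have h := ((hasDerivAt_id (x : ℂ)).cpow_const (c := 1 - s)
    (Or.inl (by simpa using hx))).comp_ofReal
  have e : 1 - s - 1 = -s := by ring
  simpa [e] using h

/-- Two applications of the mean value inequality on [m, m + 1]: first to x^{-s}, then to x^{1-s}
minus its tangent line at m. The gain of one power of m makes the series converge for Re s > 0. -/
theorem norm_zetaTerm_le (i : ℕ) {s : ℂ} (hs : 0 ≤ s.re) :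
    ‖zetaTerm i s‖ ≤ ‖1 - s‖ * ‖s‖ * (i + 1 : ℝ) ^ (-s.re - 1) := by
  set m : ℝ := i + 1 with hm
  have hm0 : 0 < m := by positivity
  have hpos : ∀ x ∈ Set.Icc m (m + 1), 0 < x := fun x hx => hm0.trans_le hx.1
  have hA : ∀ x ∈ Set.Icc m (m + 1),
      ‖(x : ℂ) ^ (-s) - (m : ℂ) ^ (-s)‖ ≤ ‖s‖ * m ^ (-s.re - 1) := by
    intro x hx
    have := Convex.norm_image_sub_le_of_norm_hasDerivWithin_le (f := fun y : ℝ => (y : ℂ) ^ (-s))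
      (f' := fun y : ℝ => -s * (y : ℂ) ^ (-s - 1)) (C := ‖s‖ * m ^ (-s.re - 1))
      (s := Set.Icc m (m + 1)) (x := m) (y := x)
      (fun y hy => (hasDerivAt_ofReal_cpow_neg (hpos y hy) s).hasDerivWithinAt)
      (fun y hy => by
        rw [norm_mul, norm_neg, Complex.norm_cpow_eq_rpow_re_of_pos (hpos y hy)]
        refine mul_le_mul_of_nonneg_left ?_ (norm_nonneg _)
        exact Real.rpow_le_rpow_of_nonpos hm0 hy.1 (by simp; linarith))
      (convex_Icc _ _) ⟨le_rfl, by linarith⟩ hx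
    refine this.trans ?_
    refine mul_le_of_le_one_right (by positivity) ?_
    rw [Real.norm_eq_abs, abs_le]
    constructor <;> linarith [hx.1, hx.2]
  have hB := Convex.norm_image_sub_le_of_norm_hasDerivWithin_le
    (f := fun y : ℝ => (y : ℂ) ^ (1 - s) - (1 - s) * (m : ℂ) ^ (-s) * (y : ℂ))
    (f' := fun y : ℝ => (1 - s) * (y : ℂ) ^ (-s) - (1 - s) * (m : ℂ) ^ (-s) * 1)
    (C := ‖1 - s‖ * (‖s‖ * m ^ (-s.re - 1)))
    (s := Set.Icc m (m + 1)) (x := m) (y := m + 1)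
    (fun y hy => ((hasDerivAt_ofReal_cpow_one_sub (hpos y hy) s).sub
      ((hasDerivAt_id y).ofReal_comp.const_mul _)).hasDerivWithinAt)
    (fun y hy => by
      rw [mul_one, ← mul_sub, norm_mul]
      exact mul_le_mul_of_nonneg_left (hA y hy) (norm_nonneg _))
    (convex_Icc _ _) ⟨le_rfl, by linarith⟩ ⟨by linarith, le_rfl⟩
  have e : zetaTerm i s = -(((m + 1 : ℝ) : ℂ) ^ (1 - s) - (1 - s) * (m : ℂ) ^ (-s) * ((m + 1 : ℝ) : ℂ)
      - ((m : ℂ) ^ (1 - s) - (1 - s) * (m : ℂ) ^ (-s) * (m : ℂ))) := by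
    have e2 : (i + 2 : ℝ) = m + 1 := by rw [hm]; ring
    rw [zetaTerm, e2, ← hm]
    push_cast
    ring
  rw [e, norm_neg]
  refine hB.trans_eq ?_
  simp
  ring

theorem sum_zetaTerm (N : ℕ) (s : ℂ) :
    ∑ i ∈ Finset.range N, zetaTerm i s
      = (1 - s) * ∑ i ∈ Finset.range N, ((i + 1 : ℝ) : ℂ) ^ (-s) - ((N + 1 : ℝ) : ℂ) ^ (1 - s) + 1 := by
  induction N with
  | zero => simp
  | succ N ih =>
    rw [Finset.sum_range_succ, ih, Finset.sum_range_succ, zetaTerm]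
    have e : ((N + 1 : ℕ) : ℝ) + 1 = N + 2 := by push_cast; ring
    rw [e]
    ring

/-- The integral parts telescope, so the sum is (1 - s) ζ(s) + 1. It is phrased through the entire
function `riemannZeta₁ s`, which equals (s - 1) ζ(s) away from the pole, in order to be continued
analytically. -/
theorem tsum_zetaTerm_of_one_lt {s : ℂ} (hs : 1 < s.re) :
    ∑' i, zetaTerm i s = 1 - riemannZeta₁ s := by
  have hs1 : s ≠ 1 := by rintro rfl; simp at hs
  have hsum : Summable (fun i => zetaTerm i s) := by
    refine Summable.of_norm_bounded (g := fun i : ℕ => ‖1 - s‖ * ‖s‖ * (i + 1 : ℝ) ^ (-s.re - 1))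
      (Summable.mul_left _ ?_) fun i => norm_zetaTerm_le i (by linarith)
    have := (summable_nat_add_iff 1).2 (Real.summable_nat_rpow.2 (by linarith : -s.re - 1 < -1))
    simpa using this
  have hz : Tendsto (fun N : ℕ => ∑ i ∈ Finset.range N, ((i + 1 : ℝ) : ℂ) ^ (-s)) atTop
      (𝓝 (riemannZeta s)) := by
    rw [zeta_eq_tsum_one_div_nat_add_one_cpow hs]
    have h1 : Summable (fun n : ℕ => 1 / ((n : ℂ) + 1) ^ s) := by
      simpa using (summable_nat_add_iff 1).2 (Complex.summable_one_div_nat_cpow.2 hs)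
    refine h1.hasSum.tendsto_sum_nat.congr fun N => Finset.sum_congr rfl fun i _ => ?_
    rw [Complex.cpow_neg, one_div]
    push_cast
    rfl
  have hp : Tendsto (fun N : ℕ => ((N + 1 : ℝ) : ℂ) ^ (1 - s)) atTop (𝓝 0) := by
    rw [tendsto_zero_iff_norm_tendsto_zero]
    have h2 : Tendsto (fun N : ℕ => ((N : ℝ) + 1) ^ (-(s.re - 1))) atTop (𝓝 0) :=
      (tendsto_rpow_neg_atTop (by linarith)).comp
        (tendsto_atTop_add_const_right _ _ tendsto_natCast_atTop_atTop)
    refine h2.congr fun N => ?_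
    rw [Complex.norm_cpow_eq_rpow_re_of_pos (by positivity)]
    simp
  have h3 := ((hz.const_mul (1 - s)).sub hp).add_const 1
  have h4 := tendsto_nhds_unique (h3.congr fun N => (sum_zetaTerm N s).symm)
    hsum.hasSum.tendsto_sum_nat
  rw [← h4, riemannZeta_eq_inv_sub_mul hs1]
  have : s - 1 ≠ 0 := sub_ne_zero.2 hs1
  field_simp
  ring

/-- Both sides are holomorphic in the half-plane Re s > 0 and agree for Re s > 1, so the identity
theorem applies. -/
theorem tsum_zetaTerm {s : ℂ} (hs : 0 < s.re) :
    Summable (fun i => zetaTerm i s) ∧ ∑' i, zetaTerm i s = 1 - riemannZeta₁ s := by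
  set R : ℝ := ‖s‖ + 3 with hR
  -- A convex region containing s and a point of real part above 1. It is bounded, to control the
  -- factor ‖1 - w‖ ‖w‖, and stays away from Re w = 0, so one summable majorant serves on all of it.
  set U : Set ℂ := {w | s.re / 2 < w.re} ∩ Metric.ball 0 R with hU
  have hUo : IsOpen U := (isOpen_lt continuous_const Complex.continuous_re).inter Metric.isOpen_ball
  have hUc : IsPreconnected U :=
    ((convex_halfSpace_re_gt _).inter (convex_ball _ _)).isPreconnected
  have hsU : s ∈ U := by
    refine ⟨?_, ?_⟩
    · change s.re / 2 < s.re; linarith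
    · simp [hR]
  have hz₀ : ((s.re / 2 + 2 : ℝ) : ℂ) ∈ U := by
    refine ⟨?_, ?_⟩
    · change _ < (((s.re / 2 + 2 : ℝ) : ℂ)).re
      rw [Complex.ofReal_re]; linarith
    · rw [mem_ball_zero_iff, Complex.norm_real, Real.norm_of_nonneg (by linarith)]
      have := Complex.re_le_norm s
      linarith
  have hu : Summable (fun i : ℕ => (1 + R) * R * (i + 1 : ℝ) ^ (-(s.re / 2) - 1)) := by
    have := (summable_nat_add_iff 1).2
      (Real.summable_nat_rpow.2 (by linarith : -(s.re / 2) - 1 < -1))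
    refine Summable.mul_left _ ?_
    simpa using this
  have hle : ∀ (i : ℕ) (w : ℂ), w ∈ U →
      ‖zetaTerm i w‖ ≤ (1 + R) * R * (i + 1 : ℝ) ^ (-(s.re / 2) - 1) := by
    intro i w hw
    have h1 : s.re / 2 < w.re := hw.1
    have h2 : ‖w‖ < R := mem_ball_zero_iff.1 hw.2
    have h3 : ‖1 - w‖ ≤ 1 + R := by
      have := norm_sub_le (1 : ℂ) w
      rw [norm_one] at this; linarith
    refine (norm_zetaTerm_le i (by linarith)).trans ?_
    have h4 : (i + 1 : ℝ) ^ (-w.re - 1) ≤ (i + 1 : ℝ) ^ (-(s.re / 2) - 1) :=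
      Real.rpow_le_rpow_of_exponent_le (by simp) (by linarith)
    have : 0 ≤ R := by positivity
    gcongr
  have hd := Complex.differentiableOn_tsum_of_summable_norm hu
    (fun i => (differentiable_zetaTerm i).differentiableOn) hUo hle
  refine ⟨Summable.of_norm_bounded hu fun i => hle i s hsU, ?_⟩
  refine (hd.analyticOnNhd hUo).eqOn_of_preconnected_of_eventuallyEq
    (((differentiable_const 1).sub differentiable_riemannZeta₁).differentiableOn.analyticOnNhd hUo)
    hUc hz₀ ?_ hsU
  have : {w : ℂ | 1 < w.re} ∈ 𝓝 ((s.re / 2 + 2 : ℝ) : ℂ) :=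
    (isOpen_lt continuous_const Complex.continuous_re).mem_nhds (by
      change 1 < (((s.re / 2 + 2 : ℝ) : ℂ)).re
      rw [Complex.ofReal_re]; linarith)
  filter_upwards [this] with w hw
  exact tsum_zetaTerm_of_one_lt hw

/-- The first terms of the Euler–Maclaurin expansion of `∑_{i ≤ N} i ^ (-s)`. -/
theorem tendsto_sum_rpow_sub {s : ℝ} (hs : 0 < s) (hs1 : s < 1) :
    Tendsto (fun N : ℕ => ∑ i ∈ Finset.range (N + 1), (i + 1 : ℝ) ^ (-s)
      - (N + 1 : ℝ) ^ (1 - s) / (1 - s)) atTop (𝓝 (zetaReal s)) := by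
  have hs1' : (s : ℂ) ≠ 1 := by exact_mod_cast hs1.ne
  have h1s : (1 : ℝ) - s ≠ 0 := by linarith
  obtain ⟨hsum, he⟩ := tsum_zetaTerm (s := (s : ℂ)) (by simpa using hs)
  have h1 := hsum.hasSum.tendsto_sum_nat
  rw [he] at h1
  have h2 := (Complex.continuous_re.tendsto _).comp h1
  have h3 : Tendsto (fun N : ℕ => ∑ i ∈ Finset.range N, (i + 1 : ℝ) ^ (-s)
      - (N + 1 : ℝ) ^ (1 - s) / (1 - s)) atTop (𝓝 (zetaReal s)) := by
    have h4 := (h2.sub_const 1).div_const (1 - s)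
    have e1 : ((1 - riemannZeta₁ (s : ℂ)).re - 1) / (1 - s) = zetaReal s := by
      have : riemannZeta₁ (s : ℂ) = ((s - 1 : ℝ) : ℂ) * riemannZeta s := by
        rw [riemannZeta_eq_inv_sub_mul hs1']
        have : (s : ℂ) - 1 ≠ 0 := sub_ne_zero.2 hs1'
        push_cast
        field_simp
      rw [Complex.sub_re, this, Complex.re_ofReal_mul, zetaReal, Complex.one_re]
      field_simp
      ring
    rw [e1] at h4
    refine h4.congr fun N => ?_
    have e2 : ∑ i ∈ Finset.range N, zetaTerm i (s : ℂ)
        = (((1 - s) * ∑ i ∈ Finset.range N, (i + 1 : ℝ) ^ (-s) - (N + 1 : ℝ) ^ (1 - s) + 1 : ℝ) : ℂ) := by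
      rw [sum_zetaTerm]
      push_cast
      rw [Complex.ofReal_cpow (by positivity)]
      have : ∀ i : ℕ, (((i + 1 : ℝ) ^ (-s) : ℝ) : ℂ) = ((i : ℂ) + 1) ^ (-(s : ℂ)) := fun i => by
        rw [Complex.ofReal_cpow (by positivity)]; push_cast; rfl
      simp only [this]
      push_cast
      rfl
    rw [Function.comp, e2, Complex.ofReal_re]
    field_simp
    ring
  -- The telescoped formula has N powers where the statement has N + 1; the extra one tends to 0.
  have h5 : Tendsto (fun N : ℕ => (N + 1 : ℝ) ^ (-s)) atTop (𝓝 0) :=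
    (tendsto_rpow_neg_atTop hs).comp
      (tendsto_atTop_add_const_right _ _ tendsto_natCast_atTop_atTop)
  have h6 := h3.add h5
  rw [add_zero] at h6
  refine h6.congr fun N => ?_
  rw [Finset.sum_range_succ]
  ring

/-! ### Smoothness of Λ, and the curve of perturbed minimisers -/

/-- The holomorphic extension of `weight` in its first argument. -/
noncomputable def cweight (z : ℂ) (y : ℝ) : ℂ :=
  ((1 - Real.exp (-y) : ℝ) : ℂ) + Complex.exp (-(1 + z) * y)

/-- The holomorphic extension of `dcgf` in its first argument. -/
noncomputable def cdcgf (z : ℂ) (y : ℝ) : ℂ :=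
  y * (((1 - Real.exp (-y) : ℝ) : ℂ) / cweight z y - y)

/-- The derivative of `cdcgf` in its first argument. -/
noncomputable def ctiltVar (z : ℂ) (y : ℝ) : ℂ :=
  y ^ 2 * (((1 - Real.exp (-y) : ℝ) : ℂ) * Complex.exp (-(1 + z) * y)) / cweight z y ^ 2

theorem cdcgf_ofReal (ϑ y : ℝ) : cdcgf ϑ y = dcgf ϑ y := by
  simp [cdcgf, dcgf, tiltRatio_eq, cweight, weight]

theorem measurable_cweight (z : ℂ) : Measurable (cweight z) := by
  unfold cweight; fun_prop

theorem measurable_cdcgf (z : ℂ) : Measurable (cdcgf z) := by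
  have := measurable_cweight z
  unfold cdcgf; fun_prop

theorem measurable_ctiltVar (z : ℂ) : Measurable (ctiltVar z) := by
  have := measurable_cweight z
  unfold ctiltVar; fun_prop

/-- The real part is bounded below. For y ≤ 1 the phase satisfies |y Im z| ≤ 1, so its cosine is at
least cos 1 > 0; for y ≥ 1 the real part is at least 1 - 2/e > 0. Thus the denominator stays away
from zero uniformly in y. -/
theorem exists_le_norm_cweight (Θ : ℝ) : ∃ c > 0, ∀ z : ℂ, 0 ≤ z.re → z.re ≤ Θ → |z.im| ≤ 1 →
    ∀ y : ℝ, 0 ≤ y → c ≤ ‖cweight z y‖ := by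
  have he : Real.exp (-1) < 1 / 2 := by
    rw [Real.exp_neg, inv_lt_comm₀ (Real.exp_pos _) (by norm_num)]
    have := Real.exp_one_gt_d9
    linarith
  refine ⟨min (Real.exp (-(1 + Θ)) * Real.cos 1) (1 - 2 * Real.exp (-1)),
    lt_min (mul_pos (Real.exp_pos _) Real.cos_one_pos) (by linarith), ?_⟩
  intro z hz hzΘ him y hy
  refine le_trans ?_ (Complex.re_le_norm _)
  have hre : (cweight z y).re = 1 - Real.exp (-y)
      + Real.exp (-(1 + z.re) * y) * Real.cos (z.im * y) := by
    rw [cweight, Complex.add_re, Complex.ofReal_re, Complex.exp_re]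
    have e1 : (-(1 + z) * (y : ℂ)).re = -(1 + z.re) * y := by simp
    have e2 : (-(1 + z) * (y : ℂ)).im = -(z.im * y) := by simp
    rw [e1, e2, Real.cos_neg]
  rw [hre]
  have h1 : Real.exp (-y) ≤ 1 := Real.exp_le_one_iff.2 (by linarith)
  rcases le_total y 1 with hy1 | hy1
  · refine (min_le_left _ _).trans ?_
    have hc : Real.cos 1 ≤ Real.cos (z.im * y) := by
      rw [← Real.cos_abs (z.im * y)]
      refine Real.cos_le_cos_of_nonneg_of_le_pi (abs_nonneg _) (by linarith [Real.pi_gt_three]) ?_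
      rw [abs_mul, abs_of_nonneg hy]
      nlinarith [abs_nonneg z.im]
    have hE : Real.exp (-(1 + Θ)) ≤ Real.exp (-(1 + z.re) * y) :=
      Real.exp_le_exp.2 (by nlinarith)
    have := mul_le_mul hE hc Real.cos_one_pos.le (Real.exp_pos _).le
    linarith
  · refine (min_le_right _ _).trans ?_
    have h2 : Real.exp (-y) ≤ Real.exp (-1) := Real.exp_le_exp.2 (by linarith)
    have h3 : Real.exp (-(1 + z.re) * y) ≤ Real.exp (-1) := Real.exp_le_exp.2 (by nlinarith)
    have h4 := Real.neg_one_le_cos (z.im * y)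
    have h5 := Real.exp_pos (-(1 + z.re) * y)
    nlinarith

theorem hasDerivAt_cdcgf {z : ℂ} {y : ℝ} (h : cweight z y ≠ 0) :
    HasDerivAt (fun z => cdcgf z y) (ctiltVar z y) z := by
  have h1 : HasDerivAt (fun z : ℂ => -(1 + z) * (y : ℂ)) (-1 * y) z :=
    (((hasDerivAt_id z).const_add 1).neg.mul_const (y : ℂ))
  have h2 : HasDerivAt (fun z => cweight z y) (Complex.exp (-(1 + z) * y) * (-1 * y)) z :=
    h1.cexp.const_add _
  have h3 := ((((hasDerivAt_const z (((1 - Real.exp (-y) : ℝ) : ℂ))).div h2 h).sub_const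
    (y : ℂ)).const_mul (y : ℂ))
  refine h3.congr_deriv ?_
  unfold ctiltVar
  field_simp
  ring

theorem norm_ctiltVar_le {z : ℂ} {y c : ℝ} (hc : 0 < c) (hy : 0 ≤ y) (hz : 0 ≤ z.re)
    (h : c ≤ ‖cweight z y‖) : ‖ctiltVar z y‖ ≤ (c ^ 2)⁻¹ * env y := by
  have hp0 : 0 ≤ 1 - Real.exp (-y) := by
    have : Real.exp (-y) ≤ 1 := Real.exp_le_one_iff.2 (by linarith)
    linarith
  have hp1 : 1 - Real.exp (-y) ≤ 1 := by have := Real.exp_pos (-y); linarith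
  have hpy : 1 - Real.exp (-y) ≤ y := by have := Real.add_one_le_exp (-y); linarith
  have he : ‖Complex.exp (-(1 + z) * y)‖ ≤ 1 := by
    rw [Complex.norm_exp, Real.exp_le_one_iff]
    simp
    nlinarith
  have hpe : y ^ 2 * (1 - Real.exp (-y)) ≤ env y :=
    le_min (by nlinarith [sq_nonneg y]) (by nlinarith [sq_nonneg y])
  rw [ctiltVar, norm_div, norm_mul, norm_mul, norm_pow, norm_pow, Complex.norm_real,
    Complex.norm_real, Real.norm_of_nonneg hy, Real.norm_of_nonneg hp0, inv_mul_eq_div]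
  have h0 := env_nonneg hy
  refine div_le_div₀ h0 ?_ (by positivity) (by gcongr)
  calc y ^ 2 * ((1 - Real.exp (-y)) * ‖Complex.exp (-(1 + z) * y)‖)
      ≤ y ^ 2 * ((1 - Real.exp (-y)) * 1) := by gcongr
    _ ≤ env y := by rw [mul_one]; exact hpe

section

variable {α : ℝ}

/-- Repeated differentiation under the integral is avoided: the complexified integral is complex
differentiable in a disc around θ, hence analytic, and its real part on the real axis is `dcgfInt`.
-/
theorem contDiffAt_dcgfInt (h1 : 1 / 3 < α) (h2 : α < 1 / 2) {θ : ℝ} (hθ : 0 < θ) :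
    ContDiffAt ℝ ((⊤ : ℕ∞) : WithTop ℕ∞) (dcgfInt α) θ := by
  obtain ⟨c, hc, hcb⟩ := exists_le_norm_cweight (2 * θ)
  set ρ := min θ 1 with hρ
  have hρ0 : 0 < ρ := lt_min hθ one_pos
  set B : Set ℂ := Metric.ball (θ : ℂ) ρ with hB
  have hBre : ∀ z ∈ B, 0 ≤ z.re ∧ z.re ≤ 2 * θ ∧ |z.im| ≤ 1 := by
    intro z hz
    rw [hB, Metric.mem_ball, dist_eq_norm] at hz
    have h3 := (Complex.abs_re_le_norm (z - θ)).trans_lt hz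
    have h4 := (Complex.abs_im_le_norm (z - θ)).trans_lt hz
    simp only [Complex.sub_re, Complex.ofReal_re, Complex.sub_im, Complex.ofReal_im, sub_zero]
      at h3 h4
    have h5 : ρ ≤ θ := min_le_left _ _
    have h6 : ρ ≤ 1 := min_le_right _ _
    have := abs_lt.1 h3
    exact ⟨by linarith, by linarith, by linarith⟩
  have hlow : ∀ z ∈ B, ∀ y : ℝ, 0 ≤ y → c ≤ ‖cweight z y‖ := fun z hz y hy =>
    hcb z (hBre z hz).1 (hBre z hz).2.1 (hBre z hz).2.2 y hy
  have hne : ∀ z ∈ B, ∀ y : ℝ, 0 ≤ y → cweight z y ≠ 0 := fun z hz y hy =>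
    norm_pos_iff.1 (hc.trans_le (hlow z hz y hy))
  have hθB : (θ : ℂ) ∈ B := Metric.mem_ball_self hρ0
  have hmeas : ∀ z, AEStronglyMeasurable (fun x : ℝ => cdcgf z (x ^ (-α)))
      (volume.restrict (Set.Ioi 0)) := fun z =>
    ((measurable_cdcgf z).comp (measurable_id.pow_const _)).aestronglyMeasurable
  have hθint : Integrable (fun x : ℝ => cdcgf (θ : ℂ) (x ^ (-α))) (volume.restrict (Set.Ioi 0)) := by
    simp only [cdcgf_ofReal]
    exact (integrableOn_dcgf h1 h2 θ).ofReal
  have henv := (integrableOn_env_rpow h1 h2).const_mul (c ^ 2)⁻¹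
  -- Integrability is known at the real point θ; the difference from there is at most a multiple of
  -- the envelope, by the derivative bound on the disc.
  have hint : ∀ z ∈ B,
      Integrable (fun x : ℝ => cdcgf z (x ^ (-α))) (volume.restrict (Set.Ioi 0)) := by
    intro z hz
    have h3 : Integrable (fun x : ℝ => cdcgf z (x ^ (-α)) - cdcgf (θ : ℂ) (x ^ (-α)))
        (volume.restrict (Set.Ioi 0)) := by
      refine Integrable.mono' (henv.mul_const ‖z - θ‖) ((hmeas z).sub (hmeas θ)) ?_
      filter_upwards [ae_restrict_mem measurableSet_Ioi] with x hx
      have hy := Real.rpow_nonneg (le_of_lt hx) (-α)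
      exact Convex.norm_image_sub_le_of_norm_hasDerivWithin_le (s := B)
        (fun w hw => (hasDerivAt_cdcgf (hne w hw _ hy)).hasDerivWithinAt)
        (fun w hw => norm_ctiltVar_le hc hy (hBre w hw).1 (hlow w hw _ hy)) (convex_ball _ _) hθB hz
    refine (h3.add hθint).congr (Eventually.of_forall fun x => ?_)
    simp
  have hdiff : DifferentiableOn ℂ (fun z => ∫ x in Set.Ioi (0 : ℝ), cdcgf z (x ^ (-α))) B := by
    intro z hz
    refine (hasDerivAt_integral_of_dominated_loc_of_deriv_le (μ := volume.restrict (Set.Ioi 0))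
      (F := fun z x => cdcgf z (x ^ (-α))) (F' := fun z x => ctiltVar z (x ^ (-α))) (x₀ := z)
      (s := B) (bound := fun x => (c ^ 2)⁻¹ * env (x ^ (-α)))
      (Metric.isOpen_ball.mem_nhds hz) (Eventually.of_forall hmeas) (hint z hz)
      ((measurable_ctiltVar z).comp (measurable_id.pow_const _)).aestronglyMeasurable ?_
      henv ?_).2.differentiableAt.differentiableWithinAt
    · filter_upwards [ae_restrict_mem measurableSet_Ioi] with x hx w hw
      have hy := Real.rpow_nonneg (le_of_lt hx) (-α)
      exact norm_ctiltVar_le hc hy (hBre w hw).1 (hlow w hw _ hy)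
    · filter_upwards [ae_restrict_mem measurableSet_Ioi] with x hx w hw
      exact hasDerivAt_cdcgf (hne w hw _ (Real.rpow_nonneg (le_of_lt hx) (-α)))
  have han := (hdiff.analyticAt (Metric.isOpen_ball.mem_nhds hθB)).contDiffAt
    (n := ((⊤ : ℕ∞) : WithTop ℕ∞))
  have hre := han.real_of_complex
  refine hre.congr_of_eventuallyEq (Eventually.of_forall fun t => ?_)
  simp only [cdcgf_ofReal]
  rw [integral_complex_ofReal, Complex.ofReal_re]
  rfl

theorem contDiffAt_cgfInt (h1 : 1 / 3 < α) (h2 : α < 1 / 2) {θ : ℝ} (hθ : 0 < θ) :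
    ContDiffAt ℝ ((⊤ : ℕ∞) : WithTop ℕ∞) (cgfInt α) θ := by
  have : ContDiffOn ℝ ((⊤ : ℕ∞) : WithTop ℕ∞) (cgfInt α) (Set.Ioi 0) := by
    rw [contDiffOn_infty_iff_deriv_of_isOpen isOpen_Ioi]
    refine ⟨fun t _ => (hasDerivAt_cgfInt h1 h2 t).differentiableAt.differentiableWithinAt, ?_⟩
    have e : deriv (cgfInt α) = dcgfInt α := funext fun t => (hasDerivAt_cgfInt h1 h2 t).deriv
    rw [e]
    exact fun t ht => (contDiffAt_dcgfInt h1 h2 ht).contDiffWithinAt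
  exact this.contDiffAt (isOpen_Ioi.mem_nhds hθ)

/-- The inverse function theorem applies to Λ', because its derivative `tiltVarInt α θ` is nonzero.
-/
theorem exists_critical_curve (h1 : 1 / 3 < α) (h2 : α < 1 / 2) {θ : ℝ} (hθ : 0 < θ)
    (h0 : dcgfInt α θ = 0) :
    ∃ ψ : ℝ → ℝ, ContDiffAt ℝ ((⊤ : ℕ∞) : WithTop ℕ∞) ψ 0 ∧ ψ 0 = θ ∧
      ∀ᶠ e in 𝓝 0, dcgfInt α (ψ e) = -e := by
  have hc := contDiffAt_dcgfInt h1 h2 hθ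
  have hne : tiltVarInt α θ ≠ 0 := (tiltVarInt_pos h1 h2 θ).ne'
  have hd : HasFDerivAt (dcgfInt α)
      ((ContinuousLinearEquiv.unitsEquivAut ℝ (Units.mk0 _ hne) : ℝ ≃L[ℝ] ℝ) : ℝ →L[ℝ] ℝ) θ := by
    have := (hasDerivAt_dcgfInt h1 h2 θ).hasFDerivAt
    refine this.congr_fderiv ?_
    ext
    simp
  have hn : ((⊤ : ℕ∞) : WithTop ℕ∞) ≠ 0 := by simp
  have hl := hc.to_localInverse hd hn
  have hr := (hc.hasStrictFDerivAt' hd hn).eventually_right_inverse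
  rw [h0] at hl hr
  have hneg : Tendsto (fun e : ℝ => -e) (𝓝 0) (𝓝 0) := by
    simpa using (continuous_neg (G := ℝ)).tendsto 0
  refine ⟨fun e => hc.localInverse hd hn (-e), ?_, ?_, hneg.eventually hr⟩
  · rw [← neg_zero] at hl
    exact ContDiffAt.comp (0 : ℝ) hl contDiffAt_id.neg
  · have := hc.localInverse_apply_image hd hn
    rw [h0] at this
    simpa using this

theorem iInf_cgfInt_eq (h1 : 1 / 3 < α) (h2 : α < 1 / 2) {ϑ e : ℝ} (h0 : dcgfInt α ϑ = -e) :
    ⨅ t : ℝ, (cgfInt α t + t * e) = cgfInt α ϑ + ϑ * e := by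
  have hle : ∀ t, cgfInt α ϑ + ϑ * e ≤ cgfInt α t + t * e := fun t => by
    rcases eq_or_ne t ϑ with rfl | h
    · exact le_rfl
    · exact (cgfInt_lt h1 h2 h0 h).le
  exact le_antisymm (ciInf_le ⟨_, by rintro _ ⟨t, rfl⟩; exact hle t⟩ ϑ) (le_ciInf hle)

end

theorem perturbedMin_eq (τ e : ℝ) :
    perturbedMin τ e = ⨅ t : ℝ, (cgfInt (alpha τ) t + t * e) := by
  simp only [perturbedMin, Lam_eq_cgfInt]

theorem isLittleO_taylor {g : ℝ → ℝ} (hg : ContDiffAt ℝ ((⊤ : ℕ∞) : WithTop ℕ∞) g 0) (K : ℕ) :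
    (fun x => g x - ∑ k ∈ Finset.range (K + 1), iteratedDeriv k g 0 / (k.factorial : ℝ) * x ^ k)
      =o[𝓝 0] fun x => x ^ K := by
  have hK : ContDiffAt ℝ (K : WithTop ℕ∞) g 0 := hg.of_le (by exact_mod_cast le_top)
  obtain ⟨U, hU, hgU⟩ := hK.contDiffOn (m := K) le_rfl (by simp)
  obtain ⟨r, hr, hrU⟩ := Metric.mem_nhds_iff.1 hU
  have h := taylor_isLittleO (convex_ball (0 : ℝ) r) (Metric.mem_ball_self hr) (hgU.mono hrU)
  rw [Metric.isOpen_ball.nhdsWithin_eq (Metric.mem_ball_self hr)] at h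
  simp only [sub_zero, taylor_within_apply, smul_eq_mul] at h
  refine h.congr_left fun x => ?_
  congr 1
  refine Finset.sum_congr rfl fun k _ => ?_
  rw [iteratedDerivWithin_of_isOpen Metric.isOpen_ball (Metric.mem_ball_self hr)]
  ring

/-! ### The variance constant as the second derivative of Λ -/

theorem varIntegrand_eq {τ θ v : ℝ} (hτ : 1 < τ) (hv : 0 < v) :
    (|-(τ - 1)| * v ^ (-(τ - 1) - 1)) • tiltVar θ ((v ^ (-(τ - 1))) ^ (-alpha τ))
      = (τ - 1) * varIntegrand τ θ v := by
  have hτ1 : 0 < τ - 1 := by linarith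
  have e1 : (v ^ (-(τ - 1))) ^ (-alpha τ) = v := by
    rw [← Real.rpow_mul hv.le, alpha]
    have : -(τ - 1) * -(1 / (τ - 1)) = 1 := by field_simp
    rw [this, Real.rpow_one]
  have e2 : v ^ (-(τ - 1) - 1) = (v ^ (τ - 2))⁻¹ * (v ^ 2)⁻¹ := by
    rw [← Real.rpow_natCast, ← Real.rpow_neg hv.le, ← Real.rpow_neg hv.le, ← Real.rpow_add hv]
    congr 1; push_cast; ring
  rw [e1, e2, abs_neg, abs_of_pos hτ1, smul_eq_mul, tiltVar, varIntegrand]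
  field_simp

/-- The substitution x = v^{-(τ-1)} turns x^{-α} into v. -/
theorem varConst_eq {τ : ℝ} (hτ : 1 < τ) (θ : ℝ) : varConst τ θ = tiltVarInt (alpha τ) θ := by
  rw [tiltVarInt, ← integral_comp_rpow_Ioi _ (p := -(τ - 1)) (by linarith),
    setIntegral_congr_fun measurableSet_Ioi (fun v hv => varIntegrand_eq hτ hv),
    integral_const_mul, varConst]

theorem integrableOn_varIntegrand {τ : ℝ} (hτ : 1 < τ) (h1 : 1 / 3 < alpha τ)
    (h2 : alpha τ < 1 / 2) (θ : ℝ) : IntegrableOn (varIntegrand τ θ) (Set.Ioi 0) := by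
  have h := (integrableOn_Ioi_comp_rpow_iff _ (p := -(τ - 1)) (by linarith)).2
    (integrableOn_tiltVar h1 h2 θ)
  have h' := (integrableOn_congr_fun (fun v hv => varIntegrand_eq hτ hv) measurableSet_Ioi).1 h
  refine (h'.const_mul (τ - 1)⁻¹).congr (Eventually.of_forall fun v => ?_)
  have : τ - 1 ≠ 0 := by linarith
  simp only
  field_simp

theorem alpha_bounds {τ : ℝ} (hτ : 3 < τ) (hτ' : τ < 4) : 1 / 3 < alpha τ ∧ alpha τ < 1 / 2 := by
  unfold alpha
  constructor
  · exact one_div_lt_one_div_of_lt (by linarith) (by linarith)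
  · exact one_div_lt_one_div_of_lt (by linarith) (by linarith)

/-! ### Euler–Maclaurin expansion of the sum of `cgf` -/

theorem trapezoid_error_le {g g' g'' : ℝ → ℝ} {a h M : ℝ} (hh : 0 ≤ h)
    (hg : ∀ x ∈ Set.Icc a (a + h), HasDerivAt g (g' x) x)
    (hg' : ∀ x ∈ Set.Icc a (a + h), HasDerivAt g' (g'' x) x)
    (hM : ∀ x ∈ Set.Icc a (a + h), |g'' x| ≤ M) :
    |(∫ x in a..a + h, g x) - h * ((g a + g (a + h)) / 2)| ≤ 2 * M * h ^ 3 := by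
  have ha : a ∈ Set.Icc a (a + h) := ⟨le_rfl, by linarith⟩
  have hb : a + h ∈ Set.Icc a (a + h) := ⟨by linarith, le_rfl⟩
  have hM0 : 0 ≤ M := (abs_nonneg _).trans (hM a ha)
  have h1 : ∀ x ∈ Set.Icc a (a + h), |g' x - g' a| ≤ M * h := fun x hx => by
    have := Convex.norm_image_sub_le_of_norm_hasDerivWithin_le (s := Set.Icc a (a + h))
      (fun y hy => (hg' y hy).hasDerivWithinAt) hM (convex_Icc _ _) ha hx
    refine this.trans ?_
    rw [Real.norm_of_nonneg (by linarith [hx.1])]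
    gcongr
    linarith [hx.2]
  -- The trapezoidal rule is exact for affine functions, so its error for g equals its error for the
  -- Taylor remainder E, which is at most M h² on the cell.
  set E : ℝ → ℝ := fun x => g x - g a - g' a * (x - a) with hE
  have h2 : ∀ x ∈ Set.Icc a (a + h), |E x| ≤ M * h ^ 2 := fun x hx => by
    have := Convex.norm_image_sub_le_of_norm_hasDerivWithin_le (s := Set.Icc a (a + h))
      (f := fun x => g x - g' a * x) (f' := fun x => g' x - g' a * 1) (C := M * h)
      (fun y hy => ((hg y hy).sub ((hasDerivAt_id y).const_mul (g' a))).hasDerivWithinAt)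
      (fun y hy => by rw [mul_one]; exact h1 y hy) (convex_Icc _ _) ha hx
    have e : E x = (g x - g' a * x) - (g a - g' a * a) := by rw [hE]; ring
    rw [e]
    refine this.trans ?_
    rw [Real.norm_of_nonneg (by linarith [hx.1]), pow_two, ← mul_assoc]
    gcongr
    linarith [hx.2]
  have hgc : ContinuousOn g (Set.Icc a (a + h)) := fun x hx =>
    (hg x hx).continuousAt.continuousWithinAt
  have hgi : IntervalIntegrable g volume a (a + h) :=
    ContinuousOn.intervalIntegrable (by rwa [Set.uIcc_of_le (by linarith)])
  have hlin : IntervalIntegrable (fun x => g' a * (x - a)) volume a (a + h) :=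
    (by fun_prop : Continuous fun x => g' a * (x - a)).intervalIntegrable _ _
  have hEint : ∫ x in a..a + h, E x = (∫ x in a..a + h, g x) - h * g a - g' a * (h ^ 2 / 2) := by
    rw [hE, intervalIntegral.integral_sub (hgi.sub intervalIntegrable_const) hlin,
      intervalIntegral.integral_sub hgi intervalIntegrable_const,
      intervalIntegral.integral_const, intervalIntegral.integral_const_mul,
      intervalIntegral.integral_comp_sub_right (fun x => x), integral_id]
    simp
  have h3 : |∫ x in a..a + h, E x| ≤ M * h ^ 2 * h := by
    have := intervalIntegral.norm_integral_le_of_norm_le_const (a := a) (b := a + h) (f := E)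
      (C := M * h ^ 2) (fun x hx => by
        rw [Set.uIoc_of_le (by linarith)] at hx
        exact h2 x ⟨hx.1.le, hx.2⟩)
    simpa [abs_of_nonneg hh] using this
  have h4 := h2 _ hb
  have e : (∫ x in a..a + h, g x) - h * ((g a + g (a + h)) / 2)
      = (∫ x in a..a + h, E x) - h * E (a + h) / 2 := by
    rw [hEint, hE]; ring
  rw [e]
  have h5 : |h * E (a + h) / 2| ≤ h * (M * h ^ 2) := by
    rw [abs_div, abs_mul, abs_of_nonneg hh, abs_two]
    have : h * |E (a + h)| ≤ h * (M * h ^ 2) := by gcongr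
    have h6 : 0 ≤ h * |E (a + h)| := by positivity
    linarith
  refine (abs_sub _ _).trans ?_
  nlinarith

theorem weight_lower_bound {ϑ Θ y : ℝ} (hϑ : 0 ≤ ϑ) (hΘ : ϑ ≤ Θ) (hy : 0 ≤ y) :
    Real.exp (-Θ) / 2 ≤ weight ϑ y := by
  rcases le_total y 1 with h | h
  · have h1 := exp_neg_abs_le_weight (ϑ := ϑ) hy h
    rw [abs_of_nonneg hϑ] at h1
    have h2 : Real.exp (-Θ) ≤ Real.exp (-ϑ) := Real.exp_le_exp.2 (by linarith)
    have := Real.exp_pos (-Θ)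
    linarith
  · have h1 : Real.exp (-Θ) ≤ 1 := Real.exp_le_one_iff.2 (by linarith)
    have h2 : Real.exp (-y) ≤ 1 / 2 := by
      refine (Real.exp_le_exp.2 (neg_le_neg h)).trans ?_
      rw [Real.exp_neg, inv_le_comm₀ (Real.exp_pos _) (by norm_num)]
      have := Real.exp_one_gt_d9
      linarith
    have h3 := Real.exp_pos (-(1 + ϑ) * y)
    unfold weight
    linarith

/-- The derivative of `weight ϑ` in the second argument. -/
noncomputable def weight' (ϑ y : ℝ) : ℝ := Real.exp (-y) - (1 + ϑ) * Real.exp (-(1 + ϑ) * y)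

/-- The second derivative of `weight ϑ` in the second argument. -/
noncomputable def weight'' (ϑ y : ℝ) : ℝ :=
  -Real.exp (-y) + (1 + ϑ) ^ 2 * Real.exp (-(1 + ϑ) * y)

theorem hasDerivAt_exp_const_mul (c y : ℝ) :
    HasDerivAt (fun y => Real.exp (c * y)) (c * Real.exp (c * y)) y := by
  have := ((hasDerivAt_id y).const_mul c).exp
  simpa [mul_comm] using this

theorem hasDerivAt_weight_right (ϑ y : ℝ) : HasDerivAt (weight ϑ) (weight' ϑ y) y := by
  have h1 := ((hasDerivAt_exp_const_mul (-1) y).const_sub 1).add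
    (hasDerivAt_exp_const_mul (-(1 + ϑ)) y)
  simp only [neg_one_mul] at h1
  refine h1.congr_deriv ?_
  unfold weight'; ring

theorem hasDerivAt_weight' (ϑ y : ℝ) : HasDerivAt (weight' ϑ) (weight'' ϑ y) y := by
  have h1 := (hasDerivAt_exp_const_mul (-1) y).sub
    ((hasDerivAt_exp_const_mul (-(1 + ϑ)) y).const_mul (1 + ϑ))
  simp only [neg_one_mul] at h1
  refine h1.congr_deriv ?_
  unfold weight''; ring

theorem exp_neg_one_add_mul_le {ϑ y : ℝ} (hϑ : 0 ≤ ϑ) (hy : 0 ≤ y) :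
    Real.exp (-(1 + ϑ) * y) ≤ Real.exp (-y) := Real.exp_le_exp.2 (by nlinarith)

theorem abs_weight'_le {ϑ Θ y : ℝ} (hϑ : 0 ≤ ϑ) (hΘ : ϑ ≤ Θ) (hy : 0 ≤ y) :
    |weight' ϑ y| ≤ (1 + Θ) * Real.exp (-y) := by
  have h1 := exp_neg_one_add_mul_le hϑ hy
  have h2 := Real.exp_pos (-(1 + ϑ) * y)
  have h3 := Real.exp_pos (-y)
  unfold weight'
  rw [abs_le]
  constructor <;> nlinarith

theorem abs_weight''_le {ϑ Θ y : ℝ} (hϑ : 0 ≤ ϑ) (hΘ : ϑ ≤ Θ) (hy : 0 ≤ y) :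
    |weight'' ϑ y| ≤ (1 + Θ) ^ 2 * Real.exp (-y) := by
  have h1 := exp_neg_one_add_mul_le hϑ hy
  have h2 := Real.exp_pos (-(1 + ϑ) * y)
  have h3 := Real.exp_pos (-y)
  have h4 : (1 + ϑ) ^ 2 ≤ (1 + Θ) ^ 2 := by gcongr
  have h5 : (1 + ϑ) ^ 2 * Real.exp (-(1 + ϑ) * y) ≤ (1 + Θ) ^ 2 * Real.exp (-y) := by gcongr
  have h6 : 0 ≤ (1 + ϑ) ^ 2 * Real.exp (-(1 + ϑ) * y) := by positivity
  have h7 : 1 ≤ (1 + Θ) ^ 2 := by nlinarith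
  unfold weight''
  rw [abs_le]
  constructor <;> nlinarith

theorem abs_log_weight_le {ϑ y : ℝ} (hϑ : 0 ≤ ϑ) (hy : 1 ≤ y) :
    |Real.log (weight ϑ y)| ≤ 2 * Real.exp (-y) := by
  have hy0 : 0 ≤ y := by linarith
  have h1 := exp_neg_one_add_mul_le hϑ hy0
  have h2 := Real.exp_pos (-(1 + ϑ) * y)
  have h3 : Real.exp (-y) ≤ 1 / 2 := by
    refine (Real.exp_le_exp.2 (neg_le_neg hy)).trans ?_
    rw [Real.exp_neg, inv_le_comm₀ (Real.exp_pos _) (by norm_num)]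
    have := Real.exp_one_gt_d9
    linarith
  have hw := weight_pos (ϑ := ϑ) hy0
  have hw1 : weight ϑ y ≤ 1 := by unfold weight; linarith
  have hw2 : 1 - Real.exp (-y) ≤ weight ϑ y := by unfold weight; linarith
  rw [abs_of_nonpos (Real.log_nonpos hw.le hw1)]
  have h4 := Real.one_sub_inv_le_log_of_pos hw
  have h5 : (weight ϑ y)⁻¹ ≤ 1 + 2 * Real.exp (-y) := by
    rw [inv_le_iff_one_le_mul₀ hw]
    nlinarith [Real.exp_pos (-y)]
  linarith

/-- The left side is v + v² + v³ + v⁴, and each v^k is at most k! e^v; 33 = 1! + 2! + 3! + 4!. -/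
theorem pow_poly_le_exp {v : ℝ} (hv : 0 ≤ v) : (v + v ^ 2) * (1 + v ^ 2) ≤ 33 * Real.exp v := by
  have h1 := Real.pow_div_factorial_le_exp v hv 1
  have h2 := Real.pow_div_factorial_le_exp v hv 2
  have h3 := Real.pow_div_factorial_le_exp v hv 3
  have h4 := Real.pow_div_factorial_le_exp v hv 4
  norm_num [Nat.factorial] at h1 h2 h3 h4
  nlinarith

section

variable {α : ℝ}

/-- The second derivative of `x ↦ log (weight ϑ (x ^ (-α)))`. -/
noncomputable def logWeight'' (α ϑ x : ℝ) : ℝ :=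
  (weight'' ϑ (x ^ (-α)) / weight ϑ (x ^ (-α)) - (weight' ϑ (x ^ (-α)) / weight ϑ (x ^ (-α))) ^ 2)
    * (-α * x ^ (-α - 1)) ^ 2
  + weight' ϑ (x ^ (-α)) / weight ϑ (x ^ (-α)) * (α * (α + 1) * x ^ (-α - 2))

theorem hasDerivAt_log_weight_rpow {ϑ x : ℝ} (hx : 0 < x) :
    HasDerivAt (fun x => Real.log (weight ϑ (x ^ (-α))))
      (weight' ϑ (x ^ (-α)) / weight ϑ (x ^ (-α)) * (-α * x ^ (-α - 1))) x := by
  have h1 := Real.hasDerivAt_rpow_const (x := x) (p := -α) (Or.inl hx.ne')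
  have hw := (weight_pos (ϑ := ϑ) (Real.rpow_nonneg hx.le (-α))).ne'
  have h2 : HasDerivAt (fun x => weight ϑ (x ^ (-α)))
      (weight' ϑ (x ^ (-α)) * (-α * x ^ (-α - 1))) x :=
    HasDerivAt.comp (h₂ := weight ϑ) x (hasDerivAt_weight_right ϑ (x ^ (-α))) h1
  refine (h2.log hw).congr_deriv ?_
  ring

theorem hasDerivAt_log_weight_rpow' {ϑ x : ℝ} (hx : 0 < x) :
    HasDerivAt (fun x => weight' ϑ (x ^ (-α)) / weight ϑ (x ^ (-α)) * (-α * x ^ (-α - 1)))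
      (logWeight'' α ϑ x) x := by
  have h1 := Real.hasDerivAt_rpow_const (x := x) (p := -α) (Or.inl hx.ne')
  have h1' := (Real.hasDerivAt_rpow_const (x := x) (p := -α - 1) (Or.inl hx.ne')).const_mul (-α)
  have hw := (weight_pos (ϑ := ϑ) (Real.rpow_nonneg hx.le (-α))).ne'
  have h2 := (hasDerivAt_weight_right ϑ (x ^ (-α))).comp x h1
  have h3 := (hasDerivAt_weight' ϑ (x ^ (-α))).comp x h1
  have h4 := (h3.div h2 hw).mul h1'
  refine h4.congr_deriv ?_
  have e : -α - 1 - 1 = -α - 2 := by ring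
  unfold logWeight''
  simp only [Function.comp, Pi.div_apply, e]
  field_simp
  ring

/-- With v = x^{-α}, the logarithmic derivatives of the weight are O(e^{-v}) and the chain rule
contributes (v + v²) x^{-2}. The singularity at 0 is harmless because e^{-v} absorbs powers of v.
The exponent 3/2 exceeds 1, so the trapezoidal errors of the cells are summable. -/
theorem exists_abs_logWeight''_le (h1 : 1 / 3 < α) (h2 : α < 1 / 2) {Θ : ℝ} (hΘ : 0 ≤ Θ) :
    ∃ C, 0 ≤ C ∧ ∀ ϑ, 0 ≤ ϑ → ϑ ≤ Θ → ∀ x > 0,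
      |logWeight'' α ϑ x| ≤ C * x ^ (-(3 / 2) : ℝ) := by
  set c := Real.exp (-Θ) / 2 with hc
  have hc0 : 0 < c := by positivity
  set L := (1 + Θ) / c with hL
  have hL0 : 0 ≤ L := by positivity
  set L2 := (1 + Θ) ^ 2 / c with hL2
  have hL20 : 0 ≤ L2 := by positivity
  refine ⟨33 * (L2 + L ^ 2 + 2 * L), by positivity, ?_⟩
  intro ϑ hϑ hϑΘ x hx
  set v := x ^ (-α) with hv
  have hv0 : 0 < v := Real.rpow_pos_of_pos hx _
  have hw := weight_pos (ϑ := ϑ) hv0.le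
  have hwl : c ≤ weight ϑ v := weight_lower_bound hϑ hϑΘ hv0.le
  have he := Real.exp_pos (-v)
  have he1 : Real.exp (-v) ≤ 1 := Real.exp_le_one_iff.2 (by linarith)
  have b1 : |weight' ϑ v / weight ϑ v| ≤ L * Real.exp (-v) := by
    rw [abs_div, abs_of_pos hw, div_le_iff₀ hw, hL]
    refine (abs_weight'_le hϑ hϑΘ hv0.le).trans ?_
    rw [div_mul_eq_mul_div, div_mul_eq_mul_div, le_div_iff₀ hc0]
    gcongr
  have b2 : |weight'' ϑ v / weight ϑ v| ≤ L2 * Real.exp (-v) := by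
    rw [abs_div, abs_of_pos hw, div_le_iff₀ hw, hL2]
    refine (abs_weight''_le hϑ hϑΘ hv0.le).trans ?_
    rw [div_mul_eq_mul_div, div_mul_eq_mul_div, le_div_iff₀ hc0]
    gcongr
  have b3 : |(weight' ϑ v / weight ϑ v) ^ 2| ≤ L ^ 2 * Real.exp (-v) := by
    rw [abs_pow]
    calc |weight' ϑ v / weight ϑ v| ^ 2 ≤ (L * Real.exp (-v)) ^ 2 := by gcongr
      _ = L ^ 2 * (Real.exp (-v) * Real.exp (-v)) := by ring
      _ ≤ L ^ 2 * (1 * Real.exp (-v)) := by gcongr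
      _ = _ := by ring
  have e1 : x ^ (-α - 1) = v * x⁻¹ := by
    rw [Real.rpow_sub hx, Real.rpow_one]; rfl
  have e2 : x ^ (-α - 2) = v * (x⁻¹) ^ 2 := by
    rw [Real.rpow_sub hx, Real.rpow_two, div_eq_mul_inv, inv_pow]
  have hxi : 0 < x⁻¹ := inv_pos.2 hx
  have e3 : (x⁻¹) ^ 2 = x ^ (-(3 / 2) : ℝ) * x ^ (-(1 / 2) : ℝ) := by
    rw [← Real.rpow_add hx, ← Real.rpow_natCast, ← Real.rpow_neg_one, ← Real.rpow_mul hx.le]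
    norm_num
  -- This trades the spare x^{-1/2} of x^{-2} = x^{-3/2} x^{-1/2} for powers of v: for x ≤ 1 it is
  -- at most x^{-2α} = v², because α ≥ 1/4.
  have e4 : x ^ (-(1 / 2) : ℝ) ≤ 1 + v ^ 2 := by
    rcases le_total 1 x with hx1 | hx1
    · have := Real.rpow_le_one_of_one_le_of_nonpos hx1 (by norm_num : (-(1 / 2) : ℝ) ≤ 0)
      nlinarith [sq_nonneg v]
    · have h3 : v ^ 2 = x ^ (-(2 * α)) := by
        rw [hv, ← Real.rpow_natCast, ← Real.rpow_mul hx.le]; congr 1; push_cast; ring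
      have := Real.rpow_le_rpow_of_exponent_ge hx hx1 (by linarith : -(2 * α) ≤ -(1 / 2))
      rw [h3]
      linarith
  have hpoly : Real.exp (-v) * (v + v ^ 2) * (x⁻¹) ^ 2 ≤ 33 * x ^ (-(3 / 2) : ℝ) := by
    have h3 := pow_poly_le_exp hv0.le
    have h4 : Real.exp (-v) * Real.exp v = 1 := by rw [← Real.exp_add]; simp
    rw [e3]
    have h5 : 0 < x ^ (-(3 / 2) : ℝ) := Real.rpow_pos_of_pos hx _
    calc Real.exp (-v) * (v + v ^ 2) * (x ^ (-(3 / 2) : ℝ) * x ^ (-(1 / 2) : ℝ))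
        ≤ Real.exp (-v) * (v + v ^ 2) * (x ^ (-(3 / 2) : ℝ) * (1 + v ^ 2)) := by gcongr
      _ = Real.exp (-v) * ((v + v ^ 2) * (1 + v ^ 2)) * x ^ (-(3 / 2) : ℝ) := by ring
      _ ≤ Real.exp (-v) * (33 * Real.exp v) * x ^ (-(3 / 2) : ℝ) := by gcongr
      _ = 33 * (Real.exp (-v) * Real.exp v) * x ^ (-(3 / 2) : ℝ) := by ring
      _ = _ := by rw [h4]; ring
  have hα2 : α ^ 2 ≤ 1 := by nlinarith
  have hα3 : α * (α + 1) ≤ 2 := by nlinarith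
  have hα0 : 0 ≤ α * (α + 1) := by nlinarith
  unfold logWeight''
  rw [← hv, e1, e2]
  have t1 : |(weight'' ϑ v / weight ϑ v - (weight' ϑ v / weight ϑ v) ^ 2) * (-α * (v * x⁻¹)) ^ 2|
      ≤ ((L2 + L ^ 2) * Real.exp (-v)) * (v ^ 2 * (x⁻¹) ^ 2) := by
    rw [abs_mul]
    refine mul_le_mul ?_ ?_ (abs_nonneg _) (by positivity)
    · refine (abs_sub _ _).trans ?_
      linarith
    · rw [abs_of_nonneg (sq_nonneg _)]
      have : (-α * (v * x⁻¹)) ^ 2 = α ^ 2 * (v ^ 2 * (x⁻¹) ^ 2) := by ring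
      rw [this]
      exact mul_le_of_le_one_left (by positivity) hα2
  have t2 : |weight' ϑ v / weight ϑ v * (α * (α + 1) * (v * (x⁻¹) ^ 2))|
      ≤ (L * Real.exp (-v)) * (2 * (v * (x⁻¹) ^ 2)) := by
    rw [abs_mul]
    refine mul_le_mul b1 ?_ (abs_nonneg _) (by positivity)
    rw [abs_of_nonneg (by positivity)]
    gcongr
  refine (abs_add_le _ _).trans ((add_le_add t1 t2).trans ?_)
  have hA : 0 ≤ Real.exp (-v) * (v * (x⁻¹) ^ 2) := by positivity
  have hB : 0 ≤ Real.exp (-v) * (v ^ 2 * (x⁻¹) ^ 2) := by positivity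
  calc ((L2 + L ^ 2) * Real.exp (-v)) * (v ^ 2 * (x⁻¹) ^ 2)
        + (L * Real.exp (-v)) * (2 * (v * (x⁻¹) ^ 2))
      ≤ (L2 + L ^ 2 + 2 * L) * (Real.exp (-v) * (v + v ^ 2) * (x⁻¹) ^ 2) := by
        have h5 : 0 ≤ (L2 + L ^ 2) * (Real.exp (-v) * (v * (x⁻¹) ^ 2)) := by positivity
        have h6 : 0 ≤ L * (Real.exp (-v) * (v ^ 2 * (x⁻¹) ^ 2)) := by positivity
        linarith
    _ ≤ (L2 + L ^ 2 + 2 * L) * (33 * x ^ (-(3 / 2) : ℝ)) := by gcongr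
    _ = _ := by ring

end

section

variable {α : ℝ}

theorem integral_rpow_neg_scaled {n s : ℝ} (hn : 0 < n) (hs : s < 1) (N : ℕ) :
    n * ∫ x in (0 : ℝ)..(N + 1 : ℝ) / n, x ^ (-s) = n ^ s * ((N + 1 : ℝ) ^ (1 - s) / (1 - s)) := by
  have h1s : (1 : ℝ) - s ≠ 0 := by linarith
  rw [integral_rpow (Or.inl (by linarith))]
  have e : -s + 1 = 1 - s := by ring
  rw [e, Real.zero_rpow h1s, sub_zero, Real.div_rpow (by positivity) hn.le]
  have e2 : n ^ (1 - s) = n / n ^ s := by rw [Real.rpow_sub hn, Real.rpow_one]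
  have h3 : n ^ s ≠ 0 := (Real.rpow_pos_of_pos hn s).ne'
  rw [e2]
  field_simp

theorem sum_rpow_neg_scaled {n : ℝ} (hn : 0 < n) (s : ℝ) (N : ℕ) :
    ∑ i ∈ Finset.range N, (((i : ℝ) + 2) / n) ^ (-s)
      = n ^ s * (∑ i ∈ Finset.range (N + 1), (i + 1 : ℝ) ^ (-s) - 1) := by
  rw [Finset.sum_range_succ']
  simp only [Nat.cast_zero, zero_add, Real.one_rpow, add_sub_cancel_right, Finset.mul_sum]
  refine Finset.sum_congr rfl fun i _ => ?_
  rw [Real.div_rpow (by positivity) hn.le, Real.rpow_neg hn.le, div_inv_eq_mul]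
  push_cast
  rw [mul_comm]
  ring_nf

theorem intervalIntegrable_rpow_neg {s a b : ℝ} (hs : s < 1) :
    IntervalIntegrable (fun x : ℝ => x ^ (-s)) volume a b :=
  intervalIntegral.intervalIntegrable_rpow' (by linarith)

theorem intervalIntegrable_log_weight (h1 : 1 / 3 < α) (h2 : α < 1 / 2) (ϑ : ℝ) {b : ℝ}
    (hb : 0 ≤ b) :
    IntervalIntegrable (fun x : ℝ => Real.log (weight ϑ (x ^ (-α)))) volume 0 b := by
  have h3 : IntervalIntegrable (fun x : ℝ => cgf ϑ (x ^ (-α))) volume 0 b := by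
    rw [intervalIntegrable_iff_integrableOn_Ioc_of_le hb]
    exact (integrableOn_cgf h1 h2 ϑ).mono_set Set.Ioc_subset_Ioi_self
  have h4 := ((h3.sub ((intervalIntegrable_rpow_neg (s := α) (a := 0) (b := b)
    (by linarith)).const_mul ϑ)).add ((intervalIntegrable_rpow_neg (s := 2 * α) (a := 0) (b := b)
    (by linarith)).const_mul ϑ))
  refine h4.congr fun x hx => ?_
  rw [Set.uIoc_of_le hb] at hx
  have e : x ^ (-(2 * α)) = (x ^ (-α)) ^ 2 := by
    rw [← Real.rpow_natCast, ← Real.rpow_mul hx.1.le]; congr 1; push_cast; ring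
  simp only [cgf, e]
  ring

/-- The trapezoidal rule for `log (weight ϑ (x ^ (-α)))` away from the singularity. -/
theorem exists_trapezoid_log_weight (h1 : 1 / 3 < α) (h2 : α < 1 / 2) {Θ : ℝ} (hΘ : 0 ≤ Θ) :
    ∃ C, 0 ≤ C ∧ ∀ ϑ, 0 ≤ ϑ → ϑ ≤ Θ → ∀ n : ℝ, 0 < n → ∀ N : ℕ,
      |n * (∫ x in (1 / n)..(N + 1 : ℝ) / n, Real.log (weight ϑ (x ^ (-α))))
        - ∑ i ∈ Finset.range N, (Real.log (weight ϑ ((((i : ℝ) + 1) / n) ^ (-α)))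
          + Real.log (weight ϑ ((((i : ℝ) + 2) / n) ^ (-α)))) / 2| ≤ C * n ^ (-(1 / 2) : ℝ) := by
  obtain ⟨C, hC, hCb⟩ := exists_abs_logWeight''_le h1 h2 hΘ
  have hS : Summable (fun i : ℕ => ((i : ℝ) + 1) ^ (-(3 / 2) : ℝ)) := by
    have := (summable_nat_add_iff 1).2
      (Real.summable_nat_rpow.2 (by norm_num : (-(3 / 2) : ℝ) < -1))
    simpa using this
  refine ⟨2 * C * ∑' i : ℕ, ((i : ℝ) + 1) ^ (-(3 / 2) : ℝ), by positivity, ?_⟩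
  intro ϑ hϑ hϑΘ n hn N
  set g : ℝ → ℝ := fun x => Real.log (weight ϑ (x ^ (-α))) with hg
  have hcell : ∀ i : ℕ, |n * (∫ x in ((i : ℝ) + 1) / n..((i + 1 : ℕ) + 1 : ℝ) / n, g x)
      - (g (((i : ℝ) + 1) / n) + g (((i : ℝ) + 2) / n)) / 2|
      ≤ 2 * C * n ^ (-(1 / 2) : ℝ) * ((i : ℝ) + 1) ^ (-(3 / 2) : ℝ) := by
    intro i
    set a : ℝ := ((i : ℝ) + 1) / n with ha
    have ha0 : 0 < a := by positivity
    have hb : ((i : ℝ) + 2) / n = a + 1 / n := by rw [ha]; ring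
    have hb' : (((i + 1 : ℕ) : ℝ) + 1) / n = a + 1 / n := by rw [ha]; push_cast; ring
    have hpos : ∀ x ∈ Set.Icc a (a + 1 / n), 0 < x := fun x hx => ha0.trans_le hx.1
    have ht := trapezoid_error_le (g := g) (a := a) (h := 1 / n)
      (M := C * a ^ (-(3 / 2) : ℝ)) (by positivity)
      (fun x hx => hasDerivAt_log_weight_rpow (hpos x hx))
      (fun x hx => hasDerivAt_log_weight_rpow' (hpos x hx))
      (fun x hx => (hCb ϑ hϑ hϑΘ x (hpos x hx)).trans
        (mul_le_mul_of_nonneg_left (Real.rpow_le_rpow_of_nonpos ha0 hx.1 (by norm_num)) hC))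
    rw [hb, hb']
    have e : n * (∫ x in a..a + 1 / n, g x) - (g a + g (a + 1 / n)) / 2
        = n * ((∫ x in a..a + 1 / n, g x) - 1 / n * ((g a + g (a + 1 / n)) / 2)) := by
      field_simp
    rw [e, abs_mul, abs_of_pos hn]
    refine (mul_le_mul_of_nonneg_left ht hn.le).trans_eq ?_
    -- The bound n · a^{-3/2} · n^{-3} with a = (i + 1)/n leaves n^{-1/2} (i + 1)^{-3/2}.
    have e2 : a ^ (-(3 / 2) : ℝ) = ((i : ℝ) + 1) ^ (-(3 / 2) : ℝ) * n ^ (3 / 2 : ℝ) := by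
      rw [ha, Real.div_rpow (by positivity) hn.le, Real.rpow_neg hn.le (3 / 2), div_inv_eq_mul]
    have e3 : n ^ (3 / 2 : ℝ) = n ^ 2 * n ^ (-(1 / 2) : ℝ) := by
      rw [← Real.rpow_natCast, ← Real.rpow_add hn]; norm_num
    rw [e2, e3]
    field_simp
  have hsum : ∫ x in (1 / n)..(N + 1 : ℝ) / n, g x
      = ∑ i ∈ Finset.range N, ∫ x in ((i : ℝ) + 1) / n..((i + 1 : ℕ) + 1 : ℝ) / n, g x := by
    have hint : ∀ b : ℝ, 0 ≤ b → IntervalIntegrable g volume 0 b := fun b hb =>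
      intervalIntegrable_log_weight h1 h2 ϑ hb
    have := intervalIntegral.sum_integral_adjacent_intervals (μ := volume) (f := g)
      (a := fun i : ℕ => ((i : ℝ) + 1) / n) (n := N)
      (fun i _ => (hint _ (by positivity)).symm.trans (hint _ (by positivity)))
    rw [this]
    simp
  rw [hsum, Finset.mul_sum, ← Finset.sum_sub_distrib]
  refine (Finset.abs_sum_le_sum_abs _ _).trans ((Finset.sum_le_sum fun i _ => hcell i).trans ?_)
  rw [← Finset.mul_sum]
  have := hS.sum_le_tsum (Finset.range N) (fun i _ => by positivity)
  calc _ ≤ 2 * C * n ^ (-(1 / 2) : ℝ) * ∑' i : ℕ, ((i : ℝ) + 1) ^ (-(3 / 2) : ℝ) := by gcongr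
    _ = _ := by ring

theorem summable_of_abs_le_env {g : ℝ → ℝ} {C n : ℝ} (h1 : 1 / 3 < α) (hn : 0 < n)
    (hb : ∀ y, 0 ≤ y → |g y| ≤ C * env y) :
    Summable (fun i : ℕ => g ((((i : ℝ) + 2) / n) ^ (-α))) :=
  Summable.of_norm_bounded ((summable_env_rpow h1 hn).mul_left C) fun i =>
    hb _ (Real.rpow_nonneg (by positivity) _)

theorem summable_cgf {n : ℝ} (h1 : 1 / 3 < α) (hn : 0 < n) (ϑ : ℝ) :
    Summable (fun i : ℕ => cgf ϑ ((((i : ℝ) + 2) / n) ^ (-α))) :=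
  summable_of_abs_le_env h1 hn fun _ hy => abs_cgf_le hy le_rfl

theorem summable_dcgf {n : ℝ} (h1 : 1 / 3 < α) (hn : 0 < n) (ϑ : ℝ) :
    Summable (fun i : ℕ => dcgf ϑ ((((i : ℝ) + 2) / n) ^ (-α))) :=
  summable_of_abs_le_env h1 hn fun _ hy => abs_dcgf_le hy

theorem summable_tiltVar {n : ℝ} (h1 : 1 / 3 < α) (hn : 0 < n) (ϑ : ℝ) :
    Summable (fun i : ℕ => tiltVar ϑ ((((i : ℝ) + 2) / n) ^ (-α))) :=
  summable_of_abs_le_env h1 hn fun _ hy => by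
    rw [abs_of_nonneg (tiltVar_nonneg hy)]; exact tiltVar_le hy le_rfl

theorem continuousAt_log_weight_zero (ϑ : ℝ) :
    Tendsto (fun y => Real.log (weight ϑ y)) (𝓝 0) (𝓝 0) := by
  have h := ((hasDerivAt_weight_right ϑ 0).log (weight_pos le_rfl).ne').continuousAt.tendsto
  have e : weight ϑ 0 = 1 := by simp [weight]
  simpa [e] using h

/-- The Euler–Maclaurin expansion of `∑ cgf ϑ ((i / n) ^ (-α))`, with an explicit error. -/
theorem exists_abs_tsum_cgf_sub_le (h1 : 1 / 3 < α) (h2 : α < 1 / 2) {Θ : ℝ} (hΘ : 0 ≤ Θ) :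
    ∃ C, 0 ≤ C ∧ ∀ ϑ, 0 ≤ ϑ → ϑ ≤ Θ → ∀ n : ℝ, 1 ≤ n →
      |∑' i : ℕ, cgf ϑ ((((i : ℝ) + 2) / n) ^ (-α))
        - (n * cgfInt α ϑ + ϑ * n ^ α * (zetaReal α - 1)
          - ϑ * n ^ (2 * α) * (zetaReal (2 * α) - 1))|
        ≤ C * n ^ (-(1 / 2) : ℝ) + 3 * Real.exp (-n ^ α) := by
  obtain ⟨C, hC, hCb⟩ := exists_trapezoid_log_weight h1 h2 hΘ
  refine ⟨C, hC, ?_⟩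
  intro ϑ hϑ hϑΘ n hn1
  have hn : 0 < n := by linarith
  set g : ℝ → ℝ := fun x => Real.log (weight ϑ (x ^ (-α))) with hg
  set Z : ℝ → ℕ → ℝ := fun s N => ∑ i ∈ Finset.range (N + 1), (i + 1 : ℝ) ^ (-s)
    - (N + 1 : ℝ) ^ (1 - s) / (1 - s) with hZ
  have hgint : ∀ b : ℝ, 0 ≤ b → IntervalIntegrable g volume 0 b := fun b hb =>
    intervalIntegrable_log_weight h1 h2 ϑ hb
  have hsq : ∀ x : ℝ, 0 < x → x ^ (-(2 * α)) = (x ^ (-α)) ^ 2 := fun x hx => by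
    rw [← Real.rpow_natCast, ← Real.rpow_mul hx.le]; congr 1; push_cast; ring
  -- On the first cell the argument x^{-α} is at least n^α, so log weight is exponentially small and
  -- no quadrature is needed near the singularity.
  have hgsmall : ∀ x, 0 < x → x ≤ 1 / n → |g x| ≤ 2 * Real.exp (-n ^ α) := by
    intro x hx hxn
    have h3 : n ^ α ≤ x ^ (-α) := by
      have := Real.rpow_le_rpow_of_nonpos hx hxn (by linarith : -α ≤ 0)
      rwa [one_div, Real.inv_rpow hn.le, Real.rpow_neg hn.le, inv_inv] at this
    have h4 : 1 ≤ n ^ α := Real.one_le_rpow hn1 (by linarith)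
    refine (abs_log_weight_le hϑ (h4.trans h3)).trans ?_
    have := Real.exp_le_exp.2 (neg_le_neg h3)
    linarith
  have hfirst : |n * ∫ x in (0 : ℝ)..1 / n, g x| ≤ 2 * Real.exp (-n ^ α) := by
    have := intervalIntegral.norm_integral_le_of_norm_le_const (a := 0) (b := 1 / n) (f := g)
      (C := 2 * Real.exp (-n ^ α)) (fun x hx => by
        rw [Set.uIoc_of_le (by positivity)] at hx
        exact hgsmall x hx.1 hx.2)
    rw [abs_mul, abs_of_pos hn]
    rw [Real.norm_eq_abs, sub_zero, abs_of_pos (by positivity : 0 < 1 / n)] at this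
    calc n * |∫ x in (0 : ℝ)..1 / n, g x| ≤ n * (2 * Real.exp (-n ^ α) * (1 / n)) := by gcongr
      _ = _ := by field_simp
  have hA : Tendsto (fun N : ℕ => ∑ i ∈ Finset.range N, cgf ϑ ((((i : ℝ) + 2) / n) ^ (-α))) atTop
      (𝓝 (∑' i : ℕ, cgf ϑ ((((i : ℝ) + 2) / n) ^ (-α)))) :=
    (summable_cgf h1 hn ϑ).hasSum.tendsto_sum_nat
  have hNn : Tendsto (fun N : ℕ => (N + 1 : ℝ) / n) atTop atTop :=
    (tendsto_atTop_add_const_right _ _ tendsto_natCast_atTop_atTop).atTop_div_const hn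
  have hI : Tendsto (fun N : ℕ => ∫ x in (0 : ℝ)..(N + 1 : ℝ) / n, cgf ϑ (x ^ (-α))) atTop
      (𝓝 (cgfInt α ϑ)) :=
    intervalIntegral_tendsto_integral_Ioi 0 (integrableOn_cgf h1 h2 ϑ) hNn
  have hgN : Tendsto (fun N : ℕ => |g ((N + 1 : ℝ) / n)| / 2) atTop (𝓝 0) := by
    have h3 : Tendsto (fun x : ℝ => x ^ (-α)) atTop (𝓝 0) := tendsto_rpow_neg_atTop (by linarith)
    have h4 := ((continuousAt_log_weight_zero ϑ).comp (h3.comp hNn)).abs.div_const 2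
    simpa using h4
  have hZ1 := tendsto_sum_rpow_sub (s := α) (by linarith) (by linarith)
  have hZ2 := tendsto_sum_rpow_sub (s := 2 * α) (by linarith) (by linarith)
  have hlim := (hA.sub (((hI.const_mul n).add ((hZ1.sub_const 1).const_mul (ϑ * n ^ α))).sub
    ((hZ2.sub_const 1).const_mul (ϑ * n ^ (2 * α))))).abs
  have hrhs : Tendsto (fun N : ℕ => C * n ^ (-(1 / 2) : ℝ) + 3 * Real.exp (-n ^ α)
      + |g ((N + 1 : ℝ) / n)| / 2) atTop (𝓝 (C * n ^ (-(1 / 2) : ℝ) + 3 * Real.exp (-n ^ α))) := by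
    simpa using hgN.const_add (C * n ^ (-(1 / 2) : ℝ) + 3 * Real.exp (-n ^ α))
  -- The estimate is proved for truncations at N and passed to the limit. The coefficient 3 collects
  -- 2 from the integral over the first cell and 1 from half of |g(1/n)|.
  refine le_of_tendsto_of_tendsto' hlim hrhs fun N => ?_
  -- The logarithm goes to the trapezoidal rule; the two pure powers, not summable separately, are
  -- matched with their integrals and yield the zeta values. Each -1 is the absent term i = 1.
  have e1 : ∑ i ∈ Finset.range N, cgf ϑ ((((i : ℝ) + 2) / n) ^ (-α))
      = ∑ i ∈ Finset.range N, g (((i : ℝ) + 2) / n)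
        + ϑ * (n ^ α * (∑ i ∈ Finset.range (N + 1), (i + 1 : ℝ) ^ (-α) - 1))
        - ϑ * (n ^ (2 * α) * (∑ i ∈ Finset.range (N + 1), (i + 1 : ℝ) ^ (-(2 * α)) - 1)) := by
    rw [← sum_rpow_neg_scaled hn, ← sum_rpow_neg_scaled hn, Finset.mul_sum, Finset.mul_sum,
      ← Finset.sum_add_distrib, ← Finset.sum_sub_distrib]
    refine Finset.sum_congr rfl fun i _ => ?_
    rw [hsq _ (by positivity)]
    rfl
  -- Trapezoidal and right-endpoint sums differ by half a telescoping sum.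
  have e2 : ∑ i ∈ Finset.range N, (g (((i : ℝ) + 1) / n) + g (((i : ℝ) + 2) / n)) / 2
      = ∑ i ∈ Finset.range N, g (((i : ℝ) + 2) / n)
        - (g ((N + 1 : ℝ) / n) - g (1 / n)) / 2 := by
    have h3 := Finset.sum_range_sub (fun i : ℕ => g (((i : ℝ) + 1) / n)) N
    simp only [Nat.cast_zero, zero_add] at h3
    rw [← h3, Finset.sum_div, ← Finset.sum_sub_distrib]
    refine Finset.sum_congr rfl fun i _ => ?_
    have : ((i + 1 : ℕ) : ℝ) + 1 = i + 2 := by push_cast; ring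
    rw [this]
    ring
  have hb0 : (0 : ℝ) ≤ (N + 1 : ℝ) / n := by positivity
  have e3 : n * ∫ x in (0 : ℝ)..(N + 1 : ℝ) / n, cgf ϑ (x ^ (-α))
      = n * (∫ x in (0 : ℝ)..1 / n, g x) + n * (∫ x in (1 / n)..(N + 1 : ℝ) / n, g x)
        + ϑ * (n ^ α * ((N + 1 : ℝ) ^ (1 - α) / (1 - α)))
        - ϑ * (n ^ (2 * α) * ((N + 1 : ℝ) ^ (1 - 2 * α) / (1 - 2 * α))) := by
    rw [← integral_rpow_neg_scaled hn (by linarith), ← integral_rpow_neg_scaled hn (by linarith),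
      ← mul_add, intervalIntegral.integral_add_adjacent_intervals (hgint _ (by positivity))
        ((hgint _ (by positivity)).symm.trans (hgint _ hb0))]
    have h3 : ∫ x in (0 : ℝ)..(N + 1 : ℝ) / n, cgf ϑ (x ^ (-α))
        = ∫ x in (0 : ℝ)..(N + 1 : ℝ) / n, (g x + ϑ * x ^ (-α) - ϑ * x ^ (-(2 * α))) := by
      refine intervalIntegral.integral_congr_ae (Eventually.of_forall fun x hx => ?_)
      rw [Set.uIoc_of_le hb0] at hx
      rw [hsq x hx.1]
      rfl
    rw [h3, intervalIntegral.integral_sub ((hgint _ hb0).add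
        ((intervalIntegrable_rpow_neg (by linarith)).const_mul ϑ))
        ((intervalIntegrable_rpow_neg (by linarith)).const_mul ϑ),
      intervalIntegral.integral_add (hgint _ hb0)
        ((intervalIntegrable_rpow_neg (by linarith)).const_mul ϑ),
      intervalIntegral.integral_const_mul, intervalIntegral.integral_const_mul]
    ring
  have ht := hCb ϑ hϑ hϑΘ n hn N
  have ht' : |n * (∫ x in (1 / n)..(N + 1 : ℝ) / n, g x)
      - ∑ i ∈ Finset.range N, (g (((i : ℝ) + 1) / n) + g (((i : ℝ) + 2) / n)) / 2|
      ≤ C * n ^ (-(1 / 2) : ℝ) := ht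
  rw [e2] at ht'
  have hg1 := hgsmall (1 / n) (by positivity) le_rfl
  rw [e1, e3]
  rw [abs_le] at ht' hfirst hg1 ⊢
  have hgNa := abs_le.1 (le_refl |g ((N + 1 : ℝ) / n)|)
  constructor <;> linarith [ht'.1, ht'.2, hfirst.1, hfirst.2, hg1.1, hg1.2, hgNa.1, hgNa.2]

end

/-! ### The log-moment generating function at its saddle point -/

/-- The scaled jump sizes `u c_i`, indexed from `i = 2`. -/
noncomputable def jump (τ u : ℝ) (i : ℕ) : ℝ := u * coeff τ (i + 2)

theorem coeff_pos (τ : ℝ) (i : ℕ) : 0 < coeff τ (i + 2) :=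
  Real.rpow_pos_of_pos (by positivity) _

theorem jump_pos {τ u : ℝ} (hu : 0 < u) (i : ℕ) : 0 < jump τ u i := mul_pos hu (coeff_pos τ i)

theorem rpow_rpow_alpha {τ u : ℝ} (hτ : 1 < τ) (hu : 0 ≤ u) : (u ^ (τ - 1)) ^ alpha τ = u := by
  rw [← Real.rpow_mul hu, alpha, mul_one_div_cancel (by linarith), Real.rpow_one]

/-- With n = u^{τ-1} the jumps are the values of x^{-α} at the points i/n, i ≥ 2; this makes sums
over jumps into Riemann sums. -/
theorem jump_eq {τ u : ℝ} (hτ : 1 < τ) (hu : 0 < u) (i : ℕ) :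
    jump τ u i = (((i : ℝ) + 2) / u ^ (τ - 1)) ^ (-alpha τ) := by
  have hn : 0 < u ^ (τ - 1) := Real.rpow_pos_of_pos hu _
  rw [Real.div_rpow (by positivity) hn.le, Real.rpow_neg hn.le, rpow_rpow_alpha hτ hu.le, jump,
    coeff, div_inv_eq_mul, mul_comm]
  push_cast
  rfl

/-- The logarithm of the moment generating function of `u S_u` at `ϑ`. -/
noncomputable def logMgf (τ β u ϑ : ℝ) : ℝ :=
  ϑ * (u * (1 + β * u)) + ∑' i, cgf ϑ (jump τ u i)

/-- The mean of `u S_u` under the tilt by `ϑ`. -/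
noncomputable def tiltMean (τ β u ϑ : ℝ) : ℝ :=
  u * (1 + β * u) + ∑' i, dcgf ϑ (jump τ u i)

/-- The value at which the variational problem is perturbed. -/
noncomputable def perturbation (τ β u : ℝ) : ℝ :=
  zetaReal (alpha τ) * u ^ (-(τ - 2)) + (β + 1 - zetaReal (2 * alpha τ)) * u ^ (-(τ - 3))

section

variable {τ : ℝ}

theorem summable_cgf_jump (hτ : 3 < τ) (hτ' : τ < 4) {u : ℝ} (hu : 0 < u) (ϑ : ℝ) :
    Summable fun i => cgf ϑ (jump τ u i) := by
  simp only [jump_eq (by linarith : 1 < τ) hu]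
  exact summable_cgf (alpha_bounds hτ hτ').1 (Real.rpow_pos_of_pos hu _) ϑ

theorem summable_dcgf_jump (hτ : 3 < τ) (hτ' : τ < 4) {u : ℝ} (hu : 0 < u) (ϑ : ℝ) :
    Summable fun i => dcgf ϑ (jump τ u i) := by
  simp only [jump_eq (by linarith : 1 < τ) hu]
  exact summable_dcgf (alpha_bounds hτ hτ').1 (Real.rpow_pos_of_pos hu _) ϑ

theorem summable_tiltVar_jump (hτ : 3 < τ) (hτ' : τ < 4) {u : ℝ} (hu : 0 < u) (ϑ : ℝ) :
    Summable fun i => tiltVar ϑ (jump τ u i) := by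
  simp only [jump_eq (by linarith : 1 < τ) hu]
  exact summable_tiltVar (alpha_bounds hτ hτ').1 (Real.rpow_pos_of_pos hu _) ϑ

theorem summable_env_jump (hτ : 3 < τ) (hτ' : τ < 4) {u : ℝ} (hu : 0 < u) :
    Summable fun i => env (jump τ u i) := by
  simp only [jump_eq (by linarith : 1 < τ) hu]
  exact summable_env_rpow (alpha_bounds hτ hτ').1 (Real.rpow_pos_of_pos hu _)

theorem tendsto_rpow_sub_one (hτ : 1 < τ) : Tendsto (fun u : ℝ => u ^ (τ - 1)) atTop atTop :=
  tendsto_rpow_atTop (by linarith)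

/-- Riemann sums over the jumps, for a family of functions converging continuously. -/
theorem tendsto_tsum_jump (hτ : 3 < τ) (hτ' : τ < 4) {q : ℝ → ℝ → ℝ} {q₀ : ℝ → ℝ} {C : ℝ}
    (hq : ∀ᶠ u in atTop, ∀ y, 0 ≤ y → |q u y| ≤ C * env y)
    (hlim : ∀ y > 0, ∀ w : ℝ → ℝ, Tendsto w atTop (𝓝 y) →
      Tendsto (fun u => q u (w u)) atTop (𝓝 (q₀ y))) (hC : 0 ≤ C) :
    Tendsto (fun u => (∑' i, q u (jump τ u i)) / u ^ (τ - 1)) atTop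
      (𝓝 (∫ x in Set.Ioi (0 : ℝ), q₀ (x ^ (-alpha τ)))) := by
  obtain ⟨h1, h2⟩ := alpha_bounds hτ hτ'
  have h := tendsto_riemann_sum (l := atTop) (q := fun u x => q u (x ^ (-alpha τ)))
    (q₀ := fun x => q₀ (x ^ (-alpha τ))) (D := fun x => C * env (x ^ (-alpha τ)))
    (n := fun u : ℝ => u ^ (τ - 1)) (tendsto_rpow_sub_one (by linarith))
    (fun a ha b hb hab => mul_le_mul_of_nonneg_left
      (antitoneOn_env_rpow (by linarith) ha hb hab) hC)
    ((integrableOn_env_rpow h1 h2).const_mul C)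
    (by filter_upwards [hq] with u hu x hx using hu _ (Real.rpow_nonneg hx.le _))
    (fun x hx w hw => hlim _ (Real.rpow_pos_of_pos hx _) _
      (hw.rpow_const (Or.inl hx.ne')))
  refine h.congr' ?_
  filter_upwards [eventually_gt_atTop 0] with u hu
  simp only [jump_eq (by linarith : 1 < τ) hu]

theorem continuousAt_tiltRatio {ϑ y : ℝ} (hy : 0 ≤ y) :
    ContinuousAt (fun p : ℝ × ℝ => tiltRatio p.1 p.2) (ϑ, y) := by
  simp only [tiltRatio_eq]
  refine ContinuousAt.div (by fun_prop) ?_ (weight_pos hy).ne'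
  unfold weight
  fun_prop

theorem tendsto_tiltRatio {l : Filter ℝ} {t w : ℝ → ℝ} {θ y : ℝ} (hy : 0 ≤ y)
    (ht : Tendsto t l (𝓝 θ)) (hw : Tendsto w l (𝓝 y)) :
    Tendsto (fun u => tiltRatio (t u) (w u)) l (𝓝 (tiltRatio θ y)) :=
  (continuousAt_tiltRatio hy).tendsto.comp (ht.prodMk_nhds hw)

/-- The drift u(1 + βu) disappears in the limit because τ - 1 > 2. -/
theorem tendsto_tiltMean_div (hτ : 3 < τ) (hτ' : τ < 4) (β ϑ : ℝ) :
    Tendsto (fun u => tiltMean τ β u ϑ / u ^ (τ - 1)) atTop (𝓝 (dcgfInt (alpha τ) ϑ)) := by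
  have h1 := tendsto_tsum_jump hτ hτ' (q := fun _ => dcgf ϑ) (q₀ := dcgf ϑ)
    (C := 2 + |ϑ| * Real.exp (2 * |ϑ|)) (Eventually.of_forall fun _ _ hy => abs_dcgf_le hy)
    (fun y hy w hw => hw.mul ((tendsto_tiltRatio hy.le tendsto_const_nhds hw).sub hw))
    (by positivity)
  have h2 : Tendsto (fun u : ℝ => u ^ (-(τ - 2)) + β * u ^ (-(τ - 3))) atTop (𝓝 0) := by
    simpa using (tendsto_rpow_neg_atTop (y := τ - 2) (by linarith)).add
      ((tendsto_rpow_neg_atTop (y := τ - 3) (by linarith)).const_mul β)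
  have h3 := h2.add h1
  rw [zero_add] at h3
  refine h3.congr' ?_
  filter_upwards [eventually_gt_atTop 0] with u hu
  have hn : u ^ (τ - 1) ≠ 0 := (Real.rpow_pos_of_pos hu _).ne'
  have e1 : u ^ (-(τ - 2)) = u / u ^ (τ - 1) := by
    rw [eq_div_iff hn, ← Real.rpow_add hu]; ring_nf; exact Real.rpow_one u
  have e2 : u ^ (-(τ - 3)) = u ^ 2 / u ^ (τ - 1) := by
    rw [eq_div_iff hn, ← Real.rpow_add hu, ← Real.rpow_natCast]; congr 1; push_cast; ring
  rw [e1, e2, tiltMean]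
  field_simp

theorem strictMono_tiltMean (hτ : 3 < τ) (hτ' : τ < 4) (β : ℝ) {u : ℝ} (hu : 0 < u) :
    StrictMono (tiltMean τ β u) := fun a b hab => by
  refine add_lt_add_of_le_of_lt le_rfl ?_
  exact (summable_dcgf_jump hτ hτ' hu a).tsum_lt_tsum (i := 0)
    (fun i => monotone_dcgf (jump_pos hu i).le hab.le) (strictMono_dcgf (jump_pos hu 0) hab)
    (summable_dcgf_jump hτ hτ' hu b)

theorem continuousOn_tiltMean (hτ : 3 < τ) (hτ' : τ < 4) (β : ℝ) {u : ℝ} (hu : 0 < u) (Θ : ℝ) :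
    ContinuousOn (tiltMean τ β u) (Set.Icc (-Θ) Θ) := by
  refine continuousOn_const.add (continuousOn_tsum
    (u := fun i => (2 + Θ * Real.exp (2 * Θ)) * env (jump τ u i)) (fun i t _ => ?_)
    ((summable_env_jump hτ hτ' hu).mul_left _)
    (fun i t ht => abs_dcgf_le_of_abs_le (jump_pos hu i).le (abs_le.2 ht)))
  exact (hasDerivAt_dcgf (jump_pos hu i).le t).continuousAt.continuousWithinAt

/-- After division by n the tilted mean converges to Λ', which changes sign at θ. Hence for each η >
0 it eventually has a zero between θ - η and θ + η, and strict monotonicity puts every zero there.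
-/
theorem exists_tilt (hτ : 3 < τ) (hτ' : τ < 4) (β : ℝ) {θ : ℝ}
    (h0 : dcgfInt (alpha τ) θ = 0) :
    ∃ t : ℝ → ℝ, Tendsto t atTop (𝓝 θ) ∧ ∀ᶠ u in atTop, tiltMean τ β u (t u) = 0 := by
  obtain ⟨h1, h2⟩ := alpha_bounds hτ hτ'
  have hm := strictMono_dcgfInt h1 h2
  have key : ∀ η > 0, ∀ᶠ u in atTop, tiltMean τ β u (θ - η) < 0 ∧ 0 < tiltMean τ β u (θ + η) := by
    intro η hη
    have ha := hm (show θ - η < θ by linarith)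
    have hb := hm (show θ < θ + η by linarith)
    rw [h0] at ha hb
    filter_upwards [(tendsto_tiltMean_div hτ hτ' β (θ - η)).eventually (gt_mem_nhds ha),
      (tendsto_tiltMean_div hτ hτ' β (θ + η)).eventually (lt_mem_nhds hb),
      eventually_gt_atTop 0] with u hua hub hu
    have hn : 0 < u ^ (τ - 1) := Real.rpow_pos_of_pos hu _
    exact ⟨by simpa using (div_lt_iff₀ hn).1 hua, (div_pos_iff_of_pos_right hn).1 hub⟩
  have hex : ∀ᶠ u in atTop, ∃ t, tiltMean τ β u t = 0 := by
    filter_upwards [key 1 one_pos, eventually_gt_atTop 0] with u hu hu0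
    have hc := continuousOn_tiltMean hτ hτ' β hu0 (|θ| + 1)
    have hsub : Set.Icc (θ - 1) (θ + 1) ⊆ Set.Icc (-(|θ| + 1)) (|θ| + 1) :=
      Set.Icc_subset_Icc (by linarith [neg_abs_le θ]) (by linarith [le_abs_self θ])
    obtain ⟨t, -, ht⟩ := intermediate_value_Icc (by linarith : θ - 1 ≤ θ + 1) (hc.mono hsub)
      (show (0 : ℝ) ∈ _ from ⟨hu.1.le, hu.2.le⟩)
    exact ⟨t, ht⟩
  refine ⟨fun u => Classical.epsilon fun t => tiltMean τ β u t = 0, ?_, ?_⟩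
  · rw [Metric.tendsto_nhds]
    intro η hη
    filter_upwards [key η hη, hex, eventually_gt_atTop 0] with u hu hu2 hu0
    have hz := Classical.epsilon_spec hu2
    have hsm := strictMono_tiltMean hτ hτ' β hu0
    rw [Real.dist_eq, abs_lt]
    constructor
    · have := hsm.lt_iff_lt.1 (hu.1.trans_eq hz.symm)
      linarith
    · have := hsm.lt_iff_lt.1 (hz.trans_lt hu.2)
      linarith
  · filter_upwards [hex] with u hu using Classical.epsilon_spec hu

/-- The tangent line inequalities at ϑ₀ are summed over the jumps; the total slope is the tilted
mean, which is zero. -/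
theorem logMgf_le_of_tiltMean_eq_zero (hτ : 3 < τ) (hτ' : τ < 4) {β u ϑ₀ : ℝ} (hu : 0 < u)
    (h0 : tiltMean τ β u ϑ₀ = 0) (ϑ : ℝ) : logMgf τ β u ϑ₀ ≤ logMgf τ β u ϑ := by
  have h1 : ∑' i, (cgf ϑ₀ (jump τ u i) + (ϑ - ϑ₀) * dcgf ϑ₀ (jump τ u i))
      ≤ ∑' i, cgf ϑ (jump τ u i) :=
    ((summable_cgf_jump hτ hτ' hu ϑ₀).add
      ((summable_dcgf_jump hτ hτ' hu ϑ₀).mul_left _)).tsum_le_tsum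
      (fun i => cgf_add_mul_dcgf_le (jump_pos hu i).le ϑ₀ ϑ) (summable_cgf_jump hτ hτ' hu ϑ)
  rw [(summable_cgf_jump hτ hτ' hu ϑ₀).tsum_add ((summable_dcgf_jump hτ hτ' hu ϑ₀).mul_left _),
    tsum_mul_left] at h1
  have h2 : (ϑ - ϑ₀) * tiltMean τ β u ϑ₀ = 0 := by rw [h0, mul_zero]
  unfold tiltMean at h2
  unfold logMgf
  linarith

theorem rpow_mul_perturbation (β : ℝ) {u : ℝ} (hu : 0 < u) :
    u ^ (τ - 1) * perturbation τ β u
      = zetaReal (alpha τ) * u + (β + 1 - zetaReal (2 * alpha τ)) * u ^ 2 := by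
  have e1 : u ^ (τ - 1) * u ^ (-(τ - 2)) = u := by
    rw [← Real.rpow_add hu]; ring_nf; exact Real.rpow_one u
  have e2 : u ^ (τ - 1) * u ^ (-(τ - 3)) = u ^ 2 := by
    rw [← Real.rpow_add hu, ← Real.rpow_natCast]; congr 1; push_cast; ring
  calc _ = zetaReal (alpha τ) * (u ^ (τ - 1) * u ^ (-(τ - 2)))
        + (β + 1 - zetaReal (2 * alpha τ)) * (u ^ (τ - 1) * u ^ (-(τ - 3))) := by
        rw [perturbation]; ring
    _ = _ := by rw [e1, e2]

theorem tendsto_perturbation (hτ : 3 < τ) (β : ℝ) :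
    Tendsto (perturbation τ β) atTop (𝓝 0) := by
  have := ((tendsto_rpow_neg_atTop (y := τ - 2) (by linarith)).const_mul
    (zetaReal (alpha τ))).add ((tendsto_rpow_neg_atTop (y := τ - 3) (by linarith)).const_mul
    (β + 1 - zetaReal (2 * alpha τ)))
  rw [mul_zero, mul_zero, add_zero] at this
  exact this

/-- In the Euler–Maclaurin expansion n^α = u and n^{2α} = u². Added to the drift, the -1 in ζ(α) - 1
cancels the initial value 1 of the process, and the one in ζ(2α) - 1 gives β + 1 - ζ(2α). Uniformity
in the tilt allows it to depend on u. -/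
theorem tendsto_logMgf_sub (hτ : 3 < τ) (hτ' : τ < 4) (β : ℝ) {θ : ℝ} (hθ : 0 < θ)
    {t : ℝ → ℝ} (ht : Tendsto t atTop (𝓝 θ)) :
    Tendsto (fun u => logMgf τ β u (t u) - u ^ (τ - 1) *
      (cgfInt (alpha τ) (t u) + t u * perturbation τ β u)) atTop (𝓝 0) := by
  obtain ⟨h1, h2⟩ := alpha_bounds hτ hτ'
  obtain ⟨C, hC, hb⟩ := exists_abs_tsum_cgf_sub_le h1 h2 (Θ := θ + 1) (by linarith)
  have hlim : Tendsto (fun u : ℝ => C * (u ^ (τ - 1)) ^ (-(1 / 2) : ℝ) + 3 * Real.exp (-u)) atTop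
      (𝓝 0) := by
    have h3 := ((tendsto_rpow_neg_atTop (y := 1 / 2) (by norm_num)).comp
      (tendsto_rpow_sub_one (by linarith : 1 < τ))).const_mul C
    have h4 := (Real.tendsto_exp_neg_atTop_nhds_zero).const_mul 3
    simpa using h3.add h4
  refine squeeze_zero_norm' ?_ hlim
  filter_upwards [ht.eventually (lt_mem_nhds hθ), ht.eventually (gt_mem_nhds (lt_add_one θ)),
    eventually_ge_atTop 1] with u hu1 hu2 hu3
  have hu : 0 < u := by linarith
  have hn1 : 1 ≤ u ^ (τ - 1) := Real.one_le_rpow hu3 (by linarith)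
  have := hb (t u) hu1.le hu2.le (u ^ (τ - 1)) hn1
  have e2 : (u ^ (τ - 1)) ^ (2 * alpha τ) = u ^ 2 := by
    rw [mul_comm, Real.rpow_mul (Real.rpow_nonneg hu.le _), rpow_rpow_alpha (by linarith) hu.le,
      Real.rpow_two]
  rw [rpow_rpow_alpha (by linarith) hu.le, e2] at this
  simp only [← jump_eq (by linarith : 1 < τ) hu] at this
  refine le_of_eq_of_le ?_ this
  rw [Real.norm_eq_abs]
  congr 1
  rw [mul_add, mul_left_comm, rpow_mul_perturbation β hu, logMgf]
  ring

/-- The tilt t(u) minimises `logMgf`, and ψ(ε) minimises its approximation n(Λ + ϑε). Evaluating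
each function at the minimiser of the other bounds the difference from both sides, so no rate for
t(u) - ψ(ε) is needed. -/
theorem tendsto_logMgf_sub_perturbedMin (hτ : 3 < τ) (hτ' : τ < 4) (β : ℝ) {θ : ℝ} (hθ : 0 < θ)
    (h0 : dcgfInt (alpha τ) θ = 0) {t : ℝ → ℝ} (ht : Tendsto t atTop (𝓝 θ))
    (htz : ∀ᶠ u in atTop, tiltMean τ β u (t u) = 0) :
    Tendsto (fun u => logMgf τ β u (t u) - u ^ (τ - 1) * perturbedMin τ (perturbation τ β u))
      atTop (𝓝 0) := by
  obtain ⟨h1, h2⟩ := alpha_bounds hτ hτ'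
  obtain ⟨ψ, hψ, hψ0, hψe⟩ := exists_critical_curve h1 h2 hθ h0
  have hp := tendsto_perturbation hτ β
  have hψt : Tendsto (fun u => ψ (perturbation τ β u)) atTop (𝓝 θ) := by
    have := hψ.continuousAt.tendsto.comp hp
    rwa [hψ0] at this
  have hup := tendsto_logMgf_sub hτ hτ' β hθ hψt
  have hlow := tendsto_logMgf_sub hτ hτ' β hθ ht
  have hmin : ∀ᶠ u in atTop, perturbedMin τ (perturbation τ β u)
      = cgfInt (alpha τ) (ψ (perturbation τ β u)) + ψ (perturbation τ β u) * perturbation τ β u ∧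
      ∀ s, perturbedMin τ (perturbation τ β u) ≤ cgfInt (alpha τ) s + s * perturbation τ β u := by
    filter_upwards [hp.eventually hψe] with u hu
    have e := iInf_cgfInt_eq h1 h2 hu
    rw [perturbedMin_eq, e]
    refine ⟨rfl, fun s => ?_⟩
    rcases eq_or_ne s (ψ (perturbation τ β u)) with rfl | hne
    · exact le_rfl
    · exact (cgfInt_lt h1 h2 hu hne).le
  refine tendsto_of_tendsto_of_tendsto_of_le_of_le' hlow hup ?_ ?_
  · filter_upwards [hmin, eventually_gt_atTop 0] with u hu hu0
    have hn : 0 < u ^ (τ - 1) := Real.rpow_pos_of_pos hu0 _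
    have := mul_le_mul_of_nonneg_left (hu.2 (t u)) hn.le
    linarith
  · filter_upwards [hmin, htz, eventually_gt_atTop 0] with u hu hu1 hu0
    rw [hu.1]
    have := logMgf_le_of_tiltMean_eq_zero hτ hτ' hu0 hu1 (ψ (perturbation τ β u))
    linarith

/-- Near 0 the infimum is attained on the smooth critical curve ψ, where it equals Λ(ψ(e)) + ψ(e) e.
-/
theorem contDiffAt_perturbedMin (hτ : 3 < τ) (hτ' : τ < 4) :
    ContDiffAt ℝ ((⊤ : ℕ∞) : WithTop ℕ∞) (perturbedMin τ) 0 := by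
  obtain ⟨h1, h2⟩ := alpha_bounds hτ hτ'
  obtain ⟨θ, hθ, h0⟩ := exists_pos_dcgfInt_eq_zero h1 h2
  obtain ⟨ψ, hψ, hψ0, hψe⟩ := exists_critical_curve h1 h2 hθ h0
  have hc : ContDiffAt ℝ ((⊤ : ℕ∞) : WithTop ℕ∞) (cgfInt (alpha τ)) (ψ 0) := by
    rw [hψ0]; exact contDiffAt_cgfInt h1 h2 hθ
  refine ((hc.comp 0 hψ).add (hψ.mul contDiffAt_id)).congr_of_eventuallyEq ?_
  filter_upwards [hψe] with e he
  rw [perturbedMin_eq, iInf_cgfInt_eq h1 h2 he]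
  rfl

theorem perturbedMin_zero (hτ : 3 < τ) (hτ' : τ < 4) {θ : ℝ} (h0 : dcgfInt (alpha τ) θ = 0) :
    perturbedMin τ 0 = Lam τ θ := by
  obtain ⟨h1, h2⟩ := alpha_bounds hτ hτ'
  rw [perturbedMin_eq, iInf_cgfInt_eq h1 h2 (ϑ := θ) (by simpa using h0), Lam_eq_cgfInt]
  simp

/-- Taylor expansion of h to order K with K (τ - 3) ≥ τ - 1: since the perturbation is
O(u^{-(τ-3)}), the remainder times n is o(1). The binomial theorem then produces the terms κ_ij;
those with a negative power of u vanish in the limit, and (0, 0) contributes nΛ(θ). -/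
theorem tendsto_rpow_mul_perturbedMin_sub (hτ : 3 < τ) (hτ' : τ < 4) (β : ℝ) {θ : ℝ}
    (h0 : dcgfInt (alpha τ) θ = 0) :
    Tendsto (fun u => u ^ (τ - 1) * perturbedMin τ (perturbation τ β u)
      - exponent τ β (-Lam τ θ) u) atTop (𝓝 0) := by
  set K := ⌊(τ - 1) / (τ - 3)⌋₊ + 1 with hK
  have h3 : 0 < τ - 3 := by linarith
  have hKτ : τ - 1 ≤ K * (τ - 3) := by
    have := Nat.lt_floor_add_one ((τ - 1) / (τ - 3))
    rw [div_lt_iff₀ h3] at this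
    rw [hK]; push_cast; linarith
  have hp := tendsto_perturbation hτ β
  set T : ℝ → ℕ × ℕ → ℝ := fun u p =>
    u ^ (τ - 1) * (kappa τ β p.1 p.2 * u ^ (-(p.1 * (τ - 2)) - p.2 * (τ - 3))) with hT
  set U : Finset (ℕ × ℕ) := (Finset.range (K + 1)).biUnion Finset.HasAntidiagonal.antidiagonal with hU
  have hmemU : ∀ p, p ∈ U ↔ p.1 + p.2 ≤ K := by
    intro p
    rw [hU, Finset.mem_biUnion]
    simp only [Finset.mem_range, Finset.HasAntidiagonal.mem_antidiagonal]
    exact ⟨fun ⟨k, hk, hk2⟩ => by omega, fun h => ⟨p.1 + p.2, by omega, rfl⟩⟩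
  have hsub : correctionPairs τ ⊆ U := by
    intro p hp
    rw [hmemU]
    obtain ⟨-, h⟩ := (mem_correctionPairs hτ p).1 hp
    have ha : (0 : ℝ) ≤ p.1 := Nat.cast_nonneg _
    have : ((p.1 + p.2 : ℕ) : ℝ) ≤ (τ - 1) / (τ - 3) := by
      rw [le_div_iff₀ h3]; push_cast; nlinarith
    exact (Nat.le_floor this).trans (by omega)
  have h00 : ((0, 0) : ℕ × ℕ) ∈ U \ correctionPairs τ := by
    rw [Finset.mem_sdiff, hmemU, mem_correctionPairs hτ]
    simp
  have hrem : Tendsto (fun u => u ^ (τ - 1) * (perturbedMin τ (perturbation τ β u)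
      - ∑ k ∈ Finset.range (K + 1), iteratedDeriv k (perturbedMin τ) 0 / (k.factorial : ℝ)
        * perturbation τ β u ^ k)) atTop (𝓝 0) := by
    have hT' := (isLittleO_taylor (contDiffAt_perturbedMin hτ hτ') K).comp_tendsto hp
    have hO : (fun u => perturbation τ β u) =O[atTop] fun u : ℝ => u ^ (-(τ - 3)) := by
      refine Asymptotics.IsBigO.add ?_ (Asymptotics.isBigO_const_mul_self _ _ _)
      refine (Asymptotics.isBigO_const_mul_self _ _ _).trans ?_
      refine Asymptotics.IsBigO.of_bound 1 ?_
      filter_upwards [eventually_ge_atTop 1] with u hu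
      rw [Real.norm_of_nonneg (by positivity), Real.norm_of_nonneg (by positivity), one_mul]
      exact Real.rpow_le_rpow_of_exponent_le hu (by linarith)
    have h4 := (Asymptotics.isBigO_refl (fun u : ℝ => u ^ (τ - 1)) atTop).mul_isLittleO
      (hT'.trans_isBigO (hO.pow K))
    have h5 : (fun u : ℝ => u ^ (τ - 1) * (u ^ (-(τ - 3))) ^ K) =O[atTop] fun _ => (1 : ℝ) := by
      refine Asymptotics.IsBigO.of_bound 1 ?_
      filter_upwards [eventually_ge_atTop 1] with u hu
      have hu0 : 0 < u := by linarith
      rw [← Real.rpow_natCast, ← Real.rpow_mul hu0.le, ← Real.rpow_add hu0,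
        Real.norm_of_nonneg (by positivity), norm_one, one_mul]
      exact Real.rpow_le_one_of_one_le_of_nonpos hu (by linarith)
    exact (Asymptotics.isLittleO_one_iff ℝ).1 (h4.trans_isBigO h5)
  have hsmall : Tendsto (fun u => ∑ p ∈ (U \ correctionPairs τ).erase (0, 0), T u p) atTop
      (𝓝 0) := by
    have hz := Finset.sum_const_zero (ι := ℕ × ℕ) (M := ℝ)
      (s := (U \ correctionPairs τ).erase (0, 0))
    rw [← hz]
    refine tendsto_finsetSum _ fun p hp => ?_
    rw [Finset.mem_erase, Finset.mem_sdiff, mem_correctionPairs hτ] at hp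
    obtain ⟨hp0, -, hp2⟩ := hp
    have hpos : 1 ≤ p.1 + p.2 := by
      by_contra hcon
      exact hp0 (Prod.ext (by simp; omega) (by simp; omega))
    have hneg : τ - 1 - p.1 * (τ - 2) - p.2 * (τ - 3) < 0 := by
      by_contra hcon
      exact hp2 ⟨hpos, not_lt.1 hcon⟩
    have h4 := (tendsto_rpow_neg_atTop (y := -(τ - 1 - p.1 * (τ - 2) - p.2 * (τ - 3)))
      (by linarith)).const_mul (kappa τ β p.1 p.2)
    rw [mul_zero] at h4
    refine h4.congr' ?_
    filter_upwards [eventually_gt_atTop 0] with u hu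
    rw [hT]
    simp only
    rw [mul_left_comm, ← Real.rpow_add hu]
    congr 2
    ring
  have hsum := hrem.add hsmall
  rw [add_zero] at hsum
  refine hsum.congr' ?_
  filter_upwards [eventually_gt_atTop 0] with u hu
  have hpoly : u ^ (τ - 1) * ∑ k ∈ Finset.range (K + 1),
      iteratedDeriv k (perturbedMin τ) 0 / (k.factorial : ℝ) * perturbation τ β u ^ k
      = ∑ p ∈ U, T u p := by
    rw [hU, Finset.sum_biUnion, Finset.mul_sum]
    · refine Finset.sum_congr rfl fun k _ => ?_
      rw [perturbation, (Commute.all _ _).add_pow', Finset.mul_sum, Finset.mul_sum]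
      refine Finset.sum_congr rfl fun p hp => ?_
      rw [Finset.HasAntidiagonal.mem_antidiagonal] at hp
      simp only [hT, kappa]
      have e : u ^ (-(p.1 * (τ - 2)) - p.2 * (τ - 3))
          = (u ^ (-(τ - 2))) ^ p.1 * (u ^ (-(τ - 3))) ^ p.2 := by
        rw [← Real.rpow_natCast, ← Real.rpow_natCast, ← Real.rpow_mul hu.le,
          ← Real.rpow_mul hu.le, ← Real.rpow_add hu]
        congr 1; ring
      rw [e, hp, nsmul_eq_mul, mul_pow, mul_pow]
      ring
    · intro k _ l _ hkl
      rw [Function.onFun, Finset.disjoint_left]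
      intro p hp hp'
      rw [Finset.HasAntidiagonal.mem_antidiagonal] at hp hp'
      omega
  have hsplit : ∑ p ∈ U, T u p = T u (0, 0) + ∑ p ∈ (U \ correctionPairs τ).erase (0, 0), T u p
      + ∑ p ∈ correctionPairs τ, T u p := by
    rw [Finset.add_sum_erase _ _ h00, Finset.sum_sdiff hsub]
  have hT00 : T u (0, 0) = u ^ (τ - 1) * Lam τ θ := by
    rw [hT]
    simp [kappa, perturbedMin_zero hτ hτ' h0]
  rw [mul_sub, hpoly, hsplit, hT00, exponent, Finset.mul_sum]
  simp only [hT]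
  ring

end

/-! ### Characteristic functions of centred Bernoulli variables -/

open Complex in
theorem norm_cexp_I_sub_le (x : ℝ) :
    ‖cexp (I * x) - 1 - I * x‖ ≤ |x| ^ 2 ∧
      ‖cexp (I * x) - 1 - I * x + x ^ 2 / 2‖ ≤ |x| ^ 3 := by
  have hd : ∀ y : ℝ, HasDerivAt (fun y : ℝ => cexp (I * y)) (cexp (I * y) * (I * 1)) y := fun y => by
    have h := ((hasDerivAt_id (y : ℂ)).const_mul I).cexp.comp_ofReal
    simpa using h
  have hI : ∀ y : ℝ, HasDerivAt (fun y : ℝ => I * (y : ℂ)) (I * 1) y := fun y =>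
    ((hasDerivAt_id (y : ℂ)).const_mul I).comp_ofReal
  have hsq : ∀ y : ℝ, HasDerivAt (fun y : ℝ => (y : ℂ) ^ 2 / 2) (y : ℂ) y := fun y => by
    have h := (((hasDerivAt_id (y : ℂ)).pow 2).div_const 2).comp_ofReal
    simpa using h
  have hmem : ∀ y ∈ Set.uIcc 0 x, |y| ≤ |x| := fun y hy => by
    have := Set.abs_sub_left_of_mem_uIcc hy
    simpa using this
  have key2 : ∀ z : ℝ, ‖cexp (I * z) - 1 - I * z‖ ≤ |z| ^ 2 := fun z => by
    have hmem : ∀ y ∈ Set.uIcc 0 z, |y| ≤ |z| := fun y hy => by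
      have := Set.abs_sub_left_of_mem_uIcc hy
      simpa using this
    have := Convex.norm_image_sub_le_of_norm_hasDerivWithin_le (s := Set.uIcc 0 z)
      (f := fun y : ℝ => cexp (I * y) - 1 - I * y)
      (f' := fun y : ℝ => cexp (I * y) * (I * 1) - I * 1) (C := |z|) (x := 0) (y := z)
      (fun y _ => (((hd y).sub_const 1).sub (hI y)).hasDerivWithinAt)
      (fun y hy => by
        rw [← sub_one_mul, norm_mul, mul_one, norm_I, mul_one]
        exact (Real.norm_exp_I_mul_ofReal_sub_one_le (x := y)).trans (hmem y hy))
      (convex_uIcc _ _) Set.left_mem_uIcc Set.right_mem_uIcc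
    simpa [pow_two] using this
  refine ⟨key2 x, ?_⟩
  have := Convex.norm_image_sub_le_of_norm_hasDerivWithin_le (s := Set.uIcc 0 x)
    (f := fun y : ℝ => cexp (I * y) - 1 - I * y + y ^ 2 / 2)
    (f' := fun y : ℝ => cexp (I * y) * (I * 1) - I * 1 + y) (C := |x| ^ 2) (x := 0) (y := x)
    (fun y _ => ((((hd y).sub_const 1).sub (hI y)).add (hsq y)).hasDerivWithinAt)
    (fun y hy => by
      have e : cexp (I * y) * (I * 1) - I * 1 + y = I * (cexp (I * y) - 1 - I * y) := by
        linear_combination (y : ℂ) * I_sq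
      rw [e, norm_mul, norm_I, one_mul]
      exact (key2 y).trans (pow_le_pow_left₀ (abs_nonneg _) (hmem y hy) 2))
    (convex_uIcc _ _) Set.left_mem_uIcc Set.right_mem_uIcc
  simpa [pow_succ] using this

/-- The characteristic function at `w` of a centred Bernoulli variable with parameter `r`. -/
noncomputable def bernChar (r w : ℝ) : ℂ :=
  (1 - r) * Complex.exp (Complex.I * ((-(r * w) : ℝ) : ℂ))
    + r * Complex.exp (Complex.I * (((1 - r) * w : ℝ) : ℂ))

/-- Centring cancels the linear terms, and the quadratic remainders add up to r(1 - r) w². The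
factor r(1 - r), rather than a constant, is what makes the errors summable over the jumps. -/
theorem norm_bernChar_sub_one_le {r : ℝ} (hr : 0 ≤ r) (hr1 : r ≤ 1) (w : ℝ) :
    ‖bernChar r w - 1‖ ≤ r * (1 - r) * w ^ 2 := by
  have h1 := (norm_cexp_I_sub_le (-(r * w))).1
  have h2 := (norm_cexp_I_sub_le ((1 - r) * w)).1
  have hr' : 0 ≤ 1 - r := by linarith
  set A := Complex.exp (Complex.I * ((-(r * w) : ℝ) : ℂ)) - 1 - Complex.I * ((-(r * w) : ℝ) : ℂ)
  set B := Complex.exp (Complex.I * (((1 - r) * w : ℝ) : ℂ)) - 1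
    - Complex.I * (((1 - r) * w : ℝ) : ℂ)
  have e : bernChar r w - 1 = ((1 - r : ℝ) : ℂ) * A + (r : ℂ) * B := by
    simp only [bernChar, A, B]
    push_cast
    ring
  rw [e]
  refine (norm_add_le _ _).trans ?_
  rw [norm_mul, norm_mul, Complex.norm_real, Complex.norm_real, Real.norm_of_nonneg hr,
    Real.norm_of_nonneg hr']
  rw [sq_abs] at h1 h2
  have h3 := mul_le_mul_of_nonneg_left h1 hr'
  have h4 := mul_le_mul_of_nonneg_left h2 hr
  nlinarith

theorem norm_bernChar_sub_quadratic_le {r : ℝ} (hr : 0 ≤ r) (hr1 : r ≤ 1) (w : ℝ) :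
    ‖bernChar r w - (1 - ((r * (1 - r) * w ^ 2 / 2 : ℝ) : ℂ))‖ ≤ r * (1 - r) * |w| ^ 3 := by
  have h1 := (norm_cexp_I_sub_le (-(r * w))).2
  have h2 := (norm_cexp_I_sub_le ((1 - r) * w)).2
  have hr' : 0 ≤ 1 - r := by linarith
  set A := Complex.exp (Complex.I * ((-(r * w) : ℝ) : ℂ)) - 1 - Complex.I * ((-(r * w) : ℝ) : ℂ)
    + ((-(r * w) : ℝ) : ℂ) ^ 2 / 2
  set B := Complex.exp (Complex.I * (((1 - r) * w : ℝ) : ℂ)) - 1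
    - Complex.I * (((1 - r) * w : ℝ) : ℂ) + (((1 - r) * w : ℝ) : ℂ) ^ 2 / 2
  have e : bernChar r w - (1 - ((r * (1 - r) * w ^ 2 / 2 : ℝ) : ℂ))
      = ((1 - r : ℝ) : ℂ) * A + (r : ℂ) * B := by
    simp only [bernChar, A, B]
    push_cast
    ring
  rw [e]
  refine (norm_add_le _ _).trans ?_
  rw [norm_mul, norm_mul, Complex.norm_real, Complex.norm_real, Real.norm_of_nonneg hr,
    Real.norm_of_nonneg hr']
  rw [abs_neg, abs_mul, abs_of_nonneg hr, mul_pow] at h1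
  rw [abs_mul, abs_of_nonneg hr', mul_pow] at h2
  have h3 := mul_le_mul_of_nonneg_left h1 hr'
  have h4 := mul_le_mul_of_nonneg_left h2 hr
  have h5 : 0 ≤ r * (1 - r) * |w| ^ 3 := by positivity
  have h6 : r ^ 2 + (1 - r) ^ 2 ≤ 1 := by nlinarith
  have h7 := mul_le_mul_of_nonneg_left h6 h5
  nlinarith

theorem norm_bernChar_le_one {r : ℝ} (hr : 0 ≤ r) (hr1 : r ≤ 1) (w : ℝ) :
    ‖bernChar r w‖ ≤ 1 := by
  have hr' : 0 ≤ 1 - r := by linarith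
  have e : ((1 : ℂ) - r) = ((1 - r : ℝ) : ℂ) := by push_cast; rfl
  rw [bernChar, e]
  refine (norm_add_le _ _).trans ?_
  rw [norm_mul, norm_mul, mul_comm Complex.I, mul_comm Complex.I, Complex.norm_exp_ofReal_mul_I,
    Complex.norm_exp_ofReal_mul_I, Complex.norm_real, Complex.norm_real,
    Real.norm_of_nonneg hr, Real.norm_of_nonneg hr']
  linarith

theorem norm_bernChar_sq (r w : ℝ) :
    ‖bernChar r w‖ ^ 2 = 1 - 2 * (r * (1 - r)) * (1 - Real.cos w) := by
  have e : bernChar r w = Complex.exp (((-(r * w) : ℝ) : ℂ) * Complex.I)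
      * (((1 - r : ℝ) : ℂ) + r * Complex.exp ((w : ℂ) * Complex.I)) := by
    rw [bernChar, mul_add, mul_left_comm _ (r : ℂ), ← Complex.exp_add]
    push_cast
    ring_nf
  rw [e, norm_mul, Complex.norm_exp_ofReal_mul_I, one_mul, ← Complex.normSq_eq_norm_sq,
    Complex.normSq_apply]
  simp only [Complex.add_re, Complex.add_im, Complex.ofReal_re, Complex.ofReal_im,
    Complex.re_ofReal_mul, Complex.im_ofReal_mul, Complex.exp_ofReal_mul_I_re,
    Complex.exp_ofReal_mul_I_im]
  have := Real.sin_sq_add_cos_sq w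
  linear_combination r ^ 2 * this

/-- The squared modulus is 1 - 2r(1 - r)(1 - cos w), with 1 - cos w ≥ 2w²/π² ≥ w²/5 on the given
range. -/
theorem norm_bernChar_le_exp {r w : ℝ} (hr : 0 ≤ r) (hr1 : r ≤ 1) (hw : |w| ≤ 1) :
    ‖bernChar r w‖ ≤ Real.exp (-(1 / 5 * (r * (1 - r) * w ^ 2))) := by
  have hr' : 0 ≤ r * (1 - r) := mul_nonneg hr (by linarith)
  have hcos := Real.cos_le_one_sub_mul_cos_sq (x := w) (by linarith [Real.pi_gt_three])
  have hpi : (1 : ℝ) / 5 ≤ 2 / Real.pi ^ 2 := by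
    rw [div_le_div_iff₀ (by norm_num) (by positivity)]
    nlinarith [Real.pi_lt_d2, Real.pi_pos]
  have h1 : 1 / 5 * w ^ 2 ≤ 1 - Real.cos w := by
    have := mul_le_mul_of_nonneg_right hpi (sq_nonneg w)
    linarith
  have h2 : ‖bernChar r w‖ ^ 2 ≤ Real.exp (-(1 / 5 * (r * (1 - r) * w ^ 2))) ^ 2 := by
    rw [norm_bernChar_sq, ← Real.exp_nat_mul]
    have h3 := mul_le_mul_of_nonneg_left h1 hr'
    have h4 := Real.add_one_le_exp (((2 : ℕ) : ℝ) * -(1 / 5 * (r * (1 - r) * w ^ 2)))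
    push_cast at h4 ⊢
    linarith
  exact le_of_sq_le_sq h2 (Real.exp_pos _).le

theorem abs_exp_neg_sub_le {x : ℝ} (hx : 0 ≤ x) : |Real.exp (-x) - (1 - x)| ≤ x ^ 2 := by
  rcases le_total x 1 with h | h
  · have := Real.abs_exp_sub_one_sub_id_le (x := -x) (by rwa [abs_neg, abs_of_nonneg hx])
    rw [neg_sq] at this
    convert this using 2
    ring
  · have h1 := Real.exp_pos (-x)
    have h2 : Real.exp (-x) ≤ 1 := Real.exp_le_one_iff.2 (by linarith)
    rw [abs_le]
    constructor <;> nlinarith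

theorem norm_bernChar_sub_exp_le {r : ℝ} (hr : 0 ≤ r) (hr1 : r ≤ 1) (w : ℝ) :
    ‖bernChar r w - ((Real.exp (-(r * (1 - r) * w ^ 2 / 2)) : ℝ) : ℂ)‖
      ≤ r * (1 - r) * |w| ^ 3 + (r * (1 - r) * w ^ 2) ^ 2 := by
  have hr' : 0 ≤ r * (1 - r) := mul_nonneg hr (by linarith)
  have h1 := norm_bernChar_sub_quadratic_le hr hr1 w
  have h2 := abs_exp_neg_sub_le (x := r * (1 - r) * w ^ 2 / 2) (by positivity)
  set x := r * (1 - r) * w ^ 2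
  have e : bernChar r w - ((Real.exp (-(x / 2)) : ℝ) : ℂ)
      = (bernChar r w - (1 - ((x / 2 : ℝ) : ℂ))) - ((Real.exp (-(x / 2)) - (1 - x / 2) : ℝ) : ℂ) := by
    push_cast
    ring
  rw [e]
  refine (norm_sub_le _ _).trans (add_le_add h1 ?_)
  rw [Complex.norm_real]
  refine h2.trans ?_
  nlinarith [sq_nonneg x]

theorem norm_prod_sub_prod_le_sum {a b : ℕ → ℂ} (ha : ∀ i, ‖a i‖ ≤ 1) (hb : ∀ i, ‖b i‖ ≤ 1)
    (N : ℕ) :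
    ‖∏ i ∈ Finset.range N, a i - ∏ i ∈ Finset.range N, b i‖
      ≤ ∑ i ∈ Finset.range N, ‖a i - b i‖ := by
  induction N with
  | zero => simp
  | succ N ih =>
    rw [Finset.prod_range_succ, Finset.prod_range_succ, Finset.sum_range_succ]
    have e : (∏ i ∈ Finset.range N, a i) * a N - (∏ i ∈ Finset.range N, b i) * b N
        = (∏ i ∈ Finset.range N, a i - ∏ i ∈ Finset.range N, b i) * a N
          + (∏ i ∈ Finset.range N, b i) * (a N - b N) := by ring
    rw [e]
    refine (norm_add_le _ _).trans (add_le_add ?_ ?_)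
    · rw [norm_mul]
      exact (mul_le_of_le_one_right (norm_nonneg _) (ha N)).trans ih
    · rw [norm_mul]
      refine mul_le_of_le_one_left (norm_nonneg _) ?_
      rw [norm_prod]
      exact Finset.prod_le_one (fun i _ => norm_nonneg _) fun i _ => hb i

theorem one_sub_tiltRatio_le {ϑ Θ y : ℝ} (hϑ : 0 ≤ ϑ) (hΘ : ϑ ≤ Θ) (hy : 0 ≤ y) :
    1 - tiltRatio ϑ y ≤ 2 * Real.exp Θ * Real.exp (-y) := by
  have hw := weight_pos (ϑ := ϑ) hy
  have hl := weight_lower_bound hϑ hΘ hy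
  rw [one_sub_tiltRatio hy, div_le_iff₀ hw]
  have h1 := exp_neg_one_add_mul_le hϑ hy
  have h2 : Real.exp Θ * Real.exp (-Θ) = 1 := by rw [← Real.exp_add]; simp
  calc Real.exp (-(1 + ϑ) * y) ≤ Real.exp (-y) := h1
    _ = 2 * Real.exp Θ * Real.exp (-y) * (Real.exp (-Θ) / 2) := by
        linear_combination -Real.exp (-y) * h2
    _ ≤ _ := by gcongr

/-- These control the cubic and quartic errors in the central limit theorem. For y ≤ 1 the extra
factors are at most 1; for y ≥ 1 they are absorbed by 1 - r = O(e^{-y}), which relies on ϑ ≥ 0. -/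
theorem exists_mul_tiltVar_le {Θ : ℝ} (hΘ : 0 ≤ Θ) : ∃ C, 0 ≤ C ∧ ∀ ϑ, 0 ≤ ϑ → ϑ ≤ Θ →
    ∀ y, 0 ≤ y → tiltVar ϑ y ≤ C * env y ∧ y * tiltVar ϑ y ≤ C * env y ∧
      tiltVar ϑ y ^ 2 ≤ C * env y := by
  set A := 3 + Θ * Real.exp (2 * Θ) with hA
  have hA0 : 0 ≤ A := by positivity
  set B := 2 * Real.exp Θ with hB
  have hB0 : 0 ≤ B := by positivity
  refine ⟨A + B + B ^ 2, by positivity, fun ϑ hϑ hϑΘ y hy => ?_⟩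
  have he := env_nonneg hy
  have h1 : tiltVar ϑ y ≤ A * env y := tiltVar_le hy (by rwa [abs_of_nonneg hϑ])
  have h0 := tiltVar_nonneg (ϑ := ϑ) hy
  have hr0 := tiltRatio_nonneg (ϑ := ϑ) hy
  have hr1 := tiltRatio_lt_one (ϑ := ϑ) hy
  have hAe : A * env y ≤ (A + B + B ^ 2) * env y := by gcongr; nlinarith [sq_nonneg B]
  have hBe : B * env y ≤ (A + B + B ^ 2) * env y := by gcongr; nlinarith [sq_nonneg B]
  have hB2e : B ^ 2 * env y ≤ (A + B + B ^ 2) * env y := by gcongr; nlinarith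
  refine ⟨h1.trans hAe, ?_⟩
  have hrr : tiltRatio ϑ y * (1 - tiltRatio ϑ y) ≤ 1 := by nlinarith
  rcases le_total y 1 with hy1 | hy1
  · have h2 : tiltVar ϑ y ≤ 1 := by
      unfold tiltVar
      have : y ^ 2 ≤ 1 := pow_le_one₀ hy hy1
      have h3 : 0 ≤ tiltRatio ϑ y * (1 - tiltRatio ϑ y) := mul_nonneg hr0 (by linarith)
      nlinarith
    exact ⟨by nlinarith, by nlinarith⟩
  · have h2 := one_sub_tiltRatio_le hϑ hϑΘ hy
    have h3 : y * Real.exp (-y) ≤ 1 := by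
      have h4 := Real.add_one_le_exp y
      have h5 : Real.exp y * Real.exp (-y) = 1 := by rw [← Real.exp_add]; simp
      nlinarith [Real.exp_pos (-y)]
    have h4 : y * (tiltRatio ϑ y * (1 - tiltRatio ϑ y)) ≤ B := by
      have h5 : tiltRatio ϑ y * (1 - tiltRatio ϑ y) ≤ B * Real.exp (-y) := by nlinarith
      calc y * (tiltRatio ϑ y * (1 - tiltRatio ϑ y)) ≤ y * (B * Real.exp (-y)) := by gcongr
        _ = B * (y * Real.exp (-y)) := by ring
        _ ≤ B * 1 := by gcongr
        _ = B := mul_one B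
    have h6 : 0 ≤ y * (tiltRatio ϑ y * (1 - tiltRatio ϑ y)) :=
      mul_nonneg hy (mul_nonneg hr0 (by linarith))
    rw [env_of_one_le hy1] at *
    have e1 : y * tiltVar ϑ y = y ^ 2 * (y * (tiltRatio ϑ y * (1 - tiltRatio ϑ y))) := by
      unfold tiltVar; ring
    have e2 : tiltVar ϑ y ^ 2 = y ^ 2 * (y * (tiltRatio ϑ y * (1 - tiltRatio ϑ y))) ^ 2 := by
      unfold tiltVar; ring
    constructor
    · rw [e1]
      refine le_trans ?_ hBe
      rw [mul_comm]
      gcongr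
    · rw [e2]
      refine le_trans ?_ hB2e
      rw [mul_comm]
      gcongr

/-! ### The tilted characteristic function: decay and Gaussian limit -/

section

variable {τ : ℝ}

/-- The characteristic function of `u S_u`, tilted by `ϑ` and centred. -/
noncomputable def tiltChar (τ u ϑ s : ℝ) : ℂ :=
  ∏' i, bernChar (tiltRatio ϑ (jump τ u i)) (s * jump τ u i)

theorem tendsto_prod_bernChar (hτ : 3 < τ) (hτ' : τ < 4) {u : ℝ} (hu : 0 < u) (ϑ s : ℝ) :
    Tendsto (fun N => ∏ i ∈ Finset.range N, bernChar (tiltRatio ϑ (jump τ u i)) (s * jump τ u i))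
      atTop (𝓝 (tiltChar τ u ϑ s)) := by
  have h : Summable fun i => ‖bernChar (tiltRatio ϑ (jump τ u i)) (s * jump τ u i) - 1‖ := by
    refine Summable.of_nonneg_of_le (fun i => norm_nonneg _) (fun i => ?_)
      ((summable_tiltVar_jump hτ hτ' hu ϑ).mul_left (s ^ 2))
    have hy := (jump_pos (τ := τ) hu i).le
    refine (norm_bernChar_sub_one_le (tiltRatio_nonneg hy) (tiltRatio_lt_one hy).le _).trans_eq ?_
    unfold tiltVar
    ring
  have h2 := multipliable_one_add_of_summable h
  simp only [add_sub_cancel] at h2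
  exact h2.hasProd.tendsto_prod_nat

theorem mul_one_sub_tiltRatio_ge {ϑ Θ y : ℝ} (hϑ : 0 ≤ ϑ) (hΘ : ϑ ≤ Θ) (hy : 0 ≤ y)
    (hy1 : y ≤ 1) :
    y / 2 * Real.exp (-(1 + Θ)) ≤ tiltRatio ϑ y * (1 - tiltRatio ϑ y) := by
  have hw := weight_pos (ϑ := ϑ) hy
  have hw1 : weight ϑ y ≤ 1 := by
    have := exp_neg_one_add_mul_le hϑ hy
    unfold weight; linarith
  have h1 : Real.exp (-(1 + Θ)) ≤ 1 - tiltRatio ϑ y := by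
    rw [one_sub_tiltRatio hy, le_div_iff₀ hw]
    have h2 : Real.exp (-(1 + Θ)) ≤ Real.exp (-(1 + ϑ) * y) := Real.exp_le_exp.2 (by nlinarith)
    nlinarith [Real.exp_pos (-(1 + Θ))]
  have h2 : y / 2 ≤ tiltRatio ϑ y := by
    rw [tiltRatio_eq, le_div_iff₀ hw]
    have h3 := Real.abs_exp_sub_one_sub_id_le (x := -y) (by rwa [abs_neg, abs_of_nonneg hy])
    have h5 : Real.exp (-y) * (1 + y) ≤ 1 := by
      have h6 := Real.add_one_le_exp y
      have h7 : Real.exp y * Real.exp (-y) = 1 := by rw [← Real.exp_add]; simp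
      nlinarith [Real.exp_pos (-y)]
    nlinarith
  exact mul_le_mul h2 h1 (Real.exp_pos _).le (tiltRatio_nonneg hy)

/-- Only one block of factors is used. With M = max(1, |s|) and m = ⌈n M^{τ-1}⌉, the indices m ≤ i +
2 < 2m have jumps between 1/(4M) and 1/M, so |s y| ≤ 1 and each factor is at most exp(-c s² M^{-3}).
There are m ≥ n M² of them, giving exp(-c n s² / M). -/
theorem exists_norm_tiltChar_le (hτ : 3 < τ) (hτ' : τ < 4) {Θ : ℝ} :
    ∃ c > 0, ∀ ϑ, 0 ≤ ϑ → ϑ ≤ Θ → ∀ u, 1 < u → ∀ s,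
      ‖tiltChar τ u ϑ s‖ ≤ Real.exp (-(c * (u ^ (τ - 1) * (s ^ 2 / max 1 |s|)))) := by
  obtain ⟨hα1, hα2⟩ := alpha_bounds hτ hτ'
  set α := alpha τ with hα
  refine ⟨Real.exp (-(1 + Θ)) / 10 / 64, by positivity, ?_⟩
  intro ϑ hϑ hϑΘ u hu s
  have hu0 : 0 < u := by linarith
  set n := u ^ (τ - 1) with hn
  have hn1 : 1 < n := Real.one_lt_rpow hu (by linarith)
  have hn0 : 0 < n := by linarith
  set M := max 1 |s| with hM
  have hM1 : 1 ≤ M := le_max_left _ _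
  have hM0 : 0 < M := by linarith
  have hsM : |s| ≤ M := le_max_right _ _
  have hMτ : M ^ 2 ≤ M ^ (τ - 1) := by
    rw [← Real.rpow_natCast]
    exact Real.rpow_le_rpow_of_exponent_le hM1 (by push_cast; linarith)
  have hMτ1 : 1 ≤ M ^ (τ - 1) := Real.one_le_rpow hM1 (by linarith)
  set m := ⌈n * M ^ (τ - 1)⌉₊ with hm
  have hm1 : n * M ^ (τ - 1) ≤ m := Nat.le_ceil _
  have hm2 : (m : ℝ) < n * M ^ (τ - 1) + 1 := Nat.ceil_lt_add_one (by positivity)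
  have hnM : 1 < n * M ^ (τ - 1) := by nlinarith
  have hm3 : 2 ≤ m := by
    have : (1 : ℝ) < m := by linarith
    exact_mod_cast this
  set b : ℕ → ℂ := fun i => bernChar (tiltRatio ϑ (jump τ u i)) (s * jump τ u i) with hb
  have hb1 : ∀ i, ‖b i‖ ≤ 1 := fun i =>
    norm_bernChar_le_one (tiltRatio_nonneg (jump_pos hu0 i).le)
      (tiltRatio_lt_one (jump_pos hu0 i).le).le _
  set δ := Real.exp (-(1 + Θ)) / 10 * (s ^ 2 / (64 * M ^ 3)) with hδ
  have hblock : ∀ i ∈ Finset.Ico (m - 2) (2 * m - 2), ‖b i‖ ≤ Real.exp (-δ) := by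
    intro i hi
    rw [Finset.mem_Ico] at hi
    have hi1 : (m : ℝ) ≤ (i : ℝ) + 2 := by exact_mod_cast (by omega : m ≤ i + 2)
    have hi2 : (i : ℝ) + 2 ≤ 2 * m := by exact_mod_cast (by omega : i + 2 ≤ 2 * m)
    have hMα : (M ^ (τ - 1)) ^ (-α) = M⁻¹ := by
      rw [Real.rpow_neg (by positivity), hα, rpow_rpow_alpha (by linarith) hM0.le]
    have hy := jump_pos (τ := τ) hu0 i
    have hyM : jump τ u i ≤ M⁻¹ := by
      rw [jump_eq (by linarith) hu0, ← hMα]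
      refine Real.rpow_le_rpow_of_nonpos (by positivity) ?_ (by linarith)
      rw [le_div_iff₀ hn0]
      linarith
    -- Here i + 2 ≤ 2m ≤ 4 n M^{τ-1}, and 4^{-α} ≥ 1/4.
    have hMy : M⁻¹ / 4 ≤ jump τ u i := by
      have h4 : M⁻¹ / 4 ≤ (4 * M ^ (τ - 1)) ^ (-α) := by
        rw [Real.mul_rpow (by norm_num) (by positivity), hMα, div_eq_mul_inv, mul_comm]
        gcongr
        rw [← Real.rpow_neg_one]
        exact Real.rpow_le_rpow_of_exponent_le (by norm_num) (by linarith)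
      refine h4.trans ?_
      rw [jump_eq (by linarith) hu0]
      refine Real.rpow_le_rpow_of_nonpos (by positivity) ?_ (by linarith)
      rw [div_le_iff₀ hn0]
      linarith
    set y := jump τ u i
    have hMi1 : M⁻¹ ≤ 1 := inv_le_one_of_one_le₀ hM1
    have hy1 : y ≤ 1 := hyM.trans hMi1
    have hsy : |s * y| ≤ 1 := by
      rw [abs_mul, abs_of_pos hy]
      calc |s| * y ≤ M * M⁻¹ := mul_le_mul hsM hyM hy.le hM0.le
        _ = 1 := mul_inv_cancel₀ hM0.ne'
    refine (norm_bernChar_le_exp (tiltRatio_nonneg hy.le) (tiltRatio_lt_one hy.le).le hsy).trans ?_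
    refine Real.exp_le_exp.2 (neg_le_neg ?_)
    have h5 := mul_one_sub_tiltRatio_ge hϑ hϑΘ hy.le hy1
    have h6 : (M⁻¹ / 4) ^ 3 ≤ y ^ 3 := by gcongr
    calc δ = Real.exp (-(1 + Θ)) / 10 * s ^ 2 * (M⁻¹ / 4) ^ 3 := by
          rw [hδ]; field_simp; norm_num
      _ ≤ Real.exp (-(1 + Θ)) / 10 * s ^ 2 * y ^ 3 := by gcongr
      _ = 1 / 5 * (y / 2 * Real.exp (-(1 + Θ)) * (s * y) ^ 2) := by ring
      _ ≤ _ := by gcongr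
  have hfin : ∀ N, 2 * m - 2 ≤ N → ‖∏ i ∈ Finset.range N, b i‖
      ≤ Real.exp (-(Real.exp (-(1 + Θ)) / 10 / 64 * (n * (s ^ 2 / M)))) := by
    intro N hN
    rw [norm_prod]
    have hsub : Finset.Ico (m - 2) (2 * m - 2) ⊆ Finset.range N := fun i hi => by
      rw [Finset.mem_Ico] at hi
      exact Finset.mem_range.2 (by omega)
    rw [← Finset.prod_sdiff hsub]
    refine (mul_le_of_le_one_left (Finset.prod_nonneg fun i _ => norm_nonneg _)
      (Finset.prod_le_one (fun i _ => norm_nonneg _) fun i _ => hb1 i)).trans ?_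
    refine (Finset.prod_le_prod (fun i _ => norm_nonneg _) hblock).trans ?_
    rw [Finset.prod_const, Nat.card_Ico, ← Real.exp_nat_mul]
    refine Real.exp_le_exp.2 ?_
    have hc : 2 * m - 2 - (m - 2) = m := by omega
    rw [hc, mul_neg]
    refine neg_le_neg ?_
    have hmM : n * M ^ 2 ≤ m := (mul_le_mul_of_nonneg_left hMτ hn0.le).trans hm1
    calc Real.exp (-(1 + Θ)) / 10 / 64 * (n * (s ^ 2 / M)) = (n * M ^ 2) * δ := by
          rw [hδ]; field_simp
      _ ≤ m * δ := by gcongr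
  refine le_of_tendsto (tendsto_prod_bernChar hτ hτ' hu0 ϑ s).norm ?_
  filter_upwards [eventually_ge_atTop (2 * m - 2)] with N hN using hfin N hN

theorem tendsto_tsum_tiltVar_div (hτ : 3 < τ) (hτ' : τ < 4) {θ : ℝ} {t : ℝ → ℝ}
    (ht : Tendsto t atTop (𝓝 θ)) :
    Tendsto (fun u => (∑' i, tiltVar (t u) (jump τ u i)) / u ^ (τ - 1)) atTop
      (𝓝 (tiltVarInt (alpha τ) θ)) := by
  refine tendsto_tsum_jump hτ hτ' (q := fun u => tiltVar (t u)) (q₀ := tiltVar θ)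
    (C := 3 + (|θ| + 1) * Real.exp (2 * (|θ| + 1))) ?_ ?_ (by positivity)
  · filter_upwards [ht.abs.eventually (gt_mem_nhds (lt_add_one |θ|))] with u hu y hy
    rw [abs_of_nonneg (tiltVar_nonneg hy)]
    exact tiltVar_le hy hu.le
  · intro y hy w hw
    have hr := tendsto_tiltRatio hy.le ht hw
    exact (hw.pow 2).mul (hr.mul (hr.const_sub 1))

theorem tendsto_tsum_env_div (hτ : 3 < τ) (hτ' : τ < 4) :
    Tendsto (fun u => (∑' i, env (jump τ u i)) / u ^ (τ - 1)) atTop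
      (𝓝 (∫ x in Set.Ioi (0 : ℝ), env (x ^ (-alpha τ)))) :=
  tendsto_tsum_jump hτ hτ' (q := fun _ => env) (q₀ := env) (C := 1)
    (Eventually.of_forall fun _ y hy => by rw [abs_of_nonneg (env_nonneg hy), one_mul])
    (fun _ _ _ hw => (continuous_env.tendsto _).comp hw) zero_le_one

/-- The central limit theorem for the tilted law, on the level of characteristic functions. -/
theorem tendsto_tiltChar (hτ : 3 < τ) (hτ' : τ < 4) {θ : ℝ} (hθ : 0 < θ) {t : ℝ → ℝ}
    (ht : Tendsto t atTop (𝓝 θ)) (x : ℝ) :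
    Tendsto (fun u => tiltChar τ u (t u) (x / u ^ ((τ - 1) / 2))) atTop
      (𝓝 ((Real.exp (-(tiltVarInt (alpha τ) θ * x ^ 2 / 2)) : ℝ) : ℂ)) := by
  obtain ⟨C, hC, hCb⟩ := exists_mul_tiltVar_le (Θ := θ + 1) (by linarith)
  have hV : Tendsto (fun u => ((Real.exp (-((∑' i, tiltVar (t u) (jump τ u i)) / u ^ (τ - 1)
      * x ^ 2 / 2)) : ℝ) : ℂ)) atTop
      (𝓝 ((Real.exp (-(tiltVarInt (alpha τ) θ * x ^ 2 / 2)) : ℝ) : ℂ)) := by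
    refine (Complex.continuous_ofReal.tendsto _).comp ((Real.continuous_exp.tendsto _).comp ?_)
    exact (((tendsto_tsum_tiltVar_div hτ hτ' ht).mul_const _).div_const _).neg
  -- The product is compared factor by factor with the Gaussians e^{-tiltVar s²/2} at s = x/√n. The
  -- total error is at most (|s|³ + s⁴) C times the sum of the envelopes, which is O(n), so it is
  -- O(n^{-1/2}).
  have herr : Tendsto (fun u : ℝ => (|x| ^ 3 * u ^ (-((τ - 1) / 2)) + x ^ 4 * u ^ (-(τ - 1)))
      * (C * ((∑' i, env (jump τ u i)) / u ^ (τ - 1)))) atTop (𝓝 0) := by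
    have h1 := ((tendsto_rpow_neg_atTop (y := (τ - 1) / 2) (by linarith)).const_mul (|x| ^ 3)).add
      ((tendsto_rpow_neg_atTop (y := τ - 1) (by linarith)).const_mul (x ^ 4))
    have h2 := h1.mul ((tendsto_tsum_env_div hτ hτ').const_mul C)
    simpa only [mul_zero, add_zero, zero_mul] using h2
  rw [tendsto_iff_norm_sub_tendsto_zero]
  have hfinal : Tendsto (fun u => tiltChar τ u (t u) (x / u ^ ((τ - 1) / 2))
      - ((Real.exp (-((∑' i, tiltVar (t u) (jump τ u i)) / u ^ (τ - 1) * x ^ 2 / 2)) : ℝ) : ℂ))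
      atTop (𝓝 0) := by
    refine squeeze_zero_norm' ?_ herr
    filter_upwards [ht.eventually (lt_mem_nhds hθ), ht.eventually (gt_mem_nhds (lt_add_one θ)),
      eventually_gt_atTop 0] with u h1 h2 hu
    set n := u ^ (τ - 1) with hn
    have hn0 : 0 < n := Real.rpow_pos_of_pos hu _
    set q := u ^ ((τ - 1) / 2) with hq
    have hq0 : 0 < q := Real.rpow_pos_of_pos hu _
    have hqn : q ^ 2 = n := by
      rw [hq, ← Real.rpow_natCast, ← Real.rpow_mul hu.le, hn]; congr 1; push_cast; ring
    set s := x / q with hs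
    have hs2 : s ^ 2 = x ^ 2 / n := by rw [hs, div_pow, hqn]
    have eq1 : u ^ (-((τ - 1) / 2)) = q⁻¹ := Real.rpow_neg hu.le _
    have eq2 : u ^ (-(τ - 1)) = n⁻¹ := Real.rpow_neg hu.le _
    have hy : ∀ i, 0 ≤ jump τ u i := fun i => (jump_pos hu i).le
    have hP := tendsto_prod_bernChar hτ hτ' hu (t u) s
    have hE : Tendsto (fun N => ∏ i ∈ Finset.range N,
        ((Real.exp (-(tiltVar (t u) (jump τ u i) * s ^ 2 / 2)) : ℝ) : ℂ)) atTop
        (𝓝 ((Real.exp (-((∑' i, tiltVar (t u) (jump τ u i)) / n * x ^ 2 / 2)) : ℝ) : ℂ)) := by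
      have h3 := (summable_tiltVar_jump hτ hτ' hu (t u)).hasSum.tendsto_sum_nat
      have h4 := (Complex.continuous_ofReal.tendsto _).comp
        ((Real.continuous_exp.tendsto _).comp ((h3.mul_const (s ^ 2 / 2)).neg))
      have e : -((∑' i, tiltVar (t u) (jump τ u i)) / n * x ^ 2 / 2)
          = -((∑' i, tiltVar (t u) (jump τ u i)) * (s ^ 2 / 2)) := by rw [hs2]; ring
      rw [e]
      refine h4.congr fun N => ?_
      simp only [Function.comp]
      rw [← Complex.ofReal_prod, ← Real.exp_sum, Finset.sum_mul, Finset.sum_neg_distrib]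
      congr 3
      exact Finset.sum_congr rfl fun i _ => by ring
    refine le_of_tendsto (hP.sub hE).norm (Eventually.of_forall fun N => ?_)
    refine (norm_prod_sub_prod_le_sum (fun i => norm_bernChar_le_one (tiltRatio_nonneg (hy i))
      (tiltRatio_lt_one (hy i)).le _) (fun i => ?_) N).trans ?_
    · rw [Complex.norm_real, Real.norm_of_nonneg (Real.exp_pos _).le, Real.exp_le_one_iff]
      have := tiltVar_nonneg (ϑ := t u) (hy i)
      have : 0 ≤ tiltVar (t u) (jump τ u i) * s ^ 2 / 2 := by positivity
      linarith
    have hterm : ∀ i, ‖bernChar (tiltRatio (t u) (jump τ u i)) (s * jump τ u i)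
        - ((Real.exp (-(tiltVar (t u) (jump τ u i) * s ^ 2 / 2)) : ℝ) : ℂ)‖
        ≤ (|s| ^ 3 + s ^ 4) * C * env (jump τ u i) := fun i => by
      have h3 := norm_bernChar_sub_exp_le (tiltRatio_nonneg (ϑ := t u) (hy i))
        (tiltRatio_lt_one (ϑ := t u) (hy i)).le (s * jump τ u i)
      obtain ⟨-, h4, h5⟩ := hCb (t u) h1.le h2.le _ (hy i)
      set r := tiltRatio (t u) (jump τ u i) with hr
      set y := jump τ u i with hyy
      have e1 : r * (1 - r) * (s * y) ^ 2 = tiltVar (t u) y * s ^ 2 := by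
        unfold tiltVar; ring
      have e2 : r * (1 - r) * |s * y| ^ 3 = |s| ^ 3 * (y * tiltVar (t u) y) := by
        rw [abs_mul, abs_of_nonneg (hy i)]; unfold tiltVar; ring
      rw [e1, e2] at h3
      refine h3.trans ?_
      calc |s| ^ 3 * (y * tiltVar (t u) y) + (tiltVar (t u) y * s ^ 2) ^ 2
          = |s| ^ 3 * (y * tiltVar (t u) y) + s ^ 4 * tiltVar (t u) y ^ 2 := by ring
        _ ≤ |s| ^ 3 * (C * env y) + s ^ 4 * (C * env y) := by gcongr
        _ = _ := by ring
    refine (Finset.sum_le_sum fun i _ => hterm i).trans ?_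
    rw [← Finset.mul_sum, eq1, eq2]
    have h6 := (summable_env_jump hτ hτ' hu).sum_le_tsum (Finset.range N)
      (fun i _ => env_nonneg (hy i))
    have e3 : |s| ^ 3 = |x| ^ 3 * q⁻¹ / n := by
      rw [hs, abs_div, abs_of_pos hq0, ← hqn]; field_simp
    have e4 : s ^ 4 = x ^ 4 * n⁻¹ / n := by
      have : s ^ 4 = (s ^ 2) ^ 2 := by ring
      rw [this, hs2]; field_simp
    calc (|s| ^ 3 + s ^ 4) * C * ∑ i ∈ Finset.range N, env (jump τ u i)
        ≤ (|s| ^ 3 + s ^ 4) * C * ∑' i, env (jump τ u i) := by gcongr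
      _ = _ := by rw [e3, e4]; ring
  have := (hfinal.add (hV.sub_const ((Real.exp (-(tiltVarInt (alpha τ) θ * x ^ 2 / 2)) : ℝ) : ℂ)))
  rw [sub_self, add_zero] at this
  have h7 := this.norm
  rw [norm_zero] at h7
  refine h7.congr fun u => ?_
  simp

end

/-! ### Almost sure convergence of the defining series -/

section Kolmogorov

variable {Ω : Type*} [MeasurableSpace Ω] {P : Measure Ω} {X : ℕ → Ω → ℝ}

/-- The partial sums are a martingale for the natural filtration, bounded in L² by orthogonality and
so in L¹; martingale convergence applies. -/
theorem ae_exists_tendsto_sum_of_stronglyMeasurable (hm : ∀ i, StronglyMeasurable (X i))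
    (hind : iIndepFun X P) (hX : ∀ i, MemLp (X i) 2 P) (h0 : ∀ i, ∫ ω, X i ω ∂P = 0)
    (hv : Summable fun i => variance (X i) P) :
    ∀ᵐ ω ∂P, ∃ c, Tendsto (fun N : ℕ => ∑ i ∈ Finset.range N, X i ω) atTop (𝓝 c) := by
  have := hind.isProbabilityMeasure
  have hint : ∀ i, Integrable (X i) P := fun i => (hX i).integrable (by norm_num)
  set S : ℕ → Ω → ℝ := fun n => ∑ i ∈ Finset.range (n + 1), X i with hS
  have hSL : ∀ n, MemLp (S n) 2 P := fun n => memLp_finsetSum' _ fun i _ => hX i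
  have hSint : ∀ n, Integrable (S n) P := fun n => (hSL n).integrable (by norm_num)
  have hadp : StronglyAdapted (Filtration.natural X hm) S := by
    intro n
    refine Finset.stronglyMeasurable_sum _ fun i hi => ?_
    exact (Filtration.stronglyAdapted_natural hm i).mono
      ((Filtration.natural X hm).mono (Nat.lt_succ_iff.1 (Finset.mem_range.1 hi)))
  have hmart : Martingale S (Filtration.natural X hm) P := by
    refine martingale_nat hadp hSint fun i => ?_
    have h1 : S (i + 1) = S i + X (i + 1) := Finset.sum_range_succ _ _
    rw [h1]
    have h2 := condExp_add (hSint i) (hint (i + 1)) (Filtration.natural X hm i)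
    have h3 := hind.condExp_natural_ae_eq_of_lt hm (Nat.lt_succ_self i)
    have h4 : P[S i | Filtration.natural X hm i] = S i :=
      condExp_of_stronglyMeasurable ((Filtration.natural X hm).le i) (hadp i) (hSint i)
    filter_upwards [h2, h3] with ω e2 e3
    rw [e2, Pi.add_apply, h4, e3, h0, add_zero]
  have hvar : ∀ n, ∫ ω, (S n ω) ^ 2 ∂P ≤ ∑' i, variance (X i) P := by
    intro n
    have h1 : ∫ ω, S n ω ∂P = 0 := by
      simp only [hS, Finset.sum_apply]
      rw [integral_finsetSum _ fun i _ => hint i]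
      exact Finset.sum_eq_zero fun i _ => h0 i
    have h2 : variance (S n) P = ∫ ω, (S n ω) ^ 2 ∂P :=
      variance_of_integral_eq_zero (hSint n).aemeasurable h1
    have h3 : variance (S n) P = ∑ i ∈ Finset.range (n + 1), variance (X i) P :=
      IndepFun.variance_sum (fun i _ => hX i) fun i _ j _ hij => hind.indepFun hij
    rw [← h2, h3]
    exact hv.sum_le_tsum _ fun i _ => variance_nonneg _ _
  have hbdd : ∀ n, eLpNorm (S n) 1 P ≤ ((1 + ∑' i, variance (X i) P).toNNReal : ENNReal) := by
    intro n
    rw [eLpNorm_one_eq_lintegral_enorm, ← ofReal_integral_norm_eq_lintegral_enorm (hSint n)]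
    refine ENNReal.ofReal_le_ofReal ?_
    have h1 : ∫ ω, ‖S n ω‖ ∂P ≤ ∫ ω, (1 + (S n ω) ^ 2) ∂P := by
      refine integral_mono (hSint n).norm ((integrable_const _).add (hSL n).integrable_sq) ?_
      intro ω
      show |S n ω| ≤ 1 + (S n ω) ^ 2
      rw [← sq_abs]
      nlinarith [sq_nonneg (|S n ω| - 1), abs_nonneg (S n ω)]
    rw [integral_add (integrable_const _) (hSL n).integrable_sq] at h1
    simp only [integral_const, probReal_univ, smul_eq_mul, mul_one] at h1
    linarith [hvar n]
  have hfin := hmart.submartingale.exists_ae_tendsto_of_bdd hbdd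
  filter_upwards [hfin] with ω hω
  obtain ⟨c, hc⟩ := hω
  refine ⟨c, (tendsto_add_atTop_iff_nat 1).1 ?_⟩
  simpa only [hS, Finset.sum_apply] using hc

/-- **Kolmogorov's theorem**: a series of independent centred random variables with summable
variances converges almost surely. -/
theorem ae_exists_tendsto_sum (hind : iIndepFun X P) (hX : ∀ i, MemLp (X i) 2 P)
    (h0 : ∀ i, ∫ ω, X i ω ∂P = 0) (hv : Summable fun i => variance (X i) P) :
    ∀ᵐ ω ∂P, ∃ c, Tendsto (fun N : ℕ => ∑ i ∈ Finset.range N, X i ω) atTop (𝓝 c) := by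
  have hae : ∀ i, X i =ᵐ[P] (hX i).1.mk := fun i => (hX i).1.ae_eq_mk
  have h := ae_exists_tendsto_sum_of_stronglyMeasurable (X := fun i => (hX i).1.mk)
    (fun i => (hX i).1.stronglyMeasurable_mk) (hind.congr hae)
    (fun i => (memLp_congr_ae (hae i)).1 (hX i))
    (fun i => (integral_congr_ae (hae i)).symm.trans (h0 i))
    (hv.congr fun i => (variance_congr (hae i)))
  filter_upwards [h, ae_all_iff.2 hae] with ω h1 h2
  simpa only [h2] using h1

end Kolmogorov

/-- The indicator of `(-∞, t]`. -/
noncomputable def stepFun (t x : ℝ) : ℝ := Set.indicator (Set.Iic t) 1 x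

theorem measurable_stepFun (t : ℝ) : Measurable (stepFun t) :=
  measurable_one.indicator measurableSet_Iic

theorem stepFun_eq_zero_or_one (t x : ℝ) : stepFun t x = 0 ∨ stepFun t x = 1 := by
  unfold stepFun
  by_cases h : x ∈ Set.Iic t <;> simp [h]

theorem partialProcess_succ {Ω : Type*} (τ β : ℝ) (T : ℕ → Ω → ℝ) (N : ℕ) (t : ℝ) (ω : Ω) :
    partialProcess τ β T (N + 1) t ω = 1 + β * t +
      ∑ i ∈ Finset.range N, coeff τ (i + 2) * (stepFun t (T (i + 2) ω) - coeff τ (i + 2) * t) := by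
  unfold partialProcess
  congr 1
  rw [← Finset.Ico_add_one_right_eq_Icc, Finset.sum_Ico_eq_sum_range]
  refine Finset.sum_congr (by congr 1) fun i _ => ?_
  rw [add_comm 2 i]
  simp only [stepFun, Set.indicator_apply, Set.mem_Iic, Pi.one_apply]

section

variable {τ : ℝ} {Ω : Type*} [MeasurableSpace Ω] {P : Measure Ω} {T : ℕ → Ω → ℝ}

theorem measureReal_le_of_hasLaw_exp {c t : ℝ} (hc : 0 < c) (ht : 0 ≤ t) {Y : Ω → ℝ}
    (hY : HasLaw Y (expMeasure c) P) : P.real {ω | Y ω ≤ t} = 1 - Real.exp (-(c * t)) := by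
  have := isProbabilityMeasure_expMeasure hc
  rw [hY.measureReal_eq (p := fun x => x ≤ t) measurableSet_Iic]
  have h := cdf_expMeasure_eq hc t
  rw [if_pos ht, cdf_eq_real] at h
  exact h

theorem integral_comp_stepFun {E : Type*} [NormedAddCommGroup E] [NormedSpace ℝ E]
    [CompleteSpace E] [IsProbabilityMeasure P] {c t : ℝ} (hc : 0 < c) (ht : 0 ≤ t) {Y : Ω → ℝ}
    (hY : HasLaw Y (expMeasure c) P) (g : ℝ → E) :
    ∫ ω, g (stepFun t (Y ω)) ∂P
      = Real.exp (-(c * t)) • g 0 + (1 - Real.exp (-(c * t))) • g 1 := by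
  have hset : NullMeasurableSet {ω | Y ω ≤ t} P := hY.aemeasurable.nullMeasurable measurableSet_Iic
  have h1 : ∀ ω, g (stepFun t (Y ω)) = g 0 + Set.indicator {ω | Y ω ≤ t} (fun _ => g 1 - g 0) ω := by
    intro ω
    by_cases h : Y ω ≤ t <;> simp [stepFun, h]
  have hi : Integrable (Set.indicator {ω | Y ω ≤ t} (fun _ : Ω => g 1 - g 0)) P :=
    (integrable_const _).indicator₀ hset
  simp_rw [h1]
  rw [integral_add (integrable_const _) hi, integral_indicator₀ hset, setIntegral_const,
    measureReal_le_of_hasLaw_exp hc ht hY, integral_const, probReal_univ]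
  module

/-- Recentre each indicator at its mean p_i = 1 - e^{-c_i t}. The centred terms have variance at
most c_i³ t, and the deterministic corrections c_i (p_i - c_i t) are at most c_i³ t² in absolute
value; ∑ c_i³ converges because 3α > 1. -/
theorem ae_exists_tendsto_partialProcess [IsProbabilityMeasure P] (hτ : 3 < τ) (hτ' : τ < 4)
    (hind : iIndepFun (fun n : ℕ => T (n + 2)) P)
    (hT : ∀ i : ℕ, 2 ≤ i → HasLaw (T i) (expMeasure (coeff τ i)) P) (β : ℝ) {t : ℝ} (ht : 0 ≤ t) :
    ∀ᵐ ω ∂P, ∃ c, Tendsto (fun N : ℕ => partialProcess τ β T N t ω) atTop (𝓝 c) := by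
  obtain ⟨h1, h2⟩ := alpha_bounds hτ hτ'
  set c : ℕ → ℝ := fun i => coeff τ (i + 2) with hcdef
  have hc : ∀ i, 0 < c i := fun i => coeff_pos τ i
  have hlaw : ∀ i, HasLaw (T (i + 2)) (expMeasure (c i)) P := fun i => hT _ (by omega)
  set p : ℕ → ℝ := fun i => 1 - Real.exp (-(c i * t)) with hp
  have hct : ∀ i, 0 ≤ c i * t := fun i => mul_nonneg (hc i).le ht
  have hp0 : ∀ i, 0 ≤ p i := fun i => by
    simp only [hp, sub_nonneg, Real.exp_le_one_iff]; linarith [hct i]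
  have hp1 : ∀ i, p i ≤ 1 := fun i => by simp only [hp]; linarith [Real.exp_pos (-(c i * t))]
  have hpc : ∀ i, p i ≤ c i * t := fun i => by
    simp only [hp]; linarith [Real.add_one_le_exp (-(c i * t))]
  have hc3 : Summable fun i => c i ^ 3 := by
    have hs : Summable fun n : ℕ => (n : ℝ) ^ (-(3 * alpha τ)) :=
      Real.summable_nat_rpow.2 (by linarith)
    refine ((summable_nat_add_iff 2).2 hs).congr fun i => ?_
    simp only [hcdef, coeff]
    rw [← Real.rpow_natCast, ← Real.rpow_mul (by positivity)]
    congr 1; push_cast; ring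
  set X : ℕ → Ω → ℝ := fun i ω => c i * (stepFun t (T (i + 2) ω) - p i) with hX
  have hmeas : ∀ i, AEMeasurable (X i) P := fun i =>
    ((((measurable_stepFun t).comp_aemeasurable (hlaw i).aemeasurable).sub_const _).const_mul _)
  have hbd : ∀ i ω, X i ω ∈ Set.Icc (c i * (0 - p i)) (c i * (1 - p i)) := by
    intro i ω
    constructor <;> refine mul_le_mul_of_nonneg_left ?_ (hc i).le <;>
      rcases stepFun_eq_zero_or_one t (T (i + 2) ω) with h | h <;> rw [h] <;> linarith
  have hX0 : ∀ i, ∫ ω, X i ω ∂P = 0 := by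
    intro i
    have h := integral_comp_stepFun (hc i) ht (hlaw i) fun a => c i * (a - p i)
    refine h.trans ?_
    simp only [hp, smul_eq_mul]
    ring
  have hind' : iIndepFun X P :=
    hind.comp (fun i x => c i * (stepFun t x - p i)) fun i =>
      ((measurable_stepFun t).sub_const _).const_mul _
  have hvar : ∀ i, variance (X i) P ≤ c i ^ 3 * t := by
    intro i
    have h := variance_le_sub_mul_sub (ae_of_all P (hbd i)) (hmeas i)
    rw [hX0 i] at h
    refine h.trans ?_
    have e1 : (c i * (1 - p i) - 0) * (0 - c i * (0 - p i)) = c i ^ 2 * (p i * (1 - p i)) := by ring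
    have e2 : p i * (1 - p i) ≤ c i * t := by nlinarith [hp0 i, hp1 i, hpc i]
    rw [e1]
    calc c i ^ 2 * (p i * (1 - p i)) ≤ c i ^ 2 * (c i * t) :=
          mul_le_mul_of_nonneg_left e2 (sq_nonneg _)
      _ = c i ^ 3 * t := by ring
  have hsum := ae_exists_tendsto_sum hind'
    (fun i => MemLp.of_bound (hmeas i).aestronglyMeasurable (c i)
      (ae_of_all P fun ω => by
        obtain ⟨ha, hb⟩ := hbd i ω
        rw [Real.norm_eq_abs, abs_le]
        constructor <;> nlinarith [hc i, hp0 i, hp1 i]))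
    hX0 (Summable.of_nonneg_of_le (fun i => variance_nonneg _ _) hvar (hc3.mul_right t))
  have hcomp : Summable fun i => c i * (p i - c i * t) := by
    refine Summable.of_norm_bounded (hc3.mul_right (t ^ 2)) fun i => ?_
    rw [Real.norm_eq_abs, abs_mul, abs_of_pos (hc i)]
    have h : |p i - c i * t| ≤ (c i * t) ^ 2 := by
      have h := abs_exp_neg_sub_le (hct i)
      rw [← abs_neg] at h
      refine (le_of_eq ?_).trans h
      congr 1; simp only [hp]; ring
    calc c i * |p i - c i * t| ≤ c i * (c i * t) ^ 2 := mul_le_mul_of_nonneg_left h (hc i).le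
      _ = c i ^ 3 * t ^ 2 := by ring
  filter_upwards [hsum] with ω hω
  obtain ⟨a, ha⟩ := hω
  refine ⟨1 + β * t + (a + ∑' i, c i * (p i - c i * t)), (tendsto_add_atTop_iff_nat 1).1 ?_⟩
  refine ((ha.add hcomp.hasSum.tendsto_sum_nat).const_add (1 + β * t)).congr fun N => ?_
  rw [partialProcess_succ, ← Finset.sum_add_distrib]
  congr 1
  refine Finset.sum_congr rfl fun i _ => ?_
  simp only [hX, hcdef]
  ring

theorem ae_tendsto_partialProcess [IsProbabilityMeasure P] (hτ : 3 < τ) (hτ' : τ < 4)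
    (hind : iIndepFun (fun n : ℕ => T (n + 2)) P)
    (hT : ∀ i : ℕ, 2 ≤ i → HasLaw (T i) (expMeasure (coeff τ i)) P) (β : ℝ) {t : ℝ} (ht : 0 ≤ t) :
    ∀ᵐ ω ∂P, Tendsto (fun N : ℕ => partialProcess τ β T N t ω) atTop
      (𝓝 (process τ β T t ω)) := by
  filter_upwards [ae_exists_tendsto_partialProcess hτ hτ' hind hT β ht] with ω hω
  exact tendsto_nhds_limUnder hω

end

/-! ### Bromwich inversion: an exact formula for smoothed tail probabilities -/

/-- A continuous approximation of the indicator of `(0, ∞)` from below. -/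
noncomputable def hinge (a x : ℝ) : ℝ := max 0 (1 - Real.exp (-(a * x)))

theorem hinge_nonneg (a x : ℝ) : 0 ≤ hinge a x := le_max_left _ _

theorem hinge_le_one (a x : ℝ) : hinge a x ≤ 1 :=
  max_le zero_le_one (by linarith [Real.exp_pos (-(a * x))])

theorem continuous_hinge (a : ℝ) : Continuous (hinge a) := by unfold hinge; fun_prop

theorem hinge_of_nonpos {a x : ℝ} (ha : 0 ≤ a) (hx : x ≤ 0) : hinge a x = 0 := by
  refine max_eq_left ?_
  have : 1 ≤ Real.exp (-(a * x)) := Real.one_le_exp (by nlinarith)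
  linarith

theorem hinge_of_nonneg {a x : ℝ} (ha : 0 ≤ a) (hx : 0 ≤ x) :
    hinge a x = 1 - Real.exp (-(a * x)) := by
  refine max_eq_right ?_
  have : Real.exp (-(a * x)) ≤ 1 := Real.exp_le_one_iff.2 (by nlinarith)
  linarith

/-- The Laplace transform of `hinge a` at `ϑ + i s`. -/
noncomputable def hingeLaplace (a ϑ s : ℝ) : ℂ :=
  a / ((ϑ + s * Complex.I) * (ϑ + a + s * Complex.I))

section

variable {a ϑ : ℝ}

theorem add_mul_I_ne_zero (hϑ : 0 < ϑ) (s : ℝ) : (ϑ : ℂ) + s * Complex.I ≠ 0 := by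
  intro h
  have := congrArg Complex.re h
  simp at this
  linarith

theorem continuous_hingeLaplace (ha : 0 < a) (hϑ : 0 < ϑ) : Continuous (hingeLaplace a ϑ) := by
  unfold hingeLaplace
  refine Continuous.div (by fun_prop) (by fun_prop) fun s => mul_ne_zero ?_ ?_
  · exact add_mul_I_ne_zero hϑ s
  · have := add_mul_I_ne_zero (add_pos hϑ ha) s
    push_cast at this
    exact this

theorem norm_hingeLaplace_le (ha : 0 < a) (hϑ : 0 < ϑ) (s : ℝ) :
    ‖hingeLaplace a ϑ s‖ ≤ a / (ϑ ^ 2 + s ^ 2) := by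
  have h1 : ∀ b : ℝ, ‖(b : ℂ) + s * Complex.I‖ = √(b ^ 2 + s ^ 2) := fun b => by
    rw [Complex.norm_add_mul_I]
  have h2 := h1 (ϑ + a)
  push_cast at h2
  rw [hingeLaplace, norm_div, norm_mul, h1, h2, Complex.norm_real, Real.norm_of_nonneg ha.le]
  refine div_le_div_of_nonneg_left ha.le (by positivity) ?_
  calc ϑ ^ 2 + s ^ 2 = √(ϑ ^ 2 + s ^ 2) * √(ϑ ^ 2 + s ^ 2) :=
        (Real.mul_self_sqrt (by positivity)).symm
    _ ≤ √(ϑ ^ 2 + s ^ 2) * √((ϑ + a) ^ 2 + s ^ 2) := by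
        gcongr; linarith

/-- This is the purpose of the smoothing: the transform 1/(ϑ + is) of the indicator itself is not
integrable. -/
theorem integrable_hingeLaplace (ha : 0 < a) (hϑ : 0 < ϑ) : Integrable (hingeLaplace a ϑ) := by
  refine Integrable.mono' (integrable_inv_one_add_sq.const_mul (a / min 1 (ϑ ^ 2)))
    (continuous_hingeLaplace ha hϑ).aestronglyMeasurable (ae_of_all _ fun s => ?_)
  have hm : 0 < min 1 (ϑ ^ 2) := lt_min one_pos (by positivity)
  refine (norm_hingeLaplace_le ha hϑ s).trans ?_
  rw [← div_eq_mul_inv, div_div]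
  refine div_le_div_of_nonneg_left ha.le (by positivity) ?_
  nlinarith [min_le_left 1 (ϑ ^ 2), min_le_right 1 (ϑ ^ 2), sq_nonneg s]

open FourierTransform in
/-- The Bromwich inversion formula for `hinge a`. -/
theorem hinge_eq_integral (ha : 0 < a) (hϑ : 0 < ϑ) (x : ℝ) :
    (hinge a x : ℂ) = (2 * Real.pi : ℝ)⁻¹ •
      ∫ s : ℝ, Complex.exp ((ϑ + s * Complex.I) * x) * hingeLaplace a ϑ s := by
  -- The factor e^{-ϑv} makes the hinge integrable. Its Fourier transform at w is `hingeLaplace a ϑ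
  -- (2πw)`, so Fourier inversion gives the formula after rescaling the frequency.
  set g : ℝ → ℂ := fun v => Complex.exp (-(ϑ * v)) * hinge a v with hg
  have hgc : Continuous g := by
    have := continuous_hinge a
    fun_prop
  have hg0 : ∀ w : ℝ, (fun v : ℝ => Complex.exp (↑(-2 * Real.pi * v * w) * Complex.I) • g v) =
      (Set.Ioi (0 : ℝ)).indicator (fun v : ℝ =>
        Complex.exp (-(ϑ + ↑(2 * Real.pi * w) * Complex.I) * v) -
        Complex.exp (-(ϑ + a + ↑(2 * Real.pi * w) * Complex.I) * v)) := by
    intro w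
    ext v
    by_cases hv : 0 < v
    · rw [Set.indicator_of_mem (Set.mem_Ioi.2 hv)]
      simp only [hg, smul_eq_mul]
      rw [hinge_of_nonneg ha.le hv.le]
      push_cast
      rw [← mul_assoc, ← Complex.exp_add, mul_sub, mul_one, ← Complex.exp_add]
      congr 2 <;> ring
    · rw [Set.indicator_of_notMem (by simpa using hv)]
      simp only [hg, hinge_of_nonpos ha.le (not_lt.1 hv)]
      simp
  have hre : ∀ w : ℝ, (-((ϑ : ℂ) + ↑(2 * Real.pi * w) * Complex.I)).re < 0 := by
    intro w; simp [hϑ]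
  have hre' : ∀ w : ℝ, (-((ϑ : ℂ) + a + ↑(2 * Real.pi * w) * Complex.I)).re < 0 := by
    intro w; simp; linarith
  have hgi : Integrable g := by
    have h := hg0 0
    have e : (fun v : ℝ => Complex.exp (↑(-2 * Real.pi * v * 0) * Complex.I) • g v) = g := by
      ext v; simp
    rw [e] at h
    rw [h, integrable_indicator_iff measurableSet_Ioi]
    exact (integrableOn_exp_mul_complex_Ioi (hre 0) 0).sub
      (integrableOn_exp_mul_complex_Ioi (hre' 0) 0)
  have hF : 𝓕 g = fun w => hingeLaplace a ϑ (2 * Real.pi * w) := by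
    ext w
    rw [Real.fourier_real_eq_integral_exp_smul, hg0, integral_indicator measurableSet_Ioi,
      integral_sub (integrableOn_exp_mul_complex_Ioi (hre w) 0)
        (integrableOn_exp_mul_complex_Ioi (hre' w) 0),
      integral_exp_mul_complex_Ioi (hre w), integral_exp_mul_complex_Ioi (hre' w), hingeLaplace]
    have n1 := add_mul_I_ne_zero hϑ (2 * Real.pi * w)
    have n2 := add_mul_I_ne_zero (add_pos hϑ ha) (2 * Real.pi * w)
    rw [Complex.ofReal_add] at n2
    generalize (↑(2 * Real.pi * w) : ℂ) = q at *
    simp only [Complex.ofReal_zero, mul_zero, Complex.exp_zero]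
    field_simp
    ring
  have hFi : Integrable (𝓕 g) := by
    rw [hF]
    exact (integrable_hingeLaplace ha hϑ).comp_mul_left' (by positivity)
  have hinv := congrFun (hgc.fourierInv_fourier_eq hgi hFi) x
  rw [Real.fourierInv_eq', hF] at hinv
  have hsc := Measure.integral_comp_mul_left
    (fun s : ℝ => Complex.exp (s * x * Complex.I) * hingeLaplace a ϑ s) (2 * Real.pi)
  have e1 : ∀ s : ℝ, Complex.exp ((ϑ + s * Complex.I) * x) * hingeLaplace a ϑ s =
      Complex.exp (ϑ * x) * (Complex.exp (s * x * Complex.I) * hingeLaplace a ϑ s) := fun s => by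
    rw [← mul_assoc, ← Complex.exp_add]
    congr 2; ring
  simp_rw [e1]
  rw [integral_const_mul, ← mul_smul_comm]
  rw [abs_of_pos (by positivity)] at hsc
  rw [← hsc]
  have e2 : (hinge a x : ℂ) = Complex.exp (ϑ * x) * g x := by
    simp only [hg]
    rw [← mul_assoc, ← Complex.exp_add]
    simp
  rw [e2, ← hinv]
  congr 1
  refine integral_congr_ae (ae_of_all _ fun w => ?_)
  simp only [smul_eq_mul]
  congr 2
  simp
  ring

variable {Ω : Type*} [MeasurableSpace Ω] {P : Measure Ω} [IsProbabilityMeasure P]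

/-- Fubini after inserting the inversion formula. The upper bound on W gives |e^{(ϑ + is)W}| ≤
e^{ϑC}; finite partial sums of the jumps satisfy such a bound. -/
theorem integral_hinge_eq (ha : 0 < a) (hϑ : 0 < ϑ) {W : Ω → ℝ} (hW : AEMeasurable W P) {C : ℝ}
    (hC : ∀ ω, W ω ≤ C) :
    ((∫ ω, hinge a (W ω) ∂P : ℝ) : ℂ) = (2 * Real.pi : ℝ)⁻¹ •
      ∫ s : ℝ, hingeLaplace a ϑ s * ∫ ω, Complex.exp ((ϑ + s * Complex.I) * W ω) ∂P := by
  rw [← integral_complex_ofReal]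
  simp_rw [hinge_eq_integral ha hϑ]
  rw [integral_smul]
  congr 1
  have hint : Integrable (Function.uncurry fun (ω : Ω) (s : ℝ) =>
      Complex.exp ((ϑ + s * Complex.I) * W ω) * hingeLaplace a ϑ s) (P.prod volume) := by
    refine Integrable.mono' ((integrable_const (Real.exp (ϑ * C))).mul_prod
      (integrable_hingeLaplace ha hϑ).norm) ?_ (ae_of_all _ fun z => ?_)
    · have h1 : AEMeasurable (fun z : Ω × ℝ => W z.1) (P.prod volume) :=
        hW.comp_quasiMeasurePreserving Measure.quasiMeasurePreserving_fst
      have h2 : AEMeasurable (fun z : Ω × ℝ => hingeLaplace a ϑ z.2) (P.prod volume) :=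
        ((continuous_hingeLaplace ha hϑ).measurable.comp measurable_snd).aemeasurable
      refine AEMeasurable.aestronglyMeasurable (AEMeasurable.mul ?_ h2)
      exact Complex.measurable_exp.comp_aemeasurable
        (AEMeasurable.mul (by fun_prop) (Complex.measurable_ofReal.comp_aemeasurable h1))
    · simp only [Function.uncurry]
      rw [norm_mul, Complex.norm_exp]
      refine mul_le_mul_of_nonneg_right (Real.exp_le_exp.2 ?_) (norm_nonneg _)
      simp only [Complex.mul_re, Complex.add_re, Complex.ofReal_re, Complex.ofReal_im,
        Complex.I_re, Complex.I_im, mul_zero, sub_zero, add_zero, mul_one]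
      nlinarith [hC z.1]
  rw [integral_integral_swap hint]
  refine integral_congr_ae (ae_of_all _ fun s => ?_)
  simp only
  rw [integral_mul_const, mul_comm]

end

/-- The left side is the expectation of exp((ϑ + is) y (B - y)) for B Bernoulli of parameter 1 -
e^{-y}. Taking out e^{cgf} leaves an expectation under the tilted parameter r, split into the phase
of the mean `dcgf` and the centred part. -/
theorem weight_mul_cexp_mul_bernChar {y : ℝ} (hy : 0 ≤ y) (ϑ s : ℝ) :
    Real.exp (-y) • Complex.exp ((ϑ + s * Complex.I) * ((y * (0 - y) : ℝ) : ℂ)) +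
      (1 - Real.exp (-y)) • Complex.exp ((ϑ + s * Complex.I) * ((y * (1 - y) : ℝ) : ℂ)) =
    Complex.exp (cgf ϑ y + s * dcgf ϑ y * Complex.I) * bernChar (tiltRatio ϑ y) (s * y) := by
  have hw := weight_pos (ϑ := ϑ) hy
  set r := tiltRatio ϑ y with hr
  have h1 : (weight ϑ y : ℂ) * (1 - r) = Real.exp (-y) * Complex.exp (-(ϑ * y)) := by
    have : weight ϑ y * (1 - r) = Real.exp (-y) * Real.exp (-(ϑ * y)) := by
      rw [hr, one_sub_tiltRatio hy, mul_div_cancel₀ _ hw.ne', ← Real.exp_add]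
      congr 1; ring
    exact_mod_cast congrArg Complex.ofReal this
  have h2 : (weight ϑ y : ℂ) * r = ((1 - Real.exp (-y) : ℝ) : ℂ) := by
    rw [← Complex.ofReal_mul, hr, tiltRatio_eq, mul_div_cancel₀ _ hw.ne']
  have h3 : Complex.exp (cgf ϑ y + s * dcgf ϑ y * Complex.I) =
      weight ϑ y * Complex.exp (ϑ * y - ϑ * y ^ 2 + s * (y * (r - y)) * Complex.I) := by
    have e : (weight ϑ y : ℂ) = Complex.exp (Real.log (weight ϑ y)) := by
      rw [← Complex.ofReal_exp, Real.exp_log hw]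
    rw [e, ← Complex.exp_add]
    congr 1
    unfold cgf dcgf
    push_cast
    ring
  rw [h3, bernChar, Complex.real_smul, Complex.real_smul]
  set A : ℂ := ϑ * y - ϑ * y ^ 2 + s * (y * (r - y)) * Complex.I with hA
  have e : ∀ p q : ℂ, weight ϑ y * Complex.exp A * ((1 - r) * Complex.exp p + r * Complex.exp q) =
      (weight ϑ y * (1 - r)) * (Complex.exp A * Complex.exp p) +
        (weight ϑ y * r) * (Complex.exp A * Complex.exp q) := fun p q => by ring
  rw [e, h1, h2, mul_assoc (Real.exp (-y) : ℂ), ← Complex.exp_add, ← Complex.exp_add,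
    ← Complex.exp_add]
  congr 3
  · rw [hA]; push_cast; ring
  · rw [hA]; push_cast; ring

section

variable {τ : ℝ} {Ω : Type*} {T : ℕ → Ω → ℝ}

/-- The sum of the first `N` compensated jumps of `u S_u`. -/
noncomputable def jumpSum (τ : ℝ) (T : ℕ → Ω → ℝ) (u : ℝ) (N : ℕ) (ω : Ω) : ℝ :=
  ∑ i ∈ Finset.range N, jump τ u i * (stepFun u (T (i + 2) ω) - jump τ u i)

theorem mul_partialProcess_succ (τ β : ℝ) (T : ℕ → Ω → ℝ) (N : ℕ) (u : ℝ) (ω : Ω) :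
    u * partialProcess τ β T (N + 1) u ω = u * (1 + β * u) + jumpSum τ T u N ω := by
  rw [partialProcess_succ, mul_add, Finset.mul_sum, jumpSum]
  congr 1
  refine Finset.sum_congr rfl fun i _ => ?_
  rw [jump]; ring

theorem jumpSum_le {u : ℝ} (hu : 0 < u) (N : ℕ) (ω : Ω) :
    jumpSum τ T u N ω ≤ ∑ i ∈ Finset.range N, jump τ u i := by
  refine Finset.sum_le_sum fun i _ => ?_
  have := jump_pos (τ := τ) hu i
  rcases stepFun_eq_zero_or_one u (T (i + 2) ω) with h | h <;> rw [h] <;> nlinarith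

variable [MeasurableSpace Ω] {P : Measure Ω}

theorem aemeasurable_jumpSum
    (hT : ∀ i : ℕ, 2 ≤ i → HasLaw (T i) (expMeasure (coeff τ i)) P) (u : ℝ) (N : ℕ) :
    AEMeasurable (jumpSum τ T u N) P := by
  refine Finset.aemeasurable_fun_sum _ fun i _ => ?_
  exact (((measurable_stepFun u).comp_aemeasurable
    (hT (i + 2) (by omega)).aemeasurable).sub_const _).const_mul _

variable [IsProbabilityMeasure P]

theorem integral_exp_jumpSum (hind : iIndepFun (fun n : ℕ => T (n + 2)) P)
    (hT : ∀ i : ℕ, 2 ≤ i → HasLaw (T i) (expMeasure (coeff τ i)) P) {u : ℝ} (hu : 0 < u)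
    (ϑ s b : ℝ) (N : ℕ) :
    ∫ ω, Complex.exp ((ϑ + s * Complex.I) * ((b + jumpSum τ T u N ω : ℝ) : ℂ)) ∂P =
      Complex.exp (((ϑ * b + ∑ i ∈ Finset.range N, cgf ϑ (jump τ u i) : ℝ) : ℂ) +
        s * ((b + ∑ i ∈ Finset.range N, dcgf ϑ (jump τ u i) : ℝ) : ℂ) * Complex.I) *
      ∏ i ∈ Finset.range N, bernChar (tiltRatio ϑ (jump τ u i)) (s * jump τ u i) := by
  have hlaw : ∀ i : ℕ, HasLaw (T (i + 2)) (expMeasure (coeff τ (i + 2))) P :=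
    fun i => hT _ (by omega)
  set z : ℂ := ϑ + s * Complex.I with hz
  have h1 : ∀ ω, Complex.exp (z * ((b + jumpSum τ T u N ω : ℝ) : ℂ)) = Complex.exp (z * b) *
      ∏ i : Fin N, Complex.exp (z *
        ((jump τ u i * (stepFun u (T (i + 2) ω) - jump τ u i) : ℝ) : ℂ)) := by
    intro ω
    rw [← Complex.exp_sum, ← Complex.exp_add, jumpSum, Finset.sum_range, ← Finset.mul_sum,
      Complex.ofReal_add, Complex.ofReal_sum, mul_add]
  simp_rw [h1]
  rw [integral_const_mul]
  have hfin : iIndepFun (fun i : Fin N => T ((i : ℕ) + 2)) P := hind.precomp Fin.val_injective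
  have h2 := hfin.integral_fun_prod_comp (fun i => (hlaw i).aemeasurable)
    (f := fun (i : Fin N) (x : ℝ) => Complex.exp (z * ((jump τ u i * (stepFun u x - jump τ u i) : ℝ) : ℂ)))
    (fun i => by
      have := measurable_stepFun u
      exact Measurable.aestronglyMeasurable (by fun_prop))
  rw [h2]
  have h3 : ∀ i : ℕ, ∫ ω, Complex.exp (z *
        ((jump τ u i * (stepFun u (T (i + 2) ω) - jump τ u i) : ℝ) : ℂ)) ∂P =
      Complex.exp (cgf ϑ (jump τ u i) + s * dcgf ϑ (jump τ u i) * Complex.I) *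
        bernChar (tiltRatio ϑ (jump τ u i)) (s * jump τ u i) := by
    intro i
    rw [integral_comp_stepFun (coeff_pos τ i) hu.le (hlaw i) fun a =>
      Complex.exp (z * ((jump τ u i * (a - jump τ u i) : ℝ) : ℂ)), mul_comm (coeff τ (i + 2)) u]
    exact weight_mul_cexp_mul_bernChar (jump_pos hu i).le ϑ s
  simp_rw [h3]
  rw [Finset.prod_mul_distrib, ← Complex.exp_sum, ← mul_assoc, ← Complex.exp_add, Finset.prod_range,
    Finset.sum_range, Finset.sum_range]
  congr 2
  rw [Finset.sum_add_distrib, ← Finset.sum_mul, ← Finset.mul_sum, hz]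
  push_cast
  ring

theorem integral_hinge_jumpSum (hind : iIndepFun (fun n : ℕ => T (n + 2)) P)
    (hT : ∀ i : ℕ, 2 ≤ i → HasLaw (T i) (expMeasure (coeff τ i)) P) {u : ℝ} (hu : 0 < u)
    {a ϑ : ℝ} (ha : 0 < a) (hϑ : 0 < ϑ) (b : ℝ) (N : ℕ) :
    ((∫ ω, hinge a (b + jumpSum τ T u N ω) ∂P : ℝ) : ℂ) =
      (Real.exp (ϑ * b + ∑ i ∈ Finset.range N, cgf ϑ (jump τ u i)) / (2 * Real.pi)) •
      ∫ s : ℝ, hingeLaplace a ϑ s *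
        (Complex.exp (s * ((b + ∑ i ∈ Finset.range N, dcgf ϑ (jump τ u i) : ℝ) : ℂ) * Complex.I) *
        ∏ i ∈ Finset.range N, bernChar (tiltRatio ϑ (jump τ u i)) (s * jump τ u i)) := by
  rw [integral_hinge_eq ha hϑ ((aemeasurable_jumpSum hT u N).const_add b)
    (fun ω => add_le_add_right (jumpSum_le hu N ω) b)]
  simp_rw [integral_exp_jumpSum hind hT hu]
  rw [div_eq_inv_mul, mul_smul]
  congr 1
  rw [← integral_smul]
  refine integral_congr_ae (ae_of_all _ fun s => ?_)
  simp only
  rw [Complex.exp_add, Complex.real_smul, Complex.ofReal_exp]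
  ring

theorem norm_prod_bernChar_le_one {u : ℝ} (hu : 0 < u) (ϑ s : ℝ) (N : ℕ) :
    ‖∏ i ∈ Finset.range N, bernChar (tiltRatio ϑ (jump τ u i)) (s * jump τ u i)‖ ≤ 1 := by
  rw [norm_prod]
  exact Finset.prod_le_one (fun _ _ => norm_nonneg _) fun i _ =>
    norm_bernChar_le_one (tiltRatio_nonneg (jump_pos hu i).le)
      (tiltRatio_lt_one (jump_pos hu i).le).le _

theorem continuous_bernChar_mul (r y : ℝ) : Continuous fun s : ℝ => bernChar r (s * y) := by
  unfold bernChar; fun_prop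

/-- The identity for N jumps passes to the limit by dominated convergence on both sides: the hinge
is continuous and bounded by 1, and the phase and the Bernoulli product have modulus at most 1
against the integrable transform. -/
theorem integral_hinge_process (hτ : 3 < τ) (hτ' : τ < 4)
    (hind : iIndepFun (fun n : ℕ => T (n + 2)) P)
    (hT : ∀ i : ℕ, 2 ≤ i → HasLaw (T i) (expMeasure (coeff τ i)) P) (β : ℝ) {u : ℝ} (hu : 0 < u)
    {a ϑ : ℝ} (ha : 0 < a) (hϑ : 0 < ϑ) (c : ℝ) :
    ((∫ ω, hinge a (c + u * process τ β T u ω) ∂P : ℝ) : ℂ) =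
      (Real.exp (logMgf τ β u ϑ + ϑ * c) / (2 * Real.pi)) •
      ∫ s : ℝ, hingeLaplace a ϑ s *
        (Complex.exp (s * ((c + tiltMean τ β u ϑ : ℝ) : ℂ) * Complex.I) * tiltChar τ u ϑ s) := by
  set b : ℝ := c + u * (1 + β * u) with hb
  have hconv := ae_tendsto_partialProcess hτ hτ' hind hT β hu.le
  have hL : Tendsto (fun N : ℕ => ∫ ω, hinge a (b + jumpSum τ T u N ω) ∂P) atTop
      (𝓝 (∫ ω, hinge a (c + u * process τ β T u ω) ∂P)) := by
    refine tendsto_integral_of_dominated_convergence (fun _ => 1) (fun N => ?_)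
      (integrable_const _) (fun N => ae_of_all _ fun ω => ?_) ?_
    · exact ((continuous_hinge a).measurable.comp_aemeasurable
        ((aemeasurable_jumpSum hT u N).const_add b)).aestronglyMeasurable
    · rw [Real.norm_of_nonneg (hinge_nonneg _ _)]
      exact hinge_le_one _ _
    · filter_upwards [hconv] with ω hω
      refine ((continuous_hinge a).tendsto _).comp ?_
      refine ((((tendsto_add_atTop_iff_nat 1).2 hω).const_mul u).const_add c).congr fun N => ?_
      rw [mul_partialProcess_succ, hb]
      ring
  have hd := (summable_dcgf_jump hτ hτ' hu ϑ).hasSum.tendsto_sum_nat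
  have hc := (summable_cgf_jump hτ hτ' hu ϑ).hasSum.tendsto_sum_nat
  have hR : Tendsto (fun N : ℕ => ∫ s : ℝ, hingeLaplace a ϑ s *
        (Complex.exp (s * ((b + ∑ i ∈ Finset.range N, dcgf ϑ (jump τ u i) : ℝ) : ℂ) * Complex.I) *
        ∏ i ∈ Finset.range N, bernChar (tiltRatio ϑ (jump τ u i)) (s * jump τ u i))) atTop
      (𝓝 (∫ s : ℝ, hingeLaplace a ϑ s *
        (Complex.exp (s * ((c + tiltMean τ β u ϑ : ℝ) : ℂ) * Complex.I) * tiltChar τ u ϑ s))) := by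
    refine tendsto_integral_of_dominated_convergence (fun s => ‖hingeLaplace a ϑ s‖) (fun N => ?_)
      (integrable_hingeLaplace ha hϑ).norm (fun N => ae_of_all _ fun s => ?_)
      (ae_of_all _ fun s => ?_)
    · refine Continuous.aestronglyMeasurable ((continuous_hingeLaplace ha hϑ).mul ?_)
      exact Continuous.mul (by fun_prop)
        (continuous_finsetProd _ fun i _ => continuous_bernChar_mul _ _)
    · rw [norm_mul, norm_mul, ← Complex.ofReal_mul, Complex.norm_exp_ofReal_mul_I, one_mul]
      exact mul_le_of_le_one_right (norm_nonneg _) (norm_prod_bernChar_le_one hu _ _ _)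
    · refine Tendsto.const_mul _ (Tendsto.mul ?_ (tendsto_prod_bernChar hτ hτ' hu ϑ s))
      have h1 : Tendsto (fun N : ℕ => b + ∑ i ∈ Finset.range N, dcgf ϑ (jump τ u i)) atTop
          (𝓝 (c + tiltMean τ β u ϑ)) := by
        have e : c + tiltMean τ β u ϑ = b + ∑' i, dcgf ϑ (jump τ u i) := by
          rw [hb, tiltMean]; ring
        rw [e]
        exact hd.const_add b
      have hcont : Continuous fun x : ℝ => Complex.exp (s * (x : ℂ) * Complex.I) := by fun_prop
      exact (hcont.tendsto _).comp h1
  have hE : Tendsto (fun N : ℕ =>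
      Real.exp (ϑ * b + ∑ i ∈ Finset.range N, cgf ϑ (jump τ u i)) / (2 * Real.pi)) atTop
      (𝓝 (Real.exp (logMgf τ β u ϑ + ϑ * c) / (2 * Real.pi))) := by
    refine Tendsto.div_const ((Real.continuous_exp.tendsto _).comp ?_) _
    have e : logMgf τ β u ϑ + ϑ * c = ϑ * b + ∑' i, cgf ϑ (jump τ u i) := by
      rw [hb, logMgf]; ring
    rw [e]
    exact hc.const_add _
  refine tendsto_nhds_unique ((Complex.continuous_ofReal.tendsto _).comp hL)
    ((hE.smul hR).congr fun N => ?_)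
  exact (integral_hinge_jumpSum hind hT hu ha hϑ b N).symm

end

/-! ### Laplace asymptotics of the inversion integral and removal of the smoothing -/

variable {τ : ℝ}

theorem stronglyMeasurable_tiltChar (hτ : 3 < τ) (hτ' : τ < 4) {u : ℝ} (hu : 0 < u) (ϑ : ℝ) :
    StronglyMeasurable (tiltChar τ u ϑ) :=
  stronglyMeasurable_of_tendsto atTop
    (fun _ => (continuous_finsetProd _ fun _ _ => continuous_bernChar_mul _ _).stronglyMeasurable)
    (tendsto_pi_nhds.2 fun s => tendsto_prod_bernChar hτ hτ' hu ϑ s)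

theorem exp_neg_mul_abs_le {c : ℝ} (hc : 0 < c) (x : ℝ) :
    Real.exp (-(c * |x|)) ≤ (min 1 (c ^ 2 / 2))⁻¹ * (1 + x ^ 2)⁻¹ := by
  have hm : 0 < min 1 (c ^ 2 / 2) := lt_min one_pos (by positivity)
  have hcx : 0 ≤ c * |x| := by positivity
  rw [Real.exp_neg, ← mul_inv]
  refine inv_anti₀ (by positivity) ?_
  refine le_trans ?_ (Real.quadratic_le_exp_of_nonneg hcx)
  have e : (c * |x|) ^ 2 / 2 = c ^ 2 / 2 * x ^ 2 := by rw [mul_pow, sq_abs]; ring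
  rw [e]
  nlinarith [min_le_left 1 (c ^ 2 / 2), min_le_right 1 (c ^ 2 / 2), sq_nonneg x]

theorem integrable_exp_neg_mul_abs {c : ℝ} (hc : 0 < c) :
    Integrable fun x : ℝ => Real.exp (-(c * |x|)) := by
  refine Integrable.mono' (integrable_inv_one_add_sq.const_mul (min 1 (c ^ 2 / 2))⁻¹)
    (Continuous.aestronglyMeasurable (by fun_prop)) (ae_of_all _ fun x => ?_)
  rw [Real.norm_of_nonneg (Real.exp_pos _).le]
  exact exp_neg_mul_abs_le hc x

/-- At s = x/R with R = √n, this turns the decay bound for the tilted characteristic function into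
the majorant e^{c - c|x|}, uniform in R ≥ 1. -/
theorem abs_sub_one_le_mul_div {R : ℝ} (hR : 1 ≤ R) (x : ℝ) :
    |x| - 1 ≤ R ^ 2 * ((x / R) ^ 2 / max 1 |x / R|) := by
  have hR0 : 0 < R := by linarith
  have hm : 0 < max 1 |x / R| := lt_max_of_lt_left one_pos
  have e : R ^ 2 * ((x / R) ^ 2 / max 1 |x / R|) = |x| ^ 2 / max 1 |x / R| := by
    rw [sq_abs]; field_simp
  rw [e, le_div_iff₀ hm]
  have hx := abs_nonneg x
  have h1 : max 1 |x / R| ≤ max 1 |x| := by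
    refine max_le_max le_rfl ?_
    rw [abs_div, abs_of_pos hR0]
    exact div_le_self hx hR
  rcases le_total |x| 1 with h | h
  · have : (|x| - 1) * max 1 |x / R| ≤ 0 := mul_nonpos_of_nonpos_of_nonneg (by linarith) hm.le
    nlinarith
  · rw [max_eq_right h] at h1
    nlinarith

theorem tendsto_hingeLaplace {a θ : ℝ} (ha : 0 < a) (hθ : 0 < θ) {l : Filter ℝ} {t s : ℝ → ℝ}
    (ht : Tendsto t l (𝓝 θ)) (hs : Tendsto s l (𝓝 0)) :
    Tendsto (fun u => hingeLaplace a (t u) (s u)) l (𝓝 ((a / (θ * (θ + a)) : ℝ) : ℂ)) := by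
  have ht' := (Complex.continuous_ofReal.tendsto θ).comp ht
  have hs' := ((Complex.continuous_ofReal.tendsto 0).comp hs).mul_const Complex.I
  have h : Tendsto (fun u => (a : ℂ) / (((t u : ℂ) + s u * Complex.I) *
      (t u + a + s u * Complex.I))) l
      (𝓝 ((a : ℂ) / ((θ + (0 : ℝ) * Complex.I) * (θ + a + (0 : ℝ) * Complex.I)))) := by
    refine tendsto_const_nhds.div ((ht'.add hs').mul ((ht'.add_const _).add hs')) ?_
    simp only [Complex.ofReal_zero, zero_mul, add_zero]
    exact_mod_cast (mul_pos hθ (add_pos hθ ha)).ne'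
  convert! h using 2
  push_cast
  simp

section

variable {θ : ℝ} {t : ℝ → ℝ}

/-- Dominated convergence on the scale s = x/√n: the transform tends to its value at s = 0, the
phase to 1, and the characteristic function to a Gaussian, whose integral gives the square root. -/
theorem tendsto_integral_tiltChar (hτ : 3 < τ) (hτ' : τ < 4) (hθ : 0 < θ)
    (ht : Tendsto t atTop (𝓝 θ)) {a : ℝ} (ha : 0 < a) (c : ℝ) :
    Tendsto (fun u : ℝ => ∫ x : ℝ, hingeLaplace a (t u) (x / u ^ ((τ - 1) / 2)) *
        (Complex.exp (((x / u ^ ((τ - 1) / 2) : ℝ) : ℂ) * (c : ℝ) * Complex.I) *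
          tiltChar τ u (t u) (x / u ^ ((τ - 1) / 2)))) atTop
      (𝓝 ((a / (θ * (θ + a)) * √(2 * Real.pi / tiltVarInt (alpha τ) θ) : ℝ) : ℂ)) := by
  obtain ⟨C, hC, hbound⟩ := exists_norm_tiltChar_le hτ hτ' (Θ := 2 * θ)
  have hRtop : Tendsto (fun u : ℝ => u ^ ((τ - 1) / 2)) atTop atTop :=
    tendsto_rpow_atTop (by linarith)
  have hgauss : ((a / (θ * (θ + a)) * √(2 * Real.pi / tiltVarInt (alpha τ) θ) : ℝ) : ℂ) =
      ∫ x : ℝ, ((a / (θ * (θ + a)) : ℝ) : ℂ) *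
        ((1 : ℂ) * (Real.exp (-(tiltVarInt (alpha τ) θ * x ^ 2 / 2)) : ℂ)) := by
    have h := integral_gaussian (tiltVarInt (alpha τ) θ / 2)
    have e : ∀ x : ℝ, -(tiltVarInt (alpha τ) θ * x ^ 2 / 2) = -(tiltVarInt (alpha τ) θ / 2) * x ^ 2 :=
      fun x => by ring
    simp_rw [e, one_mul]
    rw [integral_const_mul, integral_complex_ofReal, h, ← Complex.ofReal_mul]
    congr 3
    rw [div_div_eq_mul_div, mul_comm]
  rw [hgauss]
  have hev : ∀ᶠ u : ℝ in atTop, 1 < u ∧ θ / 2 ≤ t u ∧ t u ≤ 2 * θ :=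
    (eventually_gt_atTop 1).and ((ht.eventually (eventually_ge_nhds (by linarith))).and
      (ht.eventually (eventually_le_nhds (by linarith))))
  refine tendsto_integral_filter_of_dominated_convergence
    (fun x => a / (θ / 2) ^ 2 * (Real.exp C * Real.exp (-(C * |x|)))) ?_ ?_
    (((integrable_exp_neg_mul_abs hC).const_mul _).const_mul _) (ae_of_all _ fun x => ?_)
  · filter_upwards [hev] with u ⟨hu, hu1, hu2⟩
    have hdiv : Continuous fun x : ℝ => x / u ^ ((τ - 1) / 2) := continuous_id.div_const _
    refine AEStronglyMeasurable.mul (Continuous.aestronglyMeasurable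
      ((continuous_hingeLaplace ha (by linarith)).comp hdiv)) ?_
    refine AEStronglyMeasurable.mul (Continuous.aestronglyMeasurable (by fun_prop)) ?_
    exact ((stronglyMeasurable_tiltChar hτ hτ' (by linarith) _).comp_measurable
      hdiv.measurable).aestronglyMeasurable
  · filter_upwards [hev] with u ⟨hu, hu1, hu2⟩
    refine ae_of_all _ fun x => ?_
    have ht0 : 0 < t u := by linarith
    have hR : 1 ≤ u ^ ((τ - 1) / 2) := Real.one_le_rpow hu.le (by linarith)
    have hRsq : u ^ (τ - 1) = (u ^ ((τ - 1) / 2)) ^ 2 := by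
      rw [← Real.rpow_natCast, ← Real.rpow_mul (by linarith)]
      congr 1; push_cast; ring
    rw [norm_mul, norm_mul, ← Complex.ofReal_mul, Complex.norm_exp_ofReal_mul_I, one_mul]
    refine mul_le_mul ?_ ?_ (norm_nonneg _) (by positivity)
    · refine (norm_hingeLaplace_le ha ht0 _).trans ?_
      refine div_le_div_of_nonneg_left ha.le (by positivity) ?_
      nlinarith [sq_nonneg (x / u ^ ((τ - 1) / 2))]
    · refine (hbound (t u) ht0.le hu2 u hu _).trans ?_
      rw [← Real.exp_add, Real.exp_le_exp, hRsq]
      nlinarith [abs_sub_one_le_mul_div hR x]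
  · have hs : Tendsto (fun u : ℝ => x / u ^ ((τ - 1) / 2)) atTop (𝓝 0) :=
      tendsto_const_nhds.div_atTop hRtop
    refine (tendsto_hingeLaplace ha hθ ht hs).mul (Tendsto.mul ?_ (tendsto_tiltChar hτ hτ' hθ ht x))
    have hcont : Continuous fun y : ℝ => Complex.exp ((y : ℂ) * (c : ℝ) * Complex.I) := by fun_prop
    have h := (hcont.tendsto 0).comp hs
    simp only [Complex.ofReal_zero, zero_mul, Complex.exp_zero] at h
    exact h

variable {Ω : Type*} [MeasurableSpace Ω] {P : Measure Ω} [IsProbabilityMeasure P]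
  {T : ℕ → Ω → ℝ} {β : ℝ}

/-- At the tilt t(u) the mean is zero, so the only phase left is that of the fixed shift c,
invisible at frequency x/√n. The factor u^{(τ-1)/2} is the Jacobian of the rescaling. -/
theorem tendsto_integral_hinge_process (hτ : 3 < τ) (hτ' : τ < 4)
    (hind : iIndepFun (fun n : ℕ => T (n + 2)) P)
    (hT : ∀ i : ℕ, 2 ≤ i → HasLaw (T i) (expMeasure (coeff τ i)) P) (hθ : 0 < θ)
    (ht : Tendsto t atTop (𝓝 θ)) (htz : ∀ᶠ u in atTop, tiltMean τ β u (t u) = 0)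
    {a : ℝ} (ha : 0 < a) (c : ℝ) :
    Tendsto (fun u : ℝ => u ^ ((τ - 1) / 2) / Real.exp (logMgf τ β u (t u)) *
        ∫ ω, hinge a (c + u * process τ β T u ω) ∂P) atTop
      (𝓝 (Real.exp (θ * c) / (2 * Real.pi) *
        (a / (θ * (θ + a)) * √(2 * Real.pi / tiltVarInt (alpha τ) θ)))) := by
  have hE : Tendsto (fun u => Real.exp (t u * c) / (2 * Real.pi)) atTop
      (𝓝 (Real.exp (θ * c) / (2 * Real.pi))) :=
    ((Real.continuous_exp.tendsto _).comp (ht.mul_const c)).div_const _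
  have h := hE.smul (tendsto_integral_tiltChar hτ hτ' hθ ht ha c)
  have hre := (Complex.continuous_re.tendsto _).comp h
  rw [Complex.real_smul, ← Complex.ofReal_mul, Complex.ofReal_re] at hre
  refine hre.congr' ?_
  filter_upwards [htz, eventually_gt_atTop 0, ht.eventually (eventually_gt_nhds hθ)]
    with u hz hu ht0
  have hR : 0 < u ^ ((τ - 1) / 2) := Real.rpow_pos_of_pos hu _
  have hform := integral_hinge_process hτ hτ' hind hT β hu ha ht0 c
  rw [hz, add_zero] at hform
  have hsub := Measure.integral_comp_div (fun s : ℝ => hingeLaplace a (t u) s *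
    (Complex.exp (s * (c : ℝ) * Complex.I) * tiltChar τ u (t u) s)) (u ^ ((τ - 1) / 2))
  rw [Function.comp_apply, hsub, abs_of_pos hR]
  have h2 : ((u ^ ((τ - 1) / 2) / Real.exp (logMgf τ β u (t u)) *
      ∫ ω, hinge a (c + u * process τ β T u ω) ∂P : ℝ) : ℂ) =
      (Real.exp (t u * c) / (2 * Real.pi)) • u ^ ((τ - 1) / 2) • ∫ s : ℝ, hingeLaplace a (t u) s *
        (Complex.exp (s * (c : ℝ) * Complex.I) * tiltChar τ u (t u) s) := by
    rw [Complex.ofReal_mul, hform, ← Complex.real_smul, smul_smul, smul_smul, Real.exp_add]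
    congr 1
    have := Real.exp_pos (logMgf τ β u (t u))
    field_simp
  rw [← h2, Complex.ofReal_re]

theorem aemeasurable_process (hτ : 3 < τ) (hτ' : τ < 4)
    (hind : iIndepFun (fun n : ℕ => T (n + 2)) P)
    (hT : ∀ i : ℕ, 2 ≤ i → HasLaw (T i) (expMeasure (coeff τ i)) P) (β : ℝ) {u : ℝ} (hu : 0 < u) :
    AEMeasurable (process τ β T u) P := by
  refine aemeasurable_of_tendsto_metrizable_ae atTop (fun N => ?_)
    ((ae_tendsto_partialProcess hτ hτ' hind hT β hu.le).mono fun ω h =>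
      (tendsto_add_atTop_iff_nat 1).2 h)
  have e : (partialProcess τ β T (N + 1) u) =
      fun ω => u⁻¹ * (u * (1 + β * u) + jumpSum τ T u N ω) := by
    ext ω
    rw [← mul_partialProcess_succ, inv_mul_cancel_left₀ hu.ne']
  rw [e]
  exact ((aemeasurable_jumpSum hT u N).const_add _).const_mul _

theorem integral_hinge_le_measureReal {Y : Ω → ℝ} (hY : AEMeasurable Y P) {a u : ℝ} (ha : 0 ≤ a)
    (hu : 0 ≤ u) : ∫ ω, hinge a (0 + u * Y ω) ∂P ≤ P.real {ω | 0 < Y ω} := by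
  have hset : NullMeasurableSet {ω | 0 < Y ω} P := hY.nullMeasurable measurableSet_Ioi
  have h1 : P.real {ω | 0 < Y ω} = ∫ ω, {ω | 0 < Y ω}.indicator (fun _ => (1 : ℝ)) ω ∂P := by
    rw [integral_indicator₀ hset, setIntegral_const, smul_eq_mul, mul_one]
  rw [h1]
  refine integral_mono_of_nonneg (ae_of_all _ fun ω => hinge_nonneg _ _)
    ((integrable_const _).indicator₀ hset) (ae_of_all _ fun ω => ?_)
  by_cases h : 0 < Y ω
  · simpa [h] using hinge_le_one _ _
  · have h2 : hinge a (0 + u * Y ω) = 0 :=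
      hinge_of_nonpos ha (by rw [zero_add]; exact mul_nonpos_of_nonneg_of_nonpos hu (not_lt.1 h))
    simp only [h2, Set.indicator_of_notMem (show ω ∉ {ω | 0 < Y ω} from h), le_refl]

theorem mul_measureReal_le_integral_hinge {Y : Ω → ℝ} (hY : AEMeasurable Y P) {a u δ : ℝ}
    (ha : 0 ≤ a) (hu : 0 ≤ u) (hδ : 0 ≤ δ) :
    (1 - Real.exp (-(a * δ))) * P.real {ω | 0 < Y ω} ≤ ∫ ω, hinge a (δ + u * Y ω) ∂P := by
  have hset : NullMeasurableSet {ω | 0 < Y ω} P := hY.nullMeasurable measurableSet_Ioi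
  have h1 : (1 - Real.exp (-(a * δ))) * P.real {ω | 0 < Y ω} =
      ∫ ω, {ω | 0 < Y ω}.indicator (fun _ => 1 - Real.exp (-(a * δ))) ω ∂P := by
    rw [integral_indicator₀ hset, setIntegral_const, smul_eq_mul, mul_comm]
  rw [h1]
  refine integral_mono ((integrable_const _).indicator₀ hset) ?_ fun ω => ?_
  · refine Integrable.mono' (integrable_const (1 : ℝ)) ?_ (ae_of_all _ fun ω => ?_)
    · exact ((continuous_hinge a).measurable.comp_aemeasurable
        ((hY.const_mul u).const_add δ)).aestronglyMeasurable
    · rw [Real.norm_of_nonneg (hinge_nonneg _ _)]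
      exact hinge_le_one _ _
  · by_cases h : 0 < Y ω
    · have h0 : 0 ≤ u * Y ω := mul_nonneg hu h.le
      have : 1 - Real.exp (-(a * δ)) ≤ hinge a (δ + u * Y ω) := by
        rw [hinge_of_nonneg ha (by linarith)]
        have : Real.exp (-(a * (δ + u * Y ω))) ≤ Real.exp (-(a * δ)) :=
          Real.exp_le_exp.2 (by nlinarith)
        linarith
      simpa [h] using this
    · simpa [h] using hinge_nonneg _ _

/-- The hinge lies below the indicator, and shifted by δ it is at least 1 - e^{-aδ} on {S_u > 0}.
With a = m² and δ = 1/m, as m → ∞, all of a/(θ + a), e^{θδ} and 1 - e^{-aδ} tend to 1, so the bounds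
meet. The limit in u is taken first, for fixed m. -/
theorem tendsto_measureReal_process (hτ : 3 < τ) (hτ' : τ < 4)
    (hind : iIndepFun (fun n : ℕ => T (n + 2)) P)
    (hT : ∀ i : ℕ, 2 ≤ i → HasLaw (T i) (expMeasure (coeff τ i)) P) (hθ : 0 < θ)
    (ht : Tendsto t atTop (𝓝 θ)) (htz : ∀ᶠ u in atTop, tiltMean τ β u (t u) = 0) :
    Tendsto (fun u : ℝ => u ^ ((τ - 1) / 2) / Real.exp (logMgf τ β u (t u)) *
        P.real {ω | 0 < process τ β T u ω}) atTop
      (𝓝 (1 / (2 * Real.pi) * (1 / θ * √(2 * Real.pi / tiltVarInt (alpha τ) θ)))) := by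
  set L := √(2 * Real.pi / tiltVarInt (alpha τ) θ)
  have hsq : Tendsto (fun m : ℝ => m ^ 2) atTop atTop := tendsto_pow_atTop two_ne_zero
  have hfrac : Tendsto (fun m : ℝ => m ^ 2 / (θ * (θ + m ^ 2))) atTop (𝓝 (1 / θ)) := by
    have h1 : Tendsto (fun m : ℝ => θ / m ^ 2) atTop (𝓝 0) := tendsto_const_nhds.div_atTop hsq
    have h2 : Tendsto (fun m : ℝ => 1 / (θ * (θ / m ^ 2 + 1))) atTop (𝓝 (1 / (θ * (0 + 1)))) :=
      tendsto_const_nhds.div ((h1.add_const 1).const_mul θ) (by simpa using hθ.ne')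
    rw [zero_add, mul_one] at h2
    refine h2.congr' ?_
    filter_upwards [eventually_gt_atTop 0] with m hm
    field_simp
  have hpos : ∀ᶠ u : ℝ in atTop,
      0 < u ∧ 0 < u ^ ((τ - 1) / 2) / Real.exp (logMgf τ β u (t u)) := by
    filter_upwards [eventually_gt_atTop 0] with u hu
    exact ⟨hu, div_pos (Real.rpow_pos_of_pos hu _) (Real.exp_pos _)⟩
  refine tendsto_order.2 ⟨fun l hl => ?_, fun l hl => ?_⟩
  · have hF : Tendsto (fun m : ℝ => Real.exp (θ * 0) / (2 * Real.pi) *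
        (m ^ 2 / (θ * (θ + m ^ 2)) * L)) atTop (𝓝 (1 / (2 * Real.pi) * (1 / θ * L))) := by
      rw [mul_zero, Real.exp_zero]
      exact (hfrac.mul_const L).const_mul _
    obtain ⟨m, hm, hm0⟩ := ((hF.eventually (eventually_gt_nhds hl)).and
      (eventually_gt_atTop 0)).exists
    have hlim := tendsto_integral_hinge_process (β := β) hτ hτ' hind hT hθ ht htz (pow_pos hm0 2) 0
    filter_upwards [hlim.eventually (eventually_gt_nhds hm), hpos] with u h1 ⟨hu, h2⟩
    exact h1.trans_le (mul_le_mul_of_nonneg_left (integral_hinge_le_measureReal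
      (aemeasurable_process hτ hτ' hind hT β hu) (by positivity) hu.le) h2.le)
  · have hF : Tendsto (fun m : ℝ => (1 - Real.exp (-m))⁻¹ * (Real.exp (θ * m⁻¹) / (2 * Real.pi) *
        (m ^ 2 / (θ * (θ + m ^ 2)) * L))) atTop (𝓝 (1 / (2 * Real.pi) * (1 / θ * L))) := by
      have h1 : Tendsto (fun m : ℝ => (1 - Real.exp (-m))⁻¹) atTop (𝓝 1) := by
        have h := (Real.tendsto_exp_neg_atTop_nhds_zero.const_sub 1).inv₀ (by norm_num)
        simpa using h
      have h2 : Tendsto (fun m : ℝ => Real.exp (θ * m⁻¹)) atTop (𝓝 1) := by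
        have h := (Real.continuous_exp.tendsto _).comp (tendsto_inv_atTop_zero.const_mul θ)
        rw [mul_zero, Real.exp_zero] at h
        exact h
      have h := h1.mul ((h2.div_const (2 * Real.pi)).mul (hfrac.mul_const L))
      rwa [one_mul] at h
    obtain ⟨m, hm, hm0⟩ := ((hF.eventually (eventually_lt_nhds hl)).and
      (eventually_gt_atTop 0)).exists
    have hlim := (tendsto_integral_hinge_process (β := β) hτ hτ' hind hT hθ ht htz (pow_pos hm0 2)
      m⁻¹).const_mul (1 - Real.exp (-m))⁻¹
    filter_upwards [hlim.eventually (eventually_lt_nhds hm), hpos] with u h1 ⟨hu, h2⟩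
    refine lt_of_le_of_lt ?_ h1
    have hq : 0 < 1 - Real.exp (-m) := by
      have : Real.exp (-m) < 1 := Real.exp_lt_one_iff.2 (by linarith)
      linarith
    have h3 := mul_measureReal_le_integral_hinge (aemeasurable_process hτ hτ' hind hT β hu)
      (a := m ^ 2) (u := u) (δ := m⁻¹) (by positivity) hu.le (by positivity)
    have e : m ^ 2 * m⁻¹ = m := by field_simp
    rw [e] at h3
    rw [inv_mul_eq_div, le_div_iff₀ hq, mul_assoc]
    refine mul_le_mul_of_nonneg_left ?_ h2.le
    linarith

end

end ThinnedLevy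

/-! ### Assembly of the constants and the main theorem -/

theorem ThinnedLevy.isEquivalent_measureReal_process {τ : ℝ} (hτ : 3 < τ) (hτ' : τ < 4) {θ : ℝ}
    (hθ : 0 < θ) (h0 : ThinnedLevy.dcgfInt (ThinnedLevy.alpha τ) θ = 0) (β : ℝ) {Ω : Type*}
    [MeasurableSpace Ω] {P : Measure Ω} [IsProbabilityMeasure P] {T : ℕ → Ω → ℝ}
    (hind : iIndepFun (fun n : ℕ => T (n + 2)) P)
    (hT : ∀ i : ℕ, 2 ≤ i → HasLaw (T i) (expMeasure (ThinnedLevy.coeff τ i)) P) :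
    (fun u : ℝ => P.real {ω | 0 < ThinnedLevy.process τ β T u ω}) ~[atTop]
      (fun u : ℝ => (2 * Real.pi * ThinnedLevy.varConst τ θ) ^ (-(1 / 2) : ℝ) / θ /
        u ^ ((τ - 1) / 2) *
          Real.exp (ThinnedLevy.exponent τ β (-ThinnedLevy.Lam τ θ) u)) := by
  obtain ⟨h1, h2⟩ := ThinnedLevy.alpha_bounds hτ hτ'
  obtain ⟨t, ht, htz⟩ := ThinnedLevy.exists_tilt hτ hτ' β h0
  have hlim := ThinnedLevy.tendsto_measureReal_process hτ hτ' hind hT hθ ht htz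
  have hV := ThinnedLevy.tiltVarInt_pos h1 h2 θ
  rw [ThinnedLevy.varConst_eq (by linarith)]
  set V := ThinnedLevy.tiltVarInt (ThinnedLevy.alpha τ) θ
  have hD : 1 / (2 * Real.pi) * (1 / θ * √(2 * Real.pi / V)) =
      (2 * Real.pi * V) ^ (-(1 / 2) : ℝ) / θ := by
    have hπ := Real.pi_pos
    have e : (2 * Real.pi * V) ^ (-(1 / 2) : ℝ) = √(2 * Real.pi / V) / (2 * Real.pi) := by
      rw [Real.rpow_neg (by positivity), ← Real.sqrt_eq_rpow, ← Real.sqrt_inv,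
        Real.sqrt_eq_iff_mul_self_eq (by positivity) (by positivity), div_mul_div_comm,
        Real.mul_self_sqrt (by positivity)]
      field_simp
    rw [e]
    field_simp
  rw [hD] at hlim
  set D := (2 * Real.pi * V) ^ (-(1 / 2) : ℝ) / θ
  have hD0 : 0 < D := div_pos (Real.rpow_pos_of_pos (by positivity) _) hθ
  -- An error o(1) in the exponent is a factor 1 + o(1), so the exact saddle point value may be
  -- replaced by its expansion.
  have hexp : Tendsto (fun u => Real.exp (ThinnedLevy.logMgf τ β u (t u) -
      ThinnedLevy.exponent τ β (-ThinnedLevy.Lam τ θ) u)) atTop (𝓝 1) := by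
    have h := (ThinnedLevy.tendsto_logMgf_sub_perturbedMin hτ hτ' β hθ h0 ht htz).add
      (ThinnedLevy.tendsto_rpow_mul_perturbedMin_sub hτ hτ' β h0)
    rw [add_zero] at h
    have h3 := (Real.continuous_exp.tendsto _).comp h
    rw [Real.exp_zero] at h3
    refine h3.congr fun u => ?_
    rw [Function.comp_apply, sub_add_sub_cancel]
  refine Asymptotics.isEquivalent_of_tendsto_one ?_
  have h4 := (hlim.div_const D).mul hexp
  rw [div_self hD0.ne', one_mul] at h4
  refine h4.congr' ?_
  filter_upwards [eventually_gt_atTop 0] with u hu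
  have hR : 0 < u ^ ((τ - 1) / 2) := Real.rpow_pos_of_pos hu _
  rw [Pi.div_apply, Real.exp_sub]
  have e1 := Real.exp_pos (ThinnedLevy.logMgf τ β u (t u))
  have e2 := Real.exp_pos (ThinnedLevy.exponent τ β (-ThinnedLevy.Lam τ θ) u)
  field_simp

theorem theorem1p1 (τ : ℝ) (hτ : 3 < τ) (hτ' : τ < 4) :
    ∃ θ I D : ℝ, 0 < θ ∧ 0 < I ∧ 0 < D ∧
      -- `Λ` is well defined, `θ` is its unique minimizer, and `I = -min Λ`
      (∀ ϑ : ℝ, IntegrableOn (ThinnedLevy.f τ ϑ) (Set.Ioi 0)) ∧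
      (∀ ϑ : ℝ, ϑ ≠ θ → ThinnedLevy.Lam τ θ < ThinnedLevy.Lam τ ϑ) ∧
      I = -ThinnedLevy.Lam τ θ ∧
      -- `I_V(1)` is a convergent integral, and `D = (2 π I_V(1))^{-1/2} / θ`
      IntegrableOn (ThinnedLevy.varIntegrand τ θ) (Set.Ioi 0) ∧
      0 < ThinnedLevy.varConst τ θ ∧
      D = (2 * Real.pi * ThinnedLevy.varConst τ θ) ^ (-(1 / 2) : ℝ) / θ ∧
      -- the Taylor coefficients that define `κ_ij` exist
      ContDiffAt ℝ ((⊤ : ℕ∞) : WithTop ℕ∞) (ThinnedLevy.perturbedMin τ) 0 ∧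
      ∀ (β : ℝ) {Ω : Type*} [MeasurableSpace Ω] (P : Measure Ω) [IsProbabilityMeasure P]
        (T : ℕ → Ω → ℝ),
        iIndepFun (fun n : ℕ => T (n + 2)) P →
        (∀ i : ℕ, 2 ≤ i → HasLaw (T i) (expMeasure (ThinnedLevy.coeff τ i)) P) →
        -- the series that defines `S_t` converges almost surely
        (∀ t : ℝ, 0 ≤ t → ∀ᵐ ω ∂P,
          Tendsto (fun N : ℕ => ThinnedLevy.partialProcess τ β T N t ω) atTop
            (𝓝 (ThinnedLevy.process τ β T t ω))) ∧
        -- the tail asymptotics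
        (fun u : ℝ => P.real {ω | 0 < ThinnedLevy.process τ β T u ω}) ~[atTop]
          (fun u : ℝ => D / u ^ ((τ - 1) / 2) * Real.exp (ThinnedLevy.exponent τ β I u)) := by
  obtain ⟨h1, h2⟩ := ThinnedLevy.alpha_bounds hτ hτ'
  obtain ⟨θ, hθ, h0⟩ := ThinnedLevy.exists_pos_dcgfInt_eq_zero h1 h2
  have hmin : ∀ ϑ : ℝ, ϑ ≠ θ → ThinnedLevy.Lam τ θ < ThinnedLevy.Lam τ ϑ := fun ϑ hne => by
    have h := ThinnedLevy.cgfInt_lt h1 h2 (e := 0) (by rw [h0, neg_zero]) hne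
    simpa only [mul_zero, add_zero, ThinnedLevy.Lam_eq_cgfInt] using h
  -- Λ(0) = 0 and 0 is not the minimiser, so the minimum is negative.
  have hI : 0 < -ThinnedLevy.Lam τ θ := by
    have h := hmin 0 hθ.ne
    rw [ThinnedLevy.Lam_eq_cgfInt τ 0, ThinnedLevy.cgfInt_zero] at h
    linarith
  have hV : 0 < ThinnedLevy.varConst τ θ := by
    rw [ThinnedLevy.varConst_eq (by linarith)]
    exact ThinnedLevy.tiltVarInt_pos h1 h2 θ
  have hf : ∀ ϑ : ℝ, IntegrableOn (ThinnedLevy.f τ ϑ) (Set.Ioi 0) := fun ϑ =>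
    (ThinnedLevy.integrableOn_cgf h1 h2 ϑ).congr_fun
      (fun x hx => (ThinnedLevy.f_eq_cgf hx).symm) measurableSet_Ioi
  refine ⟨θ, _, _, hθ, hI, div_pos (Real.rpow_pos_of_pos (mul_pos Real.two_pi_pos hV) _) hθ, hf,
    hmin, rfl, ThinnedLevy.integrableOn_varIntegrand (by linarith) h1 h2 θ, hV, rfl,
    ThinnedLevy.contDiffAt_perturbedMin hτ hτ', ?_⟩
  intro β Ω _ P _ T hind hT
  exact ⟨fun t ht => ThinnedLevy.ae_tendsto_partialProcess hτ hτ' hind hT β ht,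
    ThinnedLevy.isEquivalent_measureReal_process hτ hτ' hθ h0 β hind hT⟩
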